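/- Let $H$ be a real Hilbert space and let $A:\mathcal D(A)\subset H\to H$ be a densely defined, self-adjoint, positive definite linear operator with compact inverse. Let $\{e_k\}$ be an orthonormal basis of $H$ with $Ae_k=\lambda_ke_k$, $\lambda_k>0$, and for $s\in\mathbb R$ put $A^sv=\sum_k\lambda_k^s(v,e_k)e_k$, with domain $\mathcal D(A^s)=\{v:\sum_k\lambda_k^{2s}(v,e_k)^2<\infty\}$. For $b\in L^1_{\mathrm{loc}}([0,\infty))$ real-valued put $B(t)=\int_0^tb(s)\,ds$ and $\hat b(\lambda)=\int_0^\infty e^{-\lambda t}b(t)\,dt$. The resolvent family $\{S(t)\}_{t\ge0}\subset\mathcal L(H)$ is the strongly continuous family such that $u(t)=S(t)u_0$ satisfies $u(t)+A\int_0^tB(t-s)u(s)\,ds=u_0$ for all $t\ge0$ and $u_0\in H$; $\dot S(t)$, $t>0$, denotes its strong derivative. Let $\alpha(b)=\sup\{|\arg\hat b(\lambda)|:\operatorname{Re}\lambda>0\}$. **(I)** Suppose that $0\ne b\in L^1_{\mathrm{loc}}([0,\infty))$ satisfies: - $\int_0^\infty e^{-\varepsilon t}|b(t)|\,dt<\infty$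 for all $\varepsilon>0$ (subexponential growth); - there is $C>0$ with $|\lambda|^j|\hat b^{(j)}(\lambda)|\le C|\hat b(\lambda)|$ for $\operatorname{Re}\lambda>0$, $0\le j\le2$ (2-regularity); - $\hat b(\lambda)\ne 0$ for $\operatorname{Re}\lambda>0$ and $\alpha(b)<\pi/2$ (sectoriality); - the boundary function $g(k)=\lim_{\varepsilon\to0+}\hat b(\varepsilon+ik)$ is three times differentiable on $(0,\infty)$, $k\mapsto g(k)/(|k|+|g(k)|)$ belongs to $L^p(\mathbb R)$ for some $1\le p<\infty$, and there are $C>0$ and $1<\rho<2$ such that for all $\mu>0$ $$\int_0^\infty\frac{|g(k)|}{(|k|+\mu|g(k)|)^2}\,dk\le\frac C\mu,\qquad \int_0^\infty\frac{|k^2g'''(k)|+|kg''(k)|+|g'(k)|+1/\mu}{(|k|+\mu|g(k)|)^2}\,dk\le\frac C{\mu^{1+1/\rho}}.$$ Then the resolvent family $S$ exists, it is strongly differentiable on $(0,\infty)$ with $\dot S(t)\in\mathcal L(H)$, and there is $C>0$, independent of $t$ and $s$, such that for all $t>0$ $$\|A^sS(t)\|_{\mathcal L(H)}\le Ct^{-s\rho}\quad(s\in[0,1/\rho]),$$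 $$\|A^s\dot S(t)\|_{\mathcal L(H)}\le Ct^{-s\rho-1}\quad(s\in[0,1/\rho]),$$ $$\|A^{-s}\dot S(t)\|_{\mathcal L(H)}\le C\|b\|_{L^1(0,t)}^s\,t^{s-1}\quad(s\in[0,1]);$$ in particular $S(t)$ and $\dot S(t)$ map $H$ into $\mathcal D(A^s)$ for $t>0$ and $s\in[0,1/\rho]$. **(II)** Suppose that $0\ne b\in L^1_{\mathrm{loc}}([0,\infty))$ is 4-monotone (that is, $b\in C^2(0,\infty)$, $(-1)^nb^{(n)}\ge0$ on $(0,\infty)$ for $0\le n\le2$, and $b''$ is nonincreasing and convex on $(0,\infty)$), that $\lim_{t\to\infty}b(t)=0$, and that $$\limsup_{t\to0,\infty}\frac{\frac1t\int_0^tsb(s)\,ds}{\int_0^t-s\dot b(s)\,ds}<+\infty .$$ Let $\rho=1+\frac2\pi\alpha(b)$ and suppose that $\hat b(\lambda)\sim\lambda^{1-\rho}$ as $\lambda\to\infty$ along the positive reals, in the sense that $c\lambda^{1-\rho}\le\hat b(\lambda)\le C\lambda^{1-\rho}$ for all large $\lambda$, with constants $c,C>0$. Then the resolvent family $S$ exists,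 it is strongly differentiable on $(0,\infty)$ with $\dot S(t)\in\mathcal L(H)$, and there is $C>0$ such that $$\|A^{-s}\dot S(t)\|_{\mathcal L(H)}\le Ct^{\rho s-1},\qquad t>0,\ s\in[0,1].$$ -/

import Mathlib

open MeasureTheory Filter Topology
open scoped InnerProductSpace

namespace Volterra

noncomputable section

/-! ### Convolution kernels -/

/-- The Laplace transform of `b` on the half-line `(0, ∞)`. -/
def laplace (b : ℝ → ℝ) (z : ℂ) : ℂ :=
  ∫ t in Set.Ioi (0 : ℝ), Complex.exp (-(z * t)) * (b t : ℂ)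

/-- `b` is of subexponential growth: `∫₀^∞ e^{-εt} |b(t)| dt < ∞` for every `ε > 0`. -/
def IsSubexponential (b : ℝ → ℝ) : Prop :=
  ∀ ε : ℝ, 0 < ε → IntegrableOn (fun t => Real.exp (-(ε * t)) * b t) (Set.Ioi 0)

/-- `b` is `m`-regular: `|z|^j |b̂^{(j)}(z)| ≤ C |b̂(z)|` for `Re z > 0` and `0 ≤ j ≤ m`. -/
def IsRegularKernel (m : ℕ) (b : ℝ → ℝ) : Prop :=
  ∃ C : ℝ, 0 < C ∧ ∀ z : ℂ, 0 < z.re → ∀ j : ℕ, j ≤ m →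
    ‖z‖ ^ j * ‖iteratedDeriv j (laplace b) z‖ ≤ C * ‖laplace b z‖

/-- `sup {|arg b̂(z)| : Re z > 0}`. The set is nonempty and bounded above by `π`. -/
def sectorAngle (b : ℝ → ℝ) : ℝ :=
  sSup ((fun z : ℂ => |(laplace b z).arg|) '' {z : ℂ | 0 < z.re})

/-- `b` is sectorial of angle less than `π/2`. That `arg b̂(z)` makes sense includes
`b̂(z) ≠ 0`. -/
def IsSectorial (b : ℝ → ℝ) : Prop :=
  (∀ z : ℂ, 0 < z.re → laplace b z ≠ 0) ∧ sectorAngle b < Real.pi / 2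

/-- The boundary function `g(k) = lim_{ε → 0+} b̂(ε + ik)`. -/
def boundaryFun (b : ℝ → ℝ) (k : ℝ) : ℂ :=
  limUnder (𝓝[>] (0 : ℝ)) (fun ε : ℝ => laplace b ((ε : ℂ) + (k : ℂ) * Complex.I))

/-- The standing assumption on the kernel, with the exponent `ρ` of the growth conditions.
The growth conditions are written with Lebesgue integrals in `[0, ∞]`, so that they include the
finiteness of the integrals. -/
structure KernelAssumption (b : ℝ → ℝ) (ρ : ℝ) : Prop where
  locallyIntegrable : LocallyIntegrableOn b (Set.Ici 0)
  ne_zero : ¬ b =ᵐ[volume.restrict (Set.Ioi 0)] 0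
  subexponential : IsSubexponential b
  regular : IsRegularKernel 2 b
  sectorial : IsSectorial b
  one_lt : 1 < ρ
  lt_two : ρ < 2
  /-- `k ↦ g(k) / (|k| + |g(k)|)` is in `L^p(ℝ)` for some `1 ≤ p < ∞`. -/
  memLp : ∃ p : ENNReal, 1 ≤ p ∧ p ≠ ⊤ ∧
    MemLp (fun k : ℝ => boundaryFun b k / ((|k| + ‖boundaryFun b k‖ : ℝ) : ℂ)) p volume
  /-- `g` is three times differentiable on `(0, ∞)`. -/
  differentiable : ∀ j < 3, DifferentiableOn ℝ (iteratedDeriv j (boundaryFun b)) (Set.Ioi 0)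
  growth : ∃ C : ℝ, 0 < C ∧ ∀ μ : ℝ, 0 < μ →
    (∫⁻ k in Set.Ioi (0 : ℝ),
        ENNReal.ofReal (‖boundaryFun b k‖ / (|k| + μ * ‖boundaryFun b k‖) ^ 2))
      ≤ ENNReal.ofReal (C / μ) ∧
    (∫⁻ k in Set.Ioi (0 : ℝ),
        ENNReal.ofReal
          ((k ^ 2 * ‖iteratedDeriv 3 (boundaryFun b) k‖ + |k| * ‖iteratedDeriv 2 (boundaryFun b) k‖
              + ‖deriv (boundaryFun b) k‖ + 1 / μ)
            / (|k| + μ * ‖boundaryFun b k‖) ^ 2))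
      ≤ ENNReal.ofReal (C / μ ^ (1 + 1 / ρ))

/-- `b` is `m`-monotone, `m ≥ 2`: it is `m - 2` times continuously differentiable on `(0, ∞)`,
`(-1)^n b^{(n)} ≥ 0` there for `n ≤ m - 2`, and `(-1)^{m-2} b^{(m-2)}` is nonincreasing and
convex. -/
def IsMonotoneKernel (m : ℕ) (b : ℝ → ℝ) : Prop :=
  2 ≤ m ∧ ContDiffOn ℝ ((m - 2 : ℕ) : ℕ∞) b (Set.Ioi 0) ∧
  (∀ n : ℕ, n ≤ m - 2 → ∀ t : ℝ, 0 < t → 0 ≤ (-1 : ℝ) ^ n * iteratedDeriv n b t) ∧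
  AntitoneOn (fun t => (-1 : ℝ) ^ (m - 2) * iteratedDeriv (m - 2) b t) (Set.Ioi 0) ∧
  ConvexOn ℝ (Set.Ioi 0) (fun t => (-1 : ℝ) ^ (m - 2) * iteratedDeriv (m - 2) b t)

/-- `0 ≠ b` is locally integrable, `4`-monotone, tends to `0` at infinity, and the quotient of
`t⁻¹ ∫₀ᵗ s b(s) ds` by `∫₀ᵗ -s b'(s) ds` has finite upper limits as `t → 0` and as `t → ∞`. -/
structure MonotoneKernelAssumption (b : ℝ → ℝ) : Prop where
  locallyIntegrable : LocallyIntegrableOn b (Set.Ici 0)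
  ne_zero : ¬ b =ᵐ[volume.restrict (Set.Ioi 0)] 0
  monotone : IsMonotoneKernel 4 b
  tendsto_zero : Tendsto b atTop (𝓝 0)
  smooth : ∃ M : ℝ, ∀ᶠ t in 𝓝[>] (0 : ℝ) ⊔ atTop,
    ((1 / t) * ∫ s in (0 : ℝ)..t, s * b s) / (∫ s in (0 : ℝ)..t, -(s * deriv b s)) ≤ M

/-! ### The operator and its fractional powers -/

variable {H : Type*} [NormedAddCommGroup H] [InnerProductSpace ℝ H] [CompleteSpace H]

/-- `A` is a densely defined, self-adjoint, positive definite operator with compact inverse. -/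
structure OperatorAssumption (A : H →ₗ.[ℝ] H) : Prop where
  dense : Dense (A.domain : Set H)
  selfAdjoint : IsSelfAdjoint A
  posDef : ∀ x : A.domain, (x : H) ≠ 0 → 0 < ⟪A x, (x : H)⟫_ℝ
  compactInverse : ∃ K : H →L[ℝ] H, IsCompactOperator K ∧
    (∀ x : A.domain, K (A x) = x) ∧ ∀ y : H, ∃ h : K y ∈ A.domain, A ⟨K y, h⟩ = y

theorem OperatorAssumption.symmetric {A : H →ₗ.[ℝ] H} (hA : OperatorAssumption A)
    (x y : A.domain) : ⟪A x, (y : H)⟫_ℝ = ⟪(x : H), A y⟫_ℝ := by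
  have h1 := LinearPMap.adjoint_isFormalAdjoint hA.dense
  have h2 : A.adjoint = A := hA.selfAdjoint
  rw [h2] at h1
  exact h1 x y

/-- `e` is in the domain of `A` and `A e = μ e`. -/
def IsEigenpair (A : H →ₗ.[ℝ] H) (μ : ℝ) (e : H) : Prop :=
  ∃ h : e ∈ A.domain, A ⟨e, h⟩ = μ • e

/-- The graph of `A^s`: all `(v, w)` with `(e, w) = μ^s (e, v)` for each eigenpair `(μ, e)`. -/
def fracPowGraph (A : H →ₗ.[ℝ] H) (s : ℝ) : Submodule ℝ (H × H) where
  carrier := {p | ∀ (μ : ℝ) (e : H), IsEigenpair A μ e → ⟪e, p.2⟫_ℝ = μ ^ s * ⟪e, p.1⟫_ℝ}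
  add_mem' := by
    intro p q hp hq μ e he
    simp only [Prod.snd_add, Prod.fst_add, inner_add_right, hp μ e he, hq μ e he]
    ring
  zero_mem' := by
    intro μ e _
    simp
  smul_mem' := by
    intro c p hp μ e he
    simp only [Prod.smul_snd, Prod.smul_fst, inner_smul_right, hp μ e he]
    ring

/-- The fractional power `A^s`, the operator with graph `fracPowGraph A s`. The two facts below
show that this is `A^s v = ∑ λ_k^s (v, e_k) e_k`, with domain the set of `v` such that
`∑ λ_k^{2s} (v, e_k)² < ∞`, for every orthonormal basis `e_k` with `A e_k = λ_k e_k`. -/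
def fracPow (A : H →ₗ.[ℝ] H) (s : ℝ) : H →ₗ.[ℝ] H :=
  (fracPowGraph A s).toLinearPMap

/-- The set `fracPowGraph A s` is the graph of an operator. -/
theorem fracPow_graph {A : H →ₗ.[ℝ] H} (hA : OperatorAssumption A) (s : ℝ) :
    (fracPow A s).graph = fracPowGraph A s := by
  refine Submodule.toLinearPMap_graph_eq _ ?_
  rintro ⟨v, w⟩ hx hv
  simp only at hv ⊢
  subst hv
  obtain ⟨K, hK, hl, hr⟩ := hA.compactInverse
  have hsymA := hA.symmetric
  have hKs : (K : H →ₗ[ℝ] H).IsSymmetric := by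
    intro x y
    obtain ⟨hx1, hx2⟩ := hr x
    obtain ⟨hy1, hy2⟩ := hr y
    have := hsymA ⟨K x, hx1⟩ ⟨K y, hy1⟩
    rw [hx2, hy2] at this
    exact this.symm
  have hbot := ContinuousLinearMap.orthogonalComplement_iSup_eigenspaces_eq_bot
    (T := K) hK hKs
  have hw : w ∈ (⨆ μ, Module.End.eigenspace (K : H →ₗ[ℝ] H) μ)ᗮ := by
    rw [← Submodule.iInf_orthogonal, Submodule.mem_iInf]
    intro ν
    rw [Submodule.mem_orthogonal]
    intro u hu
    have hu' : K u = ν • u := Module.End.mem_eigenspace_iff.mp hu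
    obtain ⟨h1, h2⟩ := hr u
    by_cases hν : ν = 0
    · have hz : u = 0 := by
        have h3 : (⟨K u, h1⟩ : A.domain) = 0 := by
          ext
          simp [hu', hν]
        rw [h3, LinearPMap.map_zero] at h2
        exact h2.symm
      simp [hz]
    · have hu1 : u ∈ A.domain := by
        have := A.domain.smul_mem ν⁻¹ h1
        rwa [hu', smul_smul, inv_mul_cancel₀ hν, one_smul] at this
      have h3 : (⟨K u, h1⟩ : A.domain) = ν • ⟨u, hu1⟩ := by
        ext
        simp [hu']
      rw [h3, LinearPMap.map_smul] at h2
      have h4 : IsEigenpair A ν⁻¹ u := by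
        refine ⟨hu1, ?_⟩
        rw [eq_inv_smul_iff₀ hν]
        exact h2
      simpa using hx ν⁻¹ u h4
  rw [hbot] at hw
  simpa using hw

/-- The series form of the fractional powers. -/
theorem fracPow_iff_series {A : H →ₗ.[ℝ] H} (hA : OperatorAssumption A) (s : ℝ) {ι : Type*}
    (e : HilbertBasis ι ℝ H) (lam : ι → ℝ) (he : ∀ k, IsEigenpair A (lam k) (e k)) (v : H) :
    (v ∈ (fracPow A s).domain ↔ Summable fun k => (lam k ^ s * ⟪e k, v⟫_ℝ) ^ 2) ∧
    ∀ h : v ∈ (fracPow A s).domain,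
      HasSum (fun k => (lam k ^ s * ⟪e k, v⟫_ℝ) • e k) (fracPow A s ⟨v, h⟩) := by
  have hsymA := hA.symmetric
  have key : ∀ h : v ∈ (fracPow A s).domain, ∀ k,
      ⟪e k, fracPow A s ⟨v, h⟩⟫_ℝ = lam k ^ s * ⟪e k, v⟫_ℝ := by
    intro h k
    have h1 : (v, fracPow A s ⟨v, h⟩) ∈ (fracPow A s).graph :=
      (fracPow A s).mem_graph ⟨v, h⟩
    rw [fracPow_graph hA] at h1
    exact h1 _ _ (he k)
  refine ⟨⟨fun h => ?_, fun hs => ?_⟩, fun h => ?_⟩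
  · have h1 := e.summable_inner_mul_inner (fracPow A s ⟨v, h⟩) (fracPow A s ⟨v, h⟩)
    refine h1.congr fun k => ?_
    rw [real_inner_comm, key h k]
    ring
  · have hmem : Memℓp (fun k => lam k ^ s * ⟪e k, v⟫_ℝ) 2 := by
      rw [memℓp_gen_iff (by norm_num)]
      exact hs.congr fun k => by simp [mul_pow]
    set w : H := e.repr.symm ⟨_, hmem⟩ with hwdef
    have hw : ∀ k, ⟪e k, w⟫_ℝ = lam k ^ s * ⟪e k, v⟫_ℝ := by
      intro k
      rw [← e.repr_apply_apply, hwdef, LinearIsometryEquiv.apply_symm_apply]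
    have hg : (v, w) ∈ fracPowGraph A s := by
      intro μ f hf
      simp only
      rw [← e.tsum_inner_mul_inner f w, ← e.tsum_inner_mul_inner f v, ← tsum_mul_left]
      refine tsum_congr fun k => ?_
      rw [hw k]
      by_cases h0 : ⟪f, e k⟫_ℝ = 0
      · simp [h0]
      · obtain ⟨hf1, hf2⟩ := hf
        obtain ⟨hk1, hk2⟩ := he k
        have h2 := hsymA ⟨f, hf1⟩ ⟨e k, hk1⟩
        rw [hf2, hk2] at h2
        simp only [real_inner_smul_left, real_inner_smul_right] at h2
        rw [mul_right_cancel₀ h0 h2]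
        ring
    rw [← fracPow_graph hA] at hg
    exact LinearPMap.mem_domain_of_mem_graph hg
  · have h1 := e.hasSum_repr (fracPow A s ⟨v, h⟩)
    refine h1.congr_fun ?_
    intro k
    rw [e.repr_apply_apply, key h k]

/-- `A^s R` is defined on all of `H`, and `‖A^s R‖ ≤ M` in operator norm. -/
def FracPowCompBound (A : H →ₗ.[ℝ] H) (s : ℝ) (R : H →L[ℝ] H) (M : ℝ) : Prop :=
  0 ≤ M ∧ ∀ v : H, ∃ h : R v ∈ (fracPow A s).domain, ‖fracPow A s ⟨R v, h⟩‖ ≤ M * ‖v‖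

/-! ### The resolvent family -/

/-- `S` is the resolvent family of `A` and `b`: it is strongly continuous on `[0, ∞)` and
`u(t) = S(t) v` solves `u(t) + A ∫₀ᵗ B(t - s) u(s) ds = v` for all `t ≥ 0` and `v ∈ H`, where
`B(t) = ∫₀ᵗ b(s) ds`. Only the values of `S` at `t ≥ 0` matter. -/
structure IsResolventFamily (A : H →ₗ.[ℝ] H) (b : ℝ → ℝ) (S : ℝ → H →L[ℝ] H) : Prop where
  continuousOn : ∀ v : H, ContinuousOn (fun t => S t v) (Set.Ici 0)
  equation : ∀ (v : H) (t : ℝ), 0 ≤ t →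
    ∃ h : (∫ s in (0 : ℝ)..t, (∫ r in (0 : ℝ)..(t - s), b r) • S s v) ∈ A.domain,
      S t v + A ⟨∫ s in (0 : ℝ)..t, (∫ r in (0 : ℝ)..(t - s), b r) • S s v, h⟩ = v

/-- `D` is the strong derivative of `S` on `(0, ∞)`. -/
def IsStrongDeriv (S D : ℝ → H →L[ℝ] H) : Prop :=
  ∀ (v : H) (t : ℝ), 0 < t → HasDerivAt (fun r => S r v) (D t v) t

end

end Volterra

/-! The operator `A` is diagonal in an orthonormal eigenbasis
(`OperatorAssumption.exists_eigenbasis`). Pairing the Volterra equation with an eigenvector of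
eigenvalue μ leaves the scalar equation s + μ B∗s = 1, whose solution is unique. Hence S(t) is the
diagonal operator with entries s_μ(t) (`IsResolventFamily.inner_eq`), its strong derivative has the
entries s_μ' = −μ b∗s_μ, and by Parseval each operator bound is a scalar bound uniform in μ
(`fracPowCompBound_of_coeff`).

The Laplace transform of s_μ is 1/q with q(z) = z + μ b̂(z). Sectoriality excludes cancellation, |q|
≥ c(|z| + μ|b̂|), and 2-regularity makes each derivative of q cost a factor 1/|z|. So the transforms
of t s and t² s' are O(1/(|z||q|)), in particular O(|z|⁻²) uniformly in μ. They can be inverted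
absolutely along Re z = 1/t, where |e^{zt}| = e (`abs_le_integral_laplace`). This gives |s| ≤ M and
|s'| ≤ M/t; moreover s' = −μ b∗s yields |s'| ≤ μ M ‖b‖_{L¹(0,t)}
(`IsParabolicKernel.exists_uniform_bound`).

For (I), the 1/μ term of the growth condition forces |b̂(z)| ≥ c|z|^{1−ρ}
(`KernelAssumption.exists_lower_bound`). On the line Re z = 1/t, with y = Im z, this bounds
1/(|z||q|) by a multiple of 1/(y² + cμ|y|^{2−ρ}), whose integral scales like μ^{−1/ρ}
(`exists_smoothing_bound`). Thus |s| ≤ M μ^{−1/ρ}/t and |s'| ≤ M μ^{−1/ρ}/t². Geometric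
interpolation between the endpoint bounds gives all the exponents.

For (II), both |b̂(z)| and Re b̂(z) are compared with ∫₀ᵀ b, T = 1/|z|. Integration by parts bounds
the transforms from above. A sine transform of a convex function, seen as an alternating series,
gives Re b̂(z) ≥ c ∫₀ᵀ −t b'(t) dt, and the ratio condition turns this into c ∫₀ᵀ b. So the kernel
is sectorial and 2-regular (`MonotoneKernelAssumption.exists_isParabolicKernel`). The behaviour of
b̂ at infinity gives ∫₀ᵗ b ≤ K t^{ρ−1} for small t; for large t the lower bound on the spectrum
replaces it. -/

namespace Volterra

/-! ### The Laplace transform -/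

/-- `f` has exponential type at most `ω` on the half-line in the integral sense. -/
def ExpType (ω : ℝ) (f : ℝ → ℝ) : Prop :=
  ∀ σ : ℝ, ω < σ → IntegrableOn (fun t => Real.exp (-(σ * t)) * f t) (Set.Ioi 0)

theorem norm_cexp_neg_mul (z : ℂ) (t : ℝ) : ‖Complex.exp (-(z * t))‖ = Real.exp (-(z.re * t)) := by
  simp [Complex.norm_exp]

theorem ExpType.aestronglyMeasurable {ω : ℝ} {f : ℝ → ℝ} (hf : ExpType ω f) :
    AEStronglyMeasurable f (volume.restrict (Set.Ioi 0)) := by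
  have h := (hf (ω + 1) (by linarith)).aestronglyMeasurable
  have h2 : AEStronglyMeasurable (fun t => Real.exp ((ω + 1) * t))
      (volume.restrict (Set.Ioi (0 : ℝ))) := by
    exact (by fun_prop : Continuous fun t => Real.exp ((ω + 1) * t)).aestronglyMeasurable
  refine (h2.mul h).congr (ae_of_all _ fun t => ?_)
  simp only [Pi.mul_apply]
  rw [← mul_assoc, ← Real.exp_add]
  simp

theorem ExpType.integrable {ω : ℝ} {f : ℝ → ℝ} (hf : ExpType ω f) {z : ℂ} (hz : ω < z.re) :
    IntegrableOn (fun t : ℝ => Complex.exp (-(z * t)) * (f t : ℂ)) (Set.Ioi 0) := by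
  refine Integrable.mono (hf z.re hz) ?_ (ae_of_all _ fun t => ?_)
  · exact (by fun_prop : Continuous fun t : ℝ => Complex.exp (-(z * t))).aestronglyMeasurable.mul
      (Complex.continuous_ofReal.comp_aestronglyMeasurable hf.aestronglyMeasurable)
  · rw [norm_mul, norm_mul, norm_cexp_neg_mul]
    simp

theorem ExpType.mono {ω ω' : ℝ} {f : ℝ → ℝ} (hf : ExpType ω f) (h : ω ≤ ω') : ExpType ω' f :=
  fun σ hσ => hf σ (h.trans_lt hσ)

theorem ExpType.add {ω : ℝ} {f g : ℝ → ℝ} (hf : ExpType ω f) (hg : ExpType ω g) :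
    ExpType ω (fun t => f t + g t) := fun σ hσ =>
  ((hf σ hσ).add (hg σ hσ)).congr (ae_of_all _ fun t => by simp [mul_add])

theorem ExpType.const_mul {ω : ℝ} {f : ℝ → ℝ} (hf : ExpType ω f) (c : ℝ) :
    ExpType ω (fun t => c * f t) := fun σ hσ =>
  ((hf σ hσ).const_mul c).congr (ae_of_all _ fun t => by ring)

theorem ExpType.abs {ω : ℝ} {f : ℝ → ℝ} (hf : ExpType ω f) : ExpType ω (fun t => |f t|) :=
  fun σ hσ => (hf σ hσ).norm.congr (ae_of_all _ fun t => by simp)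

theorem ExpType.mono_fun {ω : ℝ} {f g : ℝ → ℝ} (hg : ExpType ω g)
    (hf : AEStronglyMeasurable f (volume.restrict (Set.Ioi 0)))
    (h : ∀ t, 0 < t → |f t| ≤ g t) : ExpType ω f := fun σ hσ => by
  refine Integrable.mono (hg σ hσ) ?_ ?_
  · exact (by fun_prop : Continuous fun t : ℝ => Real.exp (-(σ * t))).aestronglyMeasurable.mul hf
  · filter_upwards [ae_restrict_mem measurableSet_Ioi] with t ht
    rw [norm_mul, norm_mul]
    gcongr
    exact (h t ht).trans (le_abs_self _)

theorem ExpType.of_le_exp {ω K : ℝ} {f : ℝ → ℝ}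
    (hf : AEStronglyMeasurable f (volume.restrict (Set.Ioi 0)))
    (h : ∀ t, 0 < t → |f t| ≤ K * Real.exp (ω * t)) : ExpType ω f := by
  refine ExpType.mono_fun (g := fun t => K * Real.exp (ω * t)) ?_ hf h
  intro σ hσ
  have := (integrableOn_exp_mul_Ioi (a := ω - σ) (by linarith) 0).const_mul K
  refine this.congr (ae_of_all _ fun t => ?_)
  simp only
  rw [mul_left_comm, ← Real.exp_add]
  ring_nf

/-- Multiplication by a power of `t` does not change the exponential type. -/
theorem ExpType.id_mul {ω : ℝ} {f : ℝ → ℝ} (hf : ExpType ω f) :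
    ExpType ω (fun t => t * f t) := by
  intro σ hσ
  obtain ⟨τ, h1, h2⟩ := exists_between hσ
  refine Integrable.mono ((hf τ h1).const_mul (σ - τ)⁻¹) ?_ ?_
  · exact (by fun_prop : Continuous fun t : ℝ => Real.exp (-(σ * t))).aestronglyMeasurable.mul
      (continuous_id.aestronglyMeasurable.mul hf.aestronglyMeasurable)
  · filter_upwards [ae_restrict_mem measurableSet_Ioi] with t ht
    have ht : 0 < t := ht
    have hd : 0 < σ - τ := by linarith
    have e1 : (σ - τ) * t ≤ Real.exp ((σ - τ) * t) := by
      linarith [Real.add_one_le_exp ((σ - τ) * t)]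
    have e2 : Real.exp (-(σ * t)) * t ≤ (σ - τ)⁻¹ * Real.exp (-(τ * t)) := by
      have : Real.exp (-(τ * t)) = Real.exp (-(σ * t)) * Real.exp ((σ - τ) * t) := by
        rw [← Real.exp_add]; ring_nf
      rw [this, mul_left_comm]
      gcongr
      rw [inv_mul_eq_div, le_div_iff₀ hd]
      linarith
    simp only [norm_mul, Real.norm_eq_abs, Real.abs_exp, abs_inv, abs_of_pos ht, abs_of_pos hd]
    rw [← mul_assoc, ← mul_assoc]
    gcongr

/-- Differentiation under the integral. For ω < τ < Re z the derivative is dominated on Re w > τ by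
e^{−τt} |t f(t)|, which is integrable because a factor t does not change the type. -/
theorem hasDerivAt_laplace {ω : ℝ} {f : ℝ → ℝ} (hf : ExpType ω f) {z : ℂ} (hz : ω < z.re) :
    HasDerivAt (laplace f) (-laplace (fun t => t * f t) z) z := by
  obtain ⟨τ, h1, h2⟩ := exists_between hz
  have hs : {w : ℂ | τ < w.re} ∈ 𝓝 z :=
    (isOpen_lt continuous_const Complex.continuous_re).mem_nhds h2
  have key := (hasDerivAt_integral_of_dominated_loc_of_deriv_le (μ := volume.restrict (Set.Ioi 0))
    (F := fun (w : ℂ) (t : ℝ) => Complex.exp (-(w * t)) * (f t : ℂ))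
    (F' := fun (w : ℂ) (t : ℝ) => -(Complex.exp (-(w * t)) * ((t * f t : ℝ) : ℂ)))
    (bound := fun t => ‖Real.exp (-(τ * t)) * (t * f t)‖) hs ?_ (hf.integrable hz) ?_ ?_
    (hf.id_mul τ h1).norm ?_).2
  · rw [integral_neg] at key
    exact key
  · filter_upwards [hs] with w hw
    exact (hf.integrable (h1.trans hw)).aestronglyMeasurable
  · exact (hf.id_mul.integrable hz).aestronglyMeasurable.neg
  · filter_upwards [ae_restrict_mem measurableSet_Ioi] with t ht w hw
    have ht : 0 < t := ht
    have hw : τ < w.re := hw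
    rw [norm_neg, norm_mul, norm_cexp_neg_mul, norm_mul]
    simp only [Complex.norm_real, Real.norm_eq_abs, Real.abs_exp]
    gcongr
  · refine ae_of_all _ fun t w _ => ?_
    have h := (((hasDerivAt_id w).mul_const (t : ℂ)).neg.cexp).mul_const (f t : ℂ)
    refine h.congr_deriv ?_
    simp
    ring

/-- The Laplace transform of a derivative. -/
theorem laplace_deriv {ω : ℝ} {p p' : ℝ → ℝ} (hp : ExpType ω p) (hp' : ExpType ω p')
    (hd : ∀ t, 0 < t → HasDerivAt p (p' t) t) (hc : ContinuousWithinAt p (Set.Ici 0) 0)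
    {z : ℂ} (hz : ω < z.re) : z * laplace p z = p 0 + laplace p' z := by
  set G : ℝ → ℂ := fun t => Complex.exp (-(z * t)) * (p t : ℂ)
  set G' : ℝ → ℂ := fun t =>
    Complex.exp (-(z * t)) * (p' t : ℂ) - z * (Complex.exp (-(z * t)) * (p t : ℂ))
  have hG : ∀ t ∈ Set.Ioi (0 : ℝ), HasDerivAt G (G' t) t := by
    intro t ht
    have h1 : HasDerivAt (fun t : ℝ => Complex.exp (-(z * t)))
        (Complex.exp (-(z * t)) * -z) t := by
      have := (((Complex.ofRealCLM.hasDerivAt (x := t)).const_mul z).neg).cexp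
      simpa using this
    refine (h1.mul (hd t ht).ofReal_comp).congr_deriv ?_
    simp only [G']
    ring
  have iG : IntegrableOn G (Set.Ioi 0) := hp.integrable hz
  have iG' : IntegrableOn G' (Set.Ioi 0) :=
    (hp'.integrable hz).sub ((hp.integrable hz).const_mul z)
  have h0 := tendsto_zero_of_hasDerivAt_of_integrableOn_Ioi hG iG' iG
  have hcG : ContinuousWithinAt G (Set.Ici 0) 0 := by
    refine ContinuousWithinAt.mul ?_ ?_
    · exact (by fun_prop : Continuous fun t : ℝ => Complex.exp (-(z * t))).continuousWithinAt
    · exact Complex.continuous_ofReal.continuousAt.comp_continuousWithinAt hc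
  have := integral_Ioi_of_hasDerivAt_of_tendsto hcG hG iG' h0
  rw [integral_sub (hp'.integrable hz) ((hp.integrable hz).const_mul z), integral_const_mul] at this
  simp only [G, Complex.ofReal_zero, mul_zero, neg_zero, Complex.exp_zero, one_mul] at this
  simp only [laplace]
  linear_combination -this

theorem laplace_add {ω : ℝ} {f g : ℝ → ℝ} (hf : ExpType ω f) (hg : ExpType ω g) {z : ℂ}
    (hz : ω < z.re) : laplace (fun t => f t + g t) z = laplace f z + laplace g z := by
  simp only [laplace]
  rw [← integral_add (hf.integrable hz) (hg.integrable hz)]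
  simp [mul_add]

theorem laplace_const_mul (c : ℝ) (f : ℝ → ℝ) (z : ℂ) :
    laplace (fun t => c * f t) z = c * laplace f z := by
  simp only [laplace]
  rw [← integral_const_mul]
  congr 1
  ext t
  push_cast
  ring

/-- Reduces estimates for Im z < 0 to Im z > 0, since the kernel is real. -/
theorem laplace_conj (f : ℝ → ℝ) (z : ℂ) :
    laplace f (starRingEnd ℂ z) = starRingEnd ℂ (laplace f z) := by
  simp only [laplace]
  rw [← integral_conj]
  congr 1
  ext t
  simp [← Complex.exp_conj]

/-- The Laplace transform turns convolution into multiplication. -/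
theorem laplace_convolution {ω : ℝ} {f g : ℝ → ℝ} (hf : ExpType ω f) (hg : ExpType ω g) {z : ℂ}
    (hz : ω < z.re) :
    laplace (fun t => ∫ r in (0 : ℝ)..t, f r * g (t - r)) z = laplace f z * laplace g z := by
  have := integral_posConvolution (hf.integrable hz) (hg.integrable hz)
    (ContinuousLinearMap.mul ℝ ℂ)
  simp only [ContinuousLinearMap.mul_apply'] at this
  simp only [laplace]
  rw [← this]
  congr 1
  ext t
  rw [← intervalIntegral.integral_ofReal, ← intervalIntegral.integral_const_mul]
  congr 1
  ext r
  have : Complex.exp (-(z * t)) = Complex.exp (-(z * r)) * Complex.exp (-(z * (t - r : ℝ))) := by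
    rw [← Complex.exp_add]
    push_cast
    ring_nf
  rw [this]
  push_cast
  ring

theorem convolution_expType {ω : ℝ} {f g : ℝ → ℝ} (hf : ExpType ω f) (hg : ExpType ω g) :
    ExpType ω (fun t => ∫ r in (0 : ℝ)..t, f r * g (t - r)) := by
  intro σ hσ
  have := integrable_posConvolution (hf σ hσ) (hg σ hσ) (ContinuousLinearMap.mul ℝ ℝ)
  refine (this.integrableOn (s := Set.Ioi 0)).congr ?_
  filter_upwards [ae_restrict_mem measurableSet_Ioi] with t ht
  simp only [posConvolution, Set.indicator_of_mem ht, ContinuousLinearMap.mul_apply']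
  rw [← intervalIntegral.integral_const_mul]
  congr 1
  ext r
  have : Real.exp (-(σ * t)) = Real.exp (-(σ * r)) * Real.exp (-(σ * (t - r))) := by
    rw [← Real.exp_add]
    ring_nf
  rw [this]
  ring

/-- Laplace inversion on a vertical line. -/
theorem laplace_inversion {p : ℝ → ℝ} {ω σ : ℝ} (hσ : ω < σ) (hp : ExpType ω p)
    (hc : ContinuousOn p (Set.Ici 0)) (h0 : p 0 = 0)
    (hi : Integrable fun ξ : ℝ => laplace p (σ + 2 * Real.pi * ξ * Complex.I)) {t : ℝ}
    (ht : 0 ≤ t) :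
    (p t : ℂ) = ∫ ξ : ℝ, Complex.exp ((σ + 2 * Real.pi * ξ * Complex.I) * t) *
      laplace p (σ + 2 * Real.pi * ξ * Complex.I) := by
  -- Freezing `p` at `p 0 = 0` to the left of the origin makes `G` continuous on the whole line, as
  -- Fourier inversion requires.
  set G : ℝ → ℂ := fun t => ((Real.exp (-(σ * t)) * p (max t 0) : ℝ) : ℂ) with hG
  have hp' : Continuous fun t : ℝ => p (max t 0) :=
    hc.comp_continuous (by fun_prop) fun t => Set.mem_Ici.mpr (le_max_right _ _)
  have hGc : Continuous G := Complex.continuous_ofReal.comp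
    ((by fun_prop : Continuous fun t : ℝ => Real.exp (-(σ * t))).mul hp')
  have hG0 : ∀ t ∉ Set.Ioi (0 : ℝ), G t = 0 := by
    intro t ht
    have : t ≤ 0 := not_lt.mp ht
    simp [hG, max_eq_right this, h0]
  have hGi : Integrable G := by
    rw [← integrableOn_iff_integrable_of_support_subset (s := Set.Ioi (0 : ℝ))]
    · have := (hp σ hσ).ofReal (𝕜 := ℂ)
      refine IntegrableOn.congr_fun this ?_ measurableSet_Ioi
      intro t ht
      have ht : (0 : ℝ) < t := ht
      simp [hG, max_eq_left ht.le]
    · intro t h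
      by_contra h'
      exact h (hG0 t h')
  have hF : FourierTransform.fourier G =
      fun ξ : ℝ => laplace p (σ + 2 * Real.pi * ξ * Complex.I) := by
    ext ξ
    rw [Real.fourier_real_eq_integral_exp_smul, ← setIntegral_eq_integral_of_forall_compl_eq_zero
      (s := Set.Ioi (0 : ℝ)) (fun t ht => by rw [hG0 t ht, smul_zero]), laplace]
    refine setIntegral_congr_fun measurableSet_Ioi fun t ht => ?_
    have ht : (0 : ℝ) < t := ht
    simp only [hG, max_eq_left ht.le, smul_eq_mul]
    push_cast
    rw [← mul_assoc, ← Complex.exp_add]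
    congr 2
    ring
  have hinv := congrFun (hGc.fourierInv_fourier_eq hGi (by rw [hF]; exact hi)) t
  rw [hF, Real.fourierInv_eq'] at hinv
  have e1 : (p t : ℂ) = Complex.exp (σ * t) * G t := by
    simp only [hG, max_eq_left ht]
    push_cast
    rw [← mul_assoc, ← Complex.exp_add]
    simp
  rw [e1, ← hinv, ← integral_const_mul]
  congr 1
  ext ξ
  rw [smul_eq_mul, ← mul_assoc, ← Complex.exp_add]
  congr 2
  simp
  ring

/-! ### Vertical lines -/

theorem norm_sq_vertical (a y : ℝ) : ‖(a + y * Complex.I : ℂ)‖ ^ 2 = a ^ 2 + y ^ 2 := by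
  rw [Complex.sq_norm, Complex.normSq_add_mul_I]

theorem inv_sq_add_sq_eq {a : ℝ} (ha : 0 < a) (y : ℝ) :
    (a ^ 2 + y ^ 2)⁻¹ = (a ^ 2)⁻¹ * (1 + (a⁻¹ * y) ^ 2)⁻¹ := by
  rw [← mul_inv]
  congr 1
  field_simp

theorem integrable_inv_sq_add_sq {a : ℝ} (ha : 0 < a) :
    Integrable fun y : ℝ => (a ^ 2 + y ^ 2)⁻¹ := by
  simp_rw [inv_sq_add_sq_eq ha]
  exact (integrable_inv_one_add_sq.comp_mul_left' (inv_ne_zero ha.ne')).const_mul _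

theorem integral_inv_sq_add_sq {a : ℝ} (ha : 0 < a) :
    ∫ y : ℝ, (a ^ 2 + y ^ 2)⁻¹ = Real.pi / a := by
  simp_rw [inv_sq_add_sq_eq ha]
  rw [integral_const_mul, Measure.integral_comp_mul_left (fun x => (1 + x ^ 2)⁻¹),
    integral_univ_inv_one_add_sq, inv_inv, abs_of_pos ha, smul_eq_mul]
  field_simp

theorem continuous_vertical {F : ℂ → ℂ} (hF : DifferentiableOn ℂ F {z | 0 < z.re})
    {a : ℝ} (ha : 0 < a) : Continuous fun y : ℝ => F (a + y * Complex.I) :=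
  hF.continuousOn.comp_continuous (by fun_prop) fun y => by simpa using ha

theorem integrable_vertical {F : ℂ → ℂ} (hF : DifferentiableOn ℂ F {z | 0 < z.re}) {C : ℝ}
    (hb : ∀ z : ℂ, 0 < z.re → ‖F z‖ ≤ C / ‖z‖ ^ 2)
    {a : ℝ} (ha : 0 < a) :
    Integrable fun y : ℝ => F (a + y * Complex.I) := by
  refine Integrable.mono' ((integrable_inv_sq_add_sq ha).const_mul C)
    (continuous_vertical hF ha).aestronglyMeasurable (ae_of_all _ fun y => ?_)
  have := hb (a + y * Complex.I) (by simpa using ha)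
  rwa [norm_sq_vertical, div_eq_mul_inv] at this

theorem integrable_exp_vertical {F : ℂ → ℂ} (hF : DifferentiableOn ℂ F {z | 0 < z.re}) {C : ℝ}
    (hb : ∀ z : ℂ, 0 < z.re → ‖F z‖ ≤ C / ‖z‖ ^ 2)
    {a : ℝ} (ha : 0 < a) (t : ℝ) :
    Integrable fun y : ℝ => Complex.exp ((a + y * Complex.I) * t) * F (a + y * Complex.I) := by
  refine (integrable_vertical hF hb ha).bdd_mul (c := Real.exp (a * t)) ?_ (ae_of_all _ fun y => ?_)
  · exact (by fun_prop : Continuous fun y : ℝ =>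
      Complex.exp ((a + y * Complex.I) * t)).aestronglyMeasurable
  · simp [Complex.norm_exp]

/-- The inversion integral does not depend on the vertical line. -/
theorem integral_vertical_eq {F : ℂ → ℂ} (hF : DifferentiableOn ℂ F {z | 0 < z.re}) {C : ℝ}
    (hb : ∀ z : ℂ, 0 < z.re → ‖F z‖ ≤ C / ‖z‖ ^ 2)
    {a c : ℝ} (ha : 0 < a) (hc : 0 < c) {t : ℝ} (ht : 0 ≤ t) :
    (∫ y : ℝ, Complex.exp ((a + y * Complex.I) * t) * F (a + y * Complex.I)) =
      ∫ y : ℝ, Complex.exp ((c + y * Complex.I) * t) * F (c + y * Complex.I) := by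
  set G : ℂ → ℂ := fun z => Complex.exp (z * t) * F z with hG
  have hGd : DifferentiableOn ℂ G {z | 0 < z.re} :=
    DifferentiableOn.mul (by fun_prop) hF
  set m := max a c
  have hsub : ∀ x ∈ Set.uIcc a c, 0 < x ∧ x ≤ m := by
    intro x hx
    rw [Set.mem_uIcc] at hx
    rcases hx with h | h
    · exact ⟨ha.trans_le h.1, h.2.trans (le_max_right _ _)⟩
    · exact ⟨hc.trans_le h.1, h.2.trans (le_max_left _ _)⟩
  have hC : 0 ≤ C := by
    have := (norm_nonneg _).trans (hb 1 (by simp))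
    simpa using this
  -- The horizontal sides of the rectangle with corners a − iR and c + iR are O(R⁻²), so Cauchy's
  -- theorem on it gives the claim in the limit.
  have hhor : ∀ (R : ℝ), 0 < R → ∀ r : ℝ, |r| = R →
      ‖∫ x : ℝ in a..c, G (x + r * Complex.I)‖ ≤ Real.exp (m * t) * C * |c - a| * (R ^ 2)⁻¹ := by
    intro R hR r hr
    have := intervalIntegral.norm_integral_le_of_norm_le_const (a := a) (b := c)
      (f := fun x : ℝ => G (x + r * Complex.I)) (C := Real.exp (m * t) * (C / R ^ 2)) ?_
    · refine this.trans (le_of_eq ?_)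
      ring
    · intro x hx
      obtain ⟨h1, h2⟩ := hsub x (Set.uIoc_subset_uIcc hx)
      simp only [hG, norm_mul]
      have h3 := hb (x + r * Complex.I) (by simpa using h1)
      rw [norm_sq_vertical, ← sq_abs r, hr] at h3
      gcongr
      · have h4 : ((x + r * Complex.I) * t : ℂ).re = x * t := by simp
        rw [Complex.norm_exp, h4]
        gcongr
      · refine h3.trans ?_
        gcongr
        nlinarith
  have hrect : ∀ R : ℝ, (∫ x : ℝ in a..c, G (x + (-R : ℝ) * Complex.I)) -
      (∫ x : ℝ in a..c, G (x + R * Complex.I)) +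
      Complex.I * (∫ y : ℝ in (-R)..R, G (c + y * Complex.I)) -
      Complex.I * (∫ y : ℝ in (-R)..R, G (a + y * Complex.I)) = 0 := by
    intro R
    have := Complex.integral_boundary_rect_eq_zero_of_differentiableOn G
      (a + (-R : ℝ) * Complex.I) (c + R * Complex.I) ?_
    · simpa using this
    · refine hGd.mono fun z hz => ?_
      have := hz.1
      simp only [Set.mem_preimage, Complex.add_re, Complex.ofReal_re, Complex.mul_I_re,
        Complex.ofReal_im, neg_zero, add_zero] at this
      exact (hsub _ this).1
  have lim : ∀ {s : ℝ}, 0 < s → Tendsto (fun R : ℝ => ∫ y : ℝ in (-R)..R, G (s + y * Complex.I))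
      atTop (𝓝 (∫ y : ℝ, G (s + y * Complex.I))) := fun hs =>
    intervalIntegral_tendsto_integral (integrable_exp_vertical hF hb hs t) tendsto_neg_atTop_atBot
      tendsto_id
  have hz : Tendsto (fun R : ℝ => Real.exp (m * t) * C * |c - a| * (R ^ 2)⁻¹) atTop (𝓝 0) := by
    have : Tendsto (fun R : ℝ => (R ^ 2)⁻¹) atTop (𝓝 0) :=
      (tendsto_pow_atTop (by norm_num)).inv_tendsto_atTop
    simpa using this.const_mul (Real.exp (m * t) * C * |c - a|)
  have hz1 : Tendsto (fun R : ℝ => ∫ x : ℝ in a..c, G (x + R * Complex.I)) atTop (𝓝 0) :=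
    squeeze_zero_norm' (by
      filter_upwards [eventually_gt_atTop 0] with R hR
      exact hhor R hR R (abs_of_pos hR)) hz
  have hz2 : Tendsto (fun R : ℝ => ∫ x : ℝ in a..c, G (x + (-R : ℝ) * Complex.I)) atTop (𝓝 0) :=
    squeeze_zero_norm' (by
      filter_upwards [eventually_gt_atTop 0] with R hR
      exact hhor R hR (-R) (by rw [abs_neg, abs_of_pos hR])) hz
  have hlim := ((hz2.sub hz1).add ((lim hc).const_mul Complex.I)).sub
    ((lim ha).const_mul Complex.I)
  simp_rw [hrect] at hlim
  have := tendsto_nhds_unique hlim tendsto_const_nhds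
  have h2 : Complex.I * ((∫ y : ℝ, G (c + y * Complex.I)) - ∫ y : ℝ, G (a + y * Complex.I)) = 0 := by
    linear_combination this
  rcases mul_eq_zero.mp h2 with h | h
  · exact absurd h Complex.I_ne_zero
  · exact (sub_eq_zero.mp h).symm

/-- A function whose Laplace transform extends holomorphically to the right half-plane with
quadratic decay is bounded by the integral of the extension along the line `Re z = 1 / t`. -/
theorem abs_le_integral_laplace {p : ℝ → ℝ} {ω : ℝ} (hp : ExpType ω p)
    (hpc : ContinuousOn p (Set.Ici 0)) (h0 : p 0 = 0) {F : ℂ → ℂ} {C : ℝ}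
    (hF : DifferentiableOn ℂ F {z | 0 < z.re})
    (hb : ∀ z : ℂ, 0 < z.re → ‖F z‖ ≤ C / ‖z‖ ^ 2)
    (hL : ∀ z : ℂ, ω < z.re → 0 < z.re → laplace p z = F z) {t : ℝ} (ht : 0 < t) :
    |p t| ≤ Real.exp 1 / (2 * Real.pi) * ∫ y : ℝ, ‖F ((t⁻¹ : ℝ) + y * Complex.I)‖ := by
  set σ := max ω 0 + 1
  have hσ : ω < σ := by have := le_max_left ω 0; linarith
  have hσ0 : 0 < σ := by have := le_max_right ω 0; linarith
  have hpi : (2 * Real.pi) ≠ 0 := by positivity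
  have e1 : ∀ ξ : ℝ, laplace p (σ + 2 * Real.pi * ξ * Complex.I) =
      F (σ + (2 * Real.pi * ξ : ℝ) * Complex.I) := by
    intro ξ
    push_cast
    exact hL _ (by simpa using hσ) (by simpa using hσ0)
  have hinv := laplace_inversion hσ hp hpc h0 (by
    simp_rw [e1]
    exact (integrable_vertical hF hb hσ0).comp_mul_left' hpi) ht.le
  have e2 : (p t : ℂ) = ∫ ξ : ℝ, (fun y : ℝ => Complex.exp ((σ + y * Complex.I) * t) *
      F (σ + y * Complex.I)) (2 * Real.pi * ξ) := by
    rw [hinv]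
    congr 1
    ext ξ
    rw [e1]
    push_cast
    rfl
  -- The contour moves from the abscissa σ, where the inversion formula is available, to 1/t, where
  -- the exponential has modulus e.
  rw [Measure.integral_comp_mul_left (fun y : ℝ => Complex.exp ((σ + y * Complex.I) * t) *
    F (σ + y * Complex.I)), integral_vertical_eq hF hb hσ0 (inv_pos.mpr ht) ht.le] at e2
  have e3 : |p t| = ‖(p t : ℂ)‖ := by simp
  rw [e3, e2, norm_smul, Real.norm_eq_abs, abs_abs, abs_of_pos (by positivity)]
  have e4 := norm_integral_le_integral_norm (μ := volume) (fun y : ℝ =>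
    Complex.exp (((t⁻¹ : ℝ) + y * Complex.I) * t) * F ((t⁻¹ : ℝ) + y * Complex.I))
  have e5 : ∀ y : ℝ, ‖Complex.exp (((t⁻¹ : ℝ) + y * Complex.I) * t) *
      F ((t⁻¹ : ℝ) + y * Complex.I)‖ = Real.exp 1 * ‖F ((t⁻¹ : ℝ) + y * Complex.I)‖ := by
    intro y
    rw [norm_mul, Complex.norm_exp]
    simp [ht.ne']
  simp_rw [e5] at e4
  rw [integral_const_mul] at e4
  calc _ ≤ (2 * Real.pi)⁻¹ * (Real.exp 1 * ∫ y : ℝ, ‖F ((t⁻¹ : ℝ) + y * Complex.I)‖) := by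
        gcongr
    _ = _ := by ring

/-! ### Scalar Volterra equations -/

theorem integral_exp_neg_mul_sub_le {a : ℝ} (ha : 0 < a) (t : ℝ) :
    ∫ r in (0 : ℝ)..t, Real.exp (-(a * (t - r))) ≤ a⁻¹ := by
  have h : ∀ r : ℝ, HasDerivAt (fun r => a⁻¹ * Real.exp (-(a * (t - r))))
      (Real.exp (-(a * (t - r)))) r := by
    intro r
    have := (((((hasDerivAt_id r).const_sub t).const_mul a).neg).exp).const_mul a⁻¹
    refine this.congr_deriv ?_
    simp
    field_simp
  rw [intervalIntegral.integral_eq_sub_of_hasDerivAt (fun r _ => h r)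
    ((by fun_prop : Continuous fun r => Real.exp (-(a * (t - r)))).intervalIntegrable _ _)]
  have : 0 ≤ a⁻¹ * Real.exp (-(a * (t - 0))) := by positivity
  simp only [sub_self, mul_zero, neg_zero, Real.exp_zero, mul_one]
  linarith

/-- A linear Volterra equation with continuous kernel of exponential growth has a solution of
exponential growth. -/
theorem exists_volterra_solution {k : ℝ → ℝ} (hk : Continuous k) {N : ℝ}
    (hN : ∀ t, 0 ≤ t → |k t| ≤ N * Real.exp t) :
    ∃ u : ℝ → ℝ, Continuous u ∧ (∃ K ω : ℝ, ∀ t, 0 ≤ t → |u t| ≤ K * Real.exp (ω * t)) ∧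
      ∀ t, 0 ≤ t → u t + ∫ r in (0 : ℝ)..t, k (t - r) * u r = 1 := by
  have hN0 : 0 ≤ N := by simpa using (abs_nonneg _).trans (hN 0 le_rfl)
  -- After multiplication by e^{−(a+1)t} the kernel is at most N e^{−at}, with integral at most N/a
  -- ≤ 1/2. Convolution with it is therefore a contraction in the supremum norm.
  set a := 2 * N + 1
  have ha : 0 < a := by positivity
  set κ : ℝ → ℝ := fun t => Real.exp (-((a + 1) * t)) * k t
  have hκ : Continuous κ := by fun_prop
  have hκb : ∀ t, 0 ≤ t → |κ t| ≤ N * Real.exp (-(a * t)) := by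
    intro t ht
    simp only [κ, abs_mul, Real.abs_exp]
    calc _ ≤ Real.exp (-((a + 1) * t)) * (N * Real.exp t) := by gcongr; exact hN t ht
      _ = N * (Real.exp (-((a + 1) * t)) * Real.exp t) := by ring
      _ = _ := by rw [← Real.exp_add]; ring_nf
  have hint : ∀ (w : ℝ → ℝ) (W : ℝ), 0 ≤ W → (∀ t, |w t| ≤ W) → ∀ t, 0 ≤ t →
      |∫ r in (0 : ℝ)..t, κ (t - r) * w r| ≤ 1 / 2 * W := by
    intro w W hW hw t ht
    have h1 := intervalIntegral.norm_integral_le_of_norm_le (a := 0) (b := t) (μ := volume)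
      (f := fun r => κ (t - r) * w r) (g := fun r => N * W * Real.exp (-(a * (t - r)))) ht
      (ae_of_all _ fun r hr => by
        rw [norm_mul]
        calc _ ≤ N * Real.exp (-(a * (t - r))) * W := by
              gcongr
              · exact hκb _ (sub_nonneg.mpr hr.2)
              · exact hw r
          _ = _ := by ring)
      ((by fun_prop : Continuous fun r => N * W * Real.exp (-(a * (t - r)))).intervalIntegrable _ _)
    rw [intervalIntegral.integral_const_mul] at h1
    refine h1.trans ?_
    calc _ ≤ N * W * a⁻¹ := by gcongr; exact integral_exp_neg_mul_sub_le ha t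
      _ ≤ 1 / 2 * W := by
        rw [← div_eq_mul_inv, div_le_iff₀ ha]
        simp only [a]
        nlinarith
  have hcont : ∀ w : BoundedContinuousFunction ℝ ℝ, Continuous fun t : ℝ =>
      ∫ r in (0 : ℝ)..(max t 0), κ (max t 0 - r) * w r := by
    intro w
    refine intervalIntegral.continuous_parametric_intervalIntegral_of_continuous
      (f := fun t r => κ (max t 0 - r) * w r) ?_ (by fun_prop)
    have := w.continuous
    simp only [Function.uncurry_def]
    fun_prop
  -- Evaluation at `max t 0` extends each image to negative times by its value at 0, so the fixed
  -- point can be sought among bounded continuous functions on the line.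
  set T : BoundedContinuousFunction ℝ ℝ → BoundedContinuousFunction ℝ ℝ := fun w =>
    BoundedContinuousFunction.ofNormedAddCommGroup
      (fun t => Real.exp (-((a + 1) * max t 0)) -
        ∫ r in (0 : ℝ)..(max t 0), κ (max t 0 - r) * w r)
      (by have := hcont w; fun_prop) (1 + 1 / 2 * ‖w‖) (by
        intro t
        refine (norm_sub_le _ _).trans (add_le_add ?_ ?_)
        · rw [Real.norm_eq_abs, Real.abs_exp, Real.exp_le_one_iff]
          have := le_max_right t 0
          have : 0 ≤ (a + 1) * max t 0 := by positivity
          linarith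
        · exact hint w ‖w‖ (norm_nonneg _) (fun t => w.norm_coe_le_norm t) _ (le_max_right _ _))
  have hT : ContractingWith (1 / 2) T := by
    refine ⟨by rw [← NNReal.coe_lt_coe]; norm_num, LipschitzWith.of_dist_le_mul fun v w => ?_⟩
    rw [BoundedContinuousFunction.dist_le (by positivity)]
    intro t
    simp only [T, BoundedContinuousFunction.coe_ofNormedAddCommGroup]
    rw [dist_sub_left, dist_eq_norm, ← intervalIntegral.integral_sub]
    · have := hint (fun r => v r - w r) (dist v w) dist_nonneg
        (fun r => by rw [← Real.dist_eq]; exact BoundedContinuousFunction.dist_coe_le_dist r)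
        (max t 0) (le_max_right _ _)
      simp_rw [← mul_sub]
      simpa using this
    · have := v.continuous
      exact (by fun_prop : Continuous fun r => κ (max t 0 - r) * v r).intervalIntegrable _ _
    · have := w.continuous
      exact (by fun_prop : Continuous fun r => κ (max t 0 - r) * w r).intervalIntegrable _ _
  obtain ⟨w, hw⟩ : ∃ w, T w = w := ⟨_, hT.fixedPoint_isFixedPt⟩
  have hwc := w.continuous
  refine ⟨fun t => Real.exp ((a + 1) * t) * w t, by fun_prop, ⟨‖w‖, a + 1, fun t _ => ?_⟩,
    fun t ht => ?_⟩
  · rw [abs_mul, Real.abs_exp, mul_comm]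
    gcongr
    exact w.norm_coe_le_norm t
  · have h1 : w t = Real.exp (-((a + 1) * t)) - ∫ r in (0 : ℝ)..t, κ (t - r) * w r := by
      conv_lhs => rw [← hw]
      simp only [T, BoundedContinuousFunction.coe_ofNormedAddCommGroup, max_eq_left ht]
    have h2 : ∫ r in (0 : ℝ)..t, k (t - r) * (Real.exp ((a + 1) * r) * w r) =
        Real.exp ((a + 1) * t) * ∫ r in (0 : ℝ)..t, κ (t - r) * w r := by
      rw [← intervalIntegral.integral_const_mul]
      congr 1
      ext r
      have : Real.exp ((a + 1) * r) =
          Real.exp ((a + 1) * t) * Real.exp (-((a + 1) * (t - r))) := by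
        rw [← Real.exp_add]; ring_nf
      rw [this]
      ring
    beta_reduce
    rw [h2, h1, mul_sub, ← Real.exp_add]
    simp

/-- Uniqueness for the homogeneous Volterra equation. -/
theorem volterra_unique {k u : ℝ → ℝ} (hk : Continuous k) (hu : ContinuousOn u (Set.Ici 0))
    (h : ∀ t, 0 ≤ t → u t + ∫ r in (0 : ℝ)..t, k (t - r) * u r = 0) :
    ∀ t, 0 ≤ t → u t = 0 := by
  intro T hT
  set v : ℝ → ℝ := fun t => u (max t 0)
  have hv : Continuous v :=
    hu.comp_continuous (by fun_prop) fun t => Set.mem_Ici.mpr (le_max_right _ _)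
  have huv : ∀ t, 0 ≤ t → v t = u t := fun t ht => by simp only [v, max_eq_left ht]
  obtain ⟨K, hK⟩ := (isCompact_Icc (a := (0 : ℝ)) (b := T)).exists_bound_of_continuousOn
    hk.continuousOn
  have hvi : ∀ x y : ℝ, IntervalIntegrable (fun r => |v r|) volume x y :=
    fun x y => hv.abs.intervalIntegrable _ _
  have bound : ∀ t ∈ Set.Icc (0 : ℝ) T, |v t| ≤ K * ∫ r in (0 : ℝ)..t, |v r| := by
    intro t ht
    have h1 : v t = -∫ r in (0 : ℝ)..t, k (t - r) * v r := by
      rw [huv t ht.1, eq_neg_iff_add_eq_zero]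
      refine Eq.trans ?_ (h t ht.1)
      congr 1
      refine intervalIntegral.integral_congr fun r hr => ?_
      rw [Set.uIcc_of_le ht.1] at hr
      simp only [huv r hr.1]
    rw [h1, abs_neg, ← intervalIntegral.integral_const_mul, ← Real.norm_eq_abs]
    refine intervalIntegral.norm_integral_le_of_norm_le ht.1 (ae_of_all _ fun r hr => ?_)
      ((hvi _ _).const_mul _)
    rw [norm_mul]
    exact mul_le_mul_of_nonneg_right
      (hK _ ⟨sub_nonneg.mpr hr.2, by linarith [hr.1, ht.2]⟩) (abs_nonneg _)
  have hd : ∀ t : ℝ, HasDerivAt (fun t => ∫ r in (0 : ℝ)..t, |v r|) |v t| t := fun t =>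
    intervalIntegral.integral_hasDerivAt_right (hvi _ _)
      hv.abs.stronglyMeasurable.stronglyMeasurableAtFilter hv.abs.continuousAt
  -- Gronwall for I(t) = ∫₀ᵗ |v|: I(0) = 0 and I' = |v| ≤ K I.
  have hz := eq_zero_of_abs_deriv_le_mul_abs_self_of_eq_zero_right (K := K) (a := 0) (b := T)
    (f := fun t => ∫ r in (0 : ℝ)..t, |v r|) (f' := fun t => |v t|)
    (fun t _ => (hd t).continuousAt.continuousWithinAt)
    (fun t _ => (hd t).hasDerivWithinAt) (by simp) (fun t ht => by
      have h0 : 0 ≤ ∫ r in (0 : ℝ)..t, |v r| :=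
        intervalIntegral.integral_nonneg ht.1 fun r _ => abs_nonneg _
      simp only [Real.norm_eq_abs, abs_abs, abs_of_nonneg h0]
      exact bound t ⟨ht.1, ht.2.le⟩)
  have h2 := bound T ⟨hT, le_rfl⟩
  rw [hz T ⟨hT, le_rfl⟩, mul_zero, huv T hT] at h2
  exact abs_nonpos_iff.mp h2

/-! ### Convolutions on the half-line -/

/-- Convolution on the half-line. -/
noncomputable def conv (b s : ℝ → ℝ) (t : ℝ) : ℝ := ∫ r in (0 : ℝ)..t, b r * s (t - r)

/-- The primitive of `b`, extended by zero to the left. -/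
noncomputable def primitive (b : ℝ → ℝ) (t : ℝ) : ℝ := ∫ r in (0 : ℝ)..(max t 0), b r

theorem ExpType.integrableOn_Ioc {ω : ℝ} {b : ℝ → ℝ} (hb : ExpType ω b) (T : ℝ) :
    IntegrableOn b (Set.Ioc 0 T) := by
  set σ := |ω| + 1
  have hσ : ω < σ := by have := le_abs_self ω; linarith
  have h1 := (hb σ hσ).mono_set (Set.Ioc_subset_Ioi_self : Set.Ioc 0 T ⊆ Set.Ioi 0)
  have h2 : Continuous fun t => Real.exp (σ * t) := by fun_prop
  have h3 := (h1.continuousOn_mul_of_subset (K := Set.Icc 0 T) h2.continuousOn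
    isCompact_Icc measurableSet_Ioc Set.Ioc_subset_Icc_self)
  refine h3.congr (ae_of_all _ fun t => ?_)
  simp only
  rw [← mul_assoc, ← Real.exp_add]
  simp

theorem ExpType.intervalIntegrable {ω : ℝ} {b : ℝ → ℝ} (hb : ExpType ω b) {x y : ℝ} (hx : 0 ≤ x)
    (hy : 0 ≤ y) : IntervalIntegrable b volume x y := by
  rw [intervalIntegrable_iff]
  exact (hb.integrableOn_Ioc (max x y)).mono_set (Set.Ioc_subset_Ioc_left (le_min hx hy))

theorem continuous_primitive {ω : ℝ} {b : ℝ → ℝ} (hb : ExpType ω b) :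
    Continuous (primitive b) := by
  rw [continuous_iff_continuousAt]
  intro t
  have hT : t < |t| + 1 := by have := le_abs_self t; linarith
  set T := |t| + 1
  have hT0 : 0 ≤ T := by positivity
  have h1 : ContinuousOn (fun x => ∫ r in (0 : ℝ)..x, b r) (Set.Icc 0 T) :=
    intervalIntegral.continuousOn_primitive_interval
      (by rw [Set.uIcc_of_le hT0, integrableOn_Icc_iff_integrableOn_Ioc]
          exact hb.integrableOn_Ioc T)
      |>.mono (by rw [Set.uIcc_of_le hT0])
  have h2 : ContinuousOn (primitive b) (Set.Iio T) := by
    refine h1.comp (f := fun x => max x 0) (by fun_prop) fun x hx => ?_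
    exact ⟨le_max_right _ _, max_le (le_of_lt hx) hT0⟩
  exact h2.continuousAt (Iio_mem_nhds hT)

/-- For r ≤ t the factor e^{−σr} e^{σt} is at least 1. This is the exponential growth of the
primitive, needed to solve the scalar equation. -/
theorem abs_integral_le_exp {b : ℝ → ℝ} {ω σ : ℝ} (hb : ExpType ω b) (hσ : ω < σ) (hσ0 : 0 ≤ σ)
    {t : ℝ} (ht : 0 ≤ t) :
    ∫ r in (0 : ℝ)..t, |b r| ≤ (∫ r in Set.Ioi (0 : ℝ), Real.exp (-(σ * r)) * |b r|) *
      Real.exp (σ * t) := by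
  rw [← integral_mul_const, intervalIntegral.integral_of_le ht]
  have hi : IntegrableOn (fun r => Real.exp (-(σ * r)) * |b r| * Real.exp (σ * t)) (Set.Ioi 0) :=
    (hb.abs σ hσ).mul_const (Real.exp (σ * t))
  refine (setIntegral_mono_on (g := fun r => Real.exp (-(σ * r)) * |b r| * Real.exp (σ * t))
    (hb.abs.integrableOn_Ioc t) (hi.mono_set Set.Ioc_subset_Ioi_self)
    measurableSet_Ioc fun r hr => ?_).trans (setIntegral_mono_set hi ?_ ?_)
  · have : 1 ≤ Real.exp (-(σ * r)) * Real.exp (σ * t) := by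
      rw [← Real.exp_add, Real.one_le_exp_iff]
      nlinarith [hr.2]
    nlinarith [abs_nonneg (b r)]
  · exact ae_of_all _ fun r => by simp only [Pi.zero_apply]; positivity
  · exact Set.Ioc_subset_Ioi_self.eventuallyLE

/-- On `[0, T]` the convolution is an integral over the fixed interval `(0, T]`. -/
theorem conv_eq_setIntegral (b s : ℝ → ℝ) {t T : ℝ} (ht : 0 ≤ t) (hT : t ≤ T) :
    conv b s t = ∫ r in Set.Ioc 0 T, b r * (Set.Ioi 0).indicator s (t - r) := by
  rw [conv, intervalIntegral.integral_of_le ht, integral_Ioc_eq_integral_Ioo,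
    setIntegral_congr_fun (g := fun r => b r * (Set.Ioi 0).indicator s (t - r)) measurableSet_Ioo]
  · exact (setIntegral_eq_of_subset_of_forall_sdiff_eq_zero measurableSet_Ioc
      (fun r hr => ⟨hr.1, hr.2.le.trans hT⟩) fun r hr => by
    have : ¬ r < t := fun h => hr.2 ⟨hr.1.1, h⟩
    rw [Set.indicator_of_notMem (by simpa using this), mul_zero]).symm
  · intro r hr
    have : t - r ∈ Set.Ioi (0 : ℝ) := sub_pos.mpr hr.2
    simp only [Set.indicator_of_mem this]

theorem measurable_indicator_sub {s : ℝ → ℝ} (hs : Continuous s) (x : ℝ) :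
    Measurable fun r => (Set.Ioi (0 : ℝ)).indicator s (x - r) :=
  (hs.measurable.indicator measurableSet_Ioi).comp (by fun_prop)

theorem ae_ne_restrict (t T : ℝ) : ∀ᵐ r ∂(volume.restrict (Set.Ioc 0 T)), r ≠ t :=
  ae_restrict_of_ae (Measure.ae_ne volume t)

/-- As `b` may be unbounded, the dependence on t is kept in the continuous factor s(t − r), cut off
at 0. The integrand is dominated by a multiple of |b|, and for fixed t the cut-off jumps only at r =
t. -/
theorem continuousOn_conv {ω : ℝ} {b s : ℝ → ℝ} (hb : ExpType ω b) (hs : Continuous s) :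
    ContinuousOn (conv b s) (Set.Ici 0) := by
  intro t ht
  have ht : 0 ≤ t := ht
  set T := t + 1
  obtain ⟨K, hK⟩ := (isCompact_Icc (a := (0 : ℝ)) (b := T)).exists_bound_of_continuousOn
    hs.continuousOn
  have hbi := hb.integrableOn_Ioc T
  have hT : t < T := by simp [T]
  have hc : ContinuousAt (fun x => ∫ r in Set.Ioc 0 T, b r * (Set.Ioi 0).indicator s (x - r)) t := by
    refine continuousAt_of_dominated (bound := fun r => |b r| * |K|) ?_ ?_
      (hbi.norm.mul_const _) ?_
    · exact Eventually.of_forall fun x =>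
        hbi.aestronglyMeasurable.mul (measurable_indicator_sub hs x).aestronglyMeasurable
    · filter_upwards [Iio_mem_nhds hT] with x hx
      filter_upwards [ae_restrict_mem measurableSet_Ioc] with r hr
      rw [norm_mul]
      refine mul_le_mul_of_nonneg_left ?_ (abs_nonneg _)
      by_cases h : x - r ∈ Set.Ioi (0 : ℝ)
      · rw [Set.indicator_of_mem h]
        exact (hK _ ⟨le_of_lt h, by have : x < T := hx; linarith [hr.1]⟩).trans (le_abs_self K)
      · rw [Set.indicator_of_notMem h]; simp
    · filter_upwards [ae_ne_restrict t T] with r hr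
      refine continuousAt_const.mul ?_
      have h1 : ContinuousAt ((Set.Ioi (0 : ℝ)).indicator s) (t - r) := by
        rcases lt_or_gt_of_ne hr with h | h
        · exact hs.continuousAt.congr (by
            filter_upwards [Ioi_mem_nhds (sub_pos.mpr h)] with y hy
            rw [Set.indicator_of_mem hy])
        · exact (continuousAt_const (y := (0 : ℝ))).congr (by
            filter_upwards [Iio_mem_nhds (sub_neg.mpr h)] with y hy
            rw [Set.indicator_of_notMem (by simpa using le_of_lt hy)])
      exact ContinuousAt.comp (f := fun x => x - r) (by simpa using h1) (by fun_prop)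
  refine (hc.continuousWithinAt (s := Set.Ici 0)).congr_of_eventuallyEq ?_
    (conv_eq_setIntegral b s ht hT.le)
  filter_upwards [self_mem_nhdsWithin, nhdsWithin_le_nhds (Iio_mem_nhds hT)] with x hx hx'
  exact conv_eq_setIntegral b s hx (le_of_lt hx')

theorem abs_conv_le {ω : ℝ} {b s : ℝ → ℝ} (hb : ExpType ω b) {t K : ℝ} (ht : 0 ≤ t)
    (hK : ∀ r, 0 ≤ r → r ≤ t → |s r| ≤ K) : |conv b s t| ≤ (∫ r in (0 : ℝ)..t, |b r|) * K := by
  rw [← intervalIntegral.integral_mul_const, ← Real.norm_eq_abs, conv]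
  refine intervalIntegral.norm_integral_le_of_norm_le ht (ae_of_all _ fun r hr => ?_)
    ((hb.abs.intervalIntegrable le_rfl ht).mul_const _)
  rw [norm_mul]
  refine mul_le_mul_of_nonneg_left (hK _ (sub_nonneg.mpr hr.2) (by linarith [hr.1])) (abs_nonneg _)

/-- Fubini for the convolution of a primitive. -/
theorem integral_primitive_mul {ω : ℝ} {b s : ℝ → ℝ} (hb : ExpType ω b) (hs : Continuous s) {t : ℝ}
    (ht : 0 ≤ t) : ∫ r in (0 : ℝ)..t, primitive b (t - r) * s r =
      ∫ r in (0 : ℝ)..t, b r * primitive s (t - r) := by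
  -- The indicator of the triangle τ + r ≤ t turns both sides into iterated integrals over the
  -- square (0, t]².
  set D : ℝ → ℝ → ℝ := fun τ r => {p : ℝ × ℝ | p.1 + p.2 ≤ t}.indicator (fun p => b p.2 * s p.1) (τ, r)
  have hm : MeasurableSet {p : ℝ × ℝ | p.1 + p.2 ≤ t} :=
    measurableSet_le (by fun_prop) measurable_const
  have hsi : IntegrableOn s (Set.Ioc 0 t) :=
    hs.continuousOn.integrableOn_Icc.mono_set Set.Ioc_subset_Icc_self
  have hbi := hb.integrableOn_Ioc t
  have hD : Integrable (Function.uncurry D)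
      ((volume.restrict (Set.Ioc 0 t)).prod (volume.restrict (Set.Ioc 0 t))) := by
    have := (Integrable.mul_prod hsi hbi).indicator hm
    refine this.congr (ae_of_all _ fun p => ?_)
    simp only [Function.uncurry, D, Prod.mk.eta]
    congr 1
    ext q
    ring
  have key := integral_integral_swap hD
  have half : ∀ (f : ℝ → ℝ) (x : ℝ), x ∈ Set.Ioc 0 t →
      ∫ r in Set.Ioc 0 t, {r : ℝ | x + r ≤ t}.indicator f r = primitive f (t - x) := by
    intro f x hx
    have h0 : 0 ≤ t - x := sub_nonneg.mpr hx.2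
    have hms : MeasurableSet {r : ℝ | x + r ≤ t} := measurableSet_le (by fun_prop) measurable_const
    rw [primitive, max_eq_left h0, intervalIntegral.integral_of_le h0,
      setIntegral_indicator hms]
    congr 2
    ext r
    constructor
    · rintro ⟨h1, h2⟩
      have h2 : x + r ≤ t := h2
      exact ⟨h1.1, by linarith⟩
    · rintro ⟨h1, h2⟩
      exact ⟨⟨h1, by linarith [hx.1]⟩, show x + r ≤ t by linarith⟩
  rw [intervalIntegral.integral_of_le ht, intervalIntegral.integral_of_le ht]
  calc _ = ∫ τ in Set.Ioc 0 t, ∫ r in Set.Ioc 0 t, D τ r := by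
        refine setIntegral_congr_fun measurableSet_Ioc fun τ hτ => ?_
        rw [← half b τ hτ, ← integral_mul_const]
        congr 1
        ext r
        by_cases h : τ + r ≤ t <;> simp [D, Set.indicator, h]
    _ = ∫ r in Set.Ioc 0 t, ∫ τ in Set.Ioc 0 t, D τ r := key
    _ = _ := by
        refine setIntegral_congr_fun measurableSet_Ioc fun r hr => ?_
        rw [← half s r hr, ← integral_const_mul]
        congr 1
        ext τ
        by_cases h : τ + r ≤ t
        · have h' : r + τ ≤ t := by linarith
          simp [D, Set.indicator, h, h']
        · have h' : ¬ r + τ ≤ t := by linarith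
          simp [D, Set.indicator, h, h']

/-- The derivative of the convolution with a primitive. -/
theorem hasDerivAt_integral_primitive_mul {ω : ℝ} {b s : ℝ → ℝ} (hb : ExpType ω b)
    (hs : Continuous s) {t : ℝ} (ht : 0 < t) :
    HasDerivAt (fun t => ∫ r in (0 : ℝ)..t, primitive b (t - r) * s r) (conv b s t) t := by
  set T := t + 1
  have hT : t < T := by simp [T]
  obtain ⟨K, hK⟩ := (isCompact_Icc (a := (0 : ℝ)) (b := T)).exists_bound_of_continuousOn
    hs.continuousOn
  have hbi := hb.integrableOn_Ioc T
  have hsc : ∀ x y : ℝ, IntervalIntegrable s volume x y := fun x y => hs.intervalIntegrable _ _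
  have hprim : ∀ y : ℝ, y ≠ 0 →
      HasDerivAt (primitive s) ((Set.Ioi (0 : ℝ)).indicator s y) y := by
    intro y hy
    rcases lt_or_gt_of_ne hy with h | h
    · rw [Set.indicator_of_notMem (by simpa using h.le)]
      refine (hasDerivAt_const y (0 : ℝ)).congr_of_eventuallyEq ?_
      filter_upwards [Iio_mem_nhds h] with x hx
      rw [primitive, max_eq_right (le_of_lt hx), intervalIntegral.integral_same]
    · rw [Set.indicator_of_mem (Set.mem_Ioi.mpr h)]
      refine (intervalIntegral.integral_hasDerivAt_right (hsc 0 y)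
        hs.stronglyMeasurable.stronglyMeasurableAtFilter hs.continuousAt).congr_of_eventuallyEq ?_
      filter_upwards [Ioi_mem_nhds h] with x hx
      rw [primitive, max_eq_left (le_of_lt hx)]
  have hlip : LipschitzOnWith (Real.nnabs K) (primitive s) (Set.Iic T) := by
    refine LipschitzOnWith.of_dist_le_mul fun x hx y hy => ?_
    rw [primitive, primitive, Real.dist_eq, intervalIntegral.integral_interval_sub_left
      (hsc _ _) (hsc _ _), ← Real.norm_eq_abs]
    refine (intervalIntegral.norm_integral_le_of_norm_le_const (C := |K|) fun r hr => ?_).trans ?_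
    · refine (hK r ?_).trans (le_abs_self K)
      have hr' := Set.uIoc_subset_uIcc hr
      rw [Set.mem_uIcc] at hr'
      have hT0 : 0 ≤ T := by linarith
      rcases hr' with h | h
      · exact ⟨(le_max_right _ _).trans h.1, h.2.trans (max_le hx hT0)⟩
      · exact ⟨(le_max_right _ _).trans h.1, h.2.trans (max_le hy hT0)⟩
    · rw [Real.coe_nnabs]
      gcongr
      rw [Real.dist_eq]
      simpa using abs_max_sub_max_le_max x 0 y 0
  have hpc : Continuous (primitive s) := by
    have : Continuous fun x => ∫ r in (0 : ℝ)..x, s r :=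
      intervalIntegral.continuous_primitive hsc 0
    exact this.comp (by fun_prop : Continuous fun x : ℝ => max x 0)
  -- With the primitive moved from `b` to `s`, the integrand is Lipschitz in t with constant |K
  -- b(r)| and differentiable except at r = t, so differentiation under the integral applies.
  have key := (hasDerivAt_integral_of_dominated_loc_of_lip
    (μ := volume.restrict (Set.Ioc 0 T)) (F := fun x r => b r * primitive s (x - r))
    (F' := fun r => b r * (Set.Ioi 0).indicator s (t - r)) (s := Set.Iio T)
    (bound := fun r => |b r| * |K|) (x₀ := t) (Iio_mem_nhds hT) ?_ ?_ ?_ ?_ ?_ ?_).2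
  · rw [← conv_eq_setIntegral b s ht.le hT.le] at key
    refine key.congr_of_eventuallyEq ?_
    filter_upwards [Ioo_mem_nhds ht hT] with x hx
    rw [integral_primitive_mul hb hs hx.1.le, intervalIntegral.integral_of_le hx.1.le]
    refine (setIntegral_eq_of_subset_of_forall_sdiff_eq_zero measurableSet_Ioc
      (fun r hr => ⟨hr.1, hr.2.trans hx.2.le⟩) fun r hr => ?_).symm
    have : ¬ r ≤ x := fun h => hr.2 ⟨hr.1.1, h⟩
    rw [primitive, max_eq_right (by linarith), intervalIntegral.integral_same, mul_zero]
  · exact Eventually.of_forall fun x => hbi.aestronglyMeasurable.mul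
      (hpc.comp (by fun_prop : Continuous fun r => x - r)).aestronglyMeasurable
  · refine Integrable.mul_bdd (c := |K| * T) hbi
      (hpc.comp (by fun_prop : Continuous fun r => t - r)).aestronglyMeasurable ?_
    filter_upwards [ae_restrict_mem measurableSet_Ioc] with r hr
    have h1 := hlip.dist_le_mul (t - r) (by have := hr.1; simp only [Set.mem_Iic]; linarith) 0
      (by simp only [Set.mem_Iic]; linarith)
    have h2 : primitive s 0 = 0 := by simp [primitive]
    rw [h2, dist_zero_right, Real.coe_nnabs, Real.dist_eq, sub_zero] at h1
    refine h1.trans ?_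
    gcongr
    rw [abs_le]
    constructor <;> linarith [hr.1, hr.2]
  · exact hbi.aestronglyMeasurable.mul (measurable_indicator_sub hs t).aestronglyMeasurable
  · filter_upwards [ae_restrict_mem measurableSet_Ioc] with r hr
    refine LipschitzOnWith.of_dist_le_mul fun x hx y hy => ?_
    have hx : x < T := hx
    have hy : y < T := hy
    rw [Real.dist_eq, ← mul_sub, abs_mul, Real.coe_nnabs, abs_mul, abs_abs, abs_abs, mul_assoc]
    gcongr
    have := hlip.dist_le_mul (x - r) (by have := hr.1; simp only [Set.mem_Iic]; linarith) (y - r)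
      (by have := hr.1; simp only [Set.mem_Iic]; linarith)
    simpa [Real.dist_eq] using this
  · exact hbi.norm.mul_const _
  · filter_upwards [ae_ne_restrict t T] with r hr
    exact ((hprim (t - r) (sub_ne_zero.mpr hr.symm)).comp_sub_const t r).const_mul _

/-! ### The scalar resolvent -/

/-- `s` is the scalar resolvent function: `s + μ B * s = 1` with `B` the primitive of `b`. -/
structure IsScalarResolvent (b : ℝ → ℝ) (μ : ℝ) (s : ℝ → ℝ) : Prop where
  continuous : Continuous s
  growth : ∃ K ω : ℝ, 0 < ω ∧ ∀ t, 0 ≤ t → |s t| ≤ K * Real.exp (ω * t)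
  equation : ∀ t, 0 ≤ t → s t + μ * ∫ r in (0 : ℝ)..t, primitive b (t - r) * s r = 1

theorem exists_isScalarResolvent {b : ℝ → ℝ} (hb : ExpType 0 b) (μ : ℝ) :
    ∃ s, IsScalarResolvent b μ s := by
  obtain ⟨u, hu, ⟨K, ω, hK⟩, he⟩ := exists_volterra_solution (k := fun t => μ * primitive b t)
    ((continuous_primitive hb).const_mul μ)
    (N := |μ| * ∫ r in Set.Ioi (0 : ℝ), Real.exp (-(1 * r)) * |b r|) (fun t ht => by
      rw [abs_mul, mul_assoc]
      gcongr
      rw [primitive, max_eq_left ht]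
      refine (intervalIntegral.abs_integral_le_integral_abs ht).trans ?_
      simpa using abs_integral_le_exp hb zero_lt_one zero_le_one ht)
  refine ⟨u, hu, ⟨K, max ω 1, by positivity, fun t ht => (hK t ht).trans ?_⟩, fun t ht => ?_⟩
  · have hK0 : 0 ≤ K := by
      have := (abs_nonneg _).trans (hK 0 le_rfl)
      simpa using this
    gcongr
    exact le_max_left _ _
  · rw [← he t ht, ← intervalIntegral.integral_const_mul]
    simp only [mul_assoc]

theorem IsScalarResolvent.apply_zero {b s : ℝ → ℝ} {μ : ℝ} (hs : IsScalarResolvent b μ s) :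
    s 0 = 1 := by
  simpa using hs.equation 0 le_rfl

theorem IsScalarResolvent.hasDerivAt {b s : ℝ → ℝ} {μ : ℝ} (hb : ExpType 0 b)
    (hs : IsScalarResolvent b μ s) {t : ℝ} (ht : 0 < t) : HasDerivAt s (-(μ * conv b s t)) t := by
  have h := ((hasDerivAt_integral_primitive_mul hb hs.continuous ht).const_mul μ).const_sub 1
  refine h.congr_of_eventuallyEq ?_
  filter_upwards [Ioi_mem_nhds ht] with x hx
  rw [← hs.equation x (le_of_lt hx)]
  ring

/-- The denominator `z + μ b̂(z)` of the transformed resolvent. -/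
noncomputable def symb (b : ℝ → ℝ) (μ : ℝ) (z : ℂ) : ℂ := z + μ * laplace b z

/-- The first derivative of `symb`. -/
noncomputable def symb' (b : ℝ → ℝ) (μ : ℝ) (z : ℂ) : ℂ := 1 - μ * laplace (fun t => t * b t) z

/-- The second derivative of `symb`. -/
noncomputable def symb'' (b : ℝ → ℝ) (μ : ℝ) (z : ℂ) : ℂ :=
  μ * laplace (fun t => t * (t * b t)) z

theorem hasDerivAt_symb {b : ℝ → ℝ} (hb : ExpType 0 b) (μ : ℝ) {z : ℂ} (hz : 0 < z.re) :
    HasDerivAt (symb b μ) (symb' b μ z) z := by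
  refine ((hasDerivAt_id z).add ((hasDerivAt_laplace hb hz).const_mul (μ : ℂ))).congr_deriv ?_
  simp only [symb']
  ring

theorem hasDerivAt_symb' {b : ℝ → ℝ} (hb : ExpType 0 b) (μ : ℝ) {z : ℂ} (hz : 0 < z.re) :
    HasDerivAt (symb' b μ) (symb'' b μ z) z := by
  refine ((hasDerivAt_const z (1 : ℂ)).sub
    ((hasDerivAt_laplace hb.id_mul hz).const_mul (μ : ℂ))).congr_deriv ?_
  simp only [symb'']
  ring

/-- The Laplace transform of `t s(t)`. -/
noncomputable def transS (b : ℝ → ℝ) (μ : ℝ) (z : ℂ) : ℂ := symb' b μ z / symb b μ z ^ 2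

/-- The Laplace transform of `t² s'(t)`. -/
noncomputable def transD (b : ℝ → ℝ) (μ : ℝ) (z : ℂ) : ℂ :=
  -(2 * symb' b μ z / symb b μ z ^ 2) - z * symb'' b μ z / symb b μ z ^ 2 +
    2 * z * symb' b μ z ^ 2 / symb b μ z ^ 3

theorem isOpen_re_gt (ω : ℝ) : IsOpen {z : ℂ | ω < z.re} :=
  isOpen_lt continuous_const Complex.continuous_re

theorem laplace_id_mul_of_eq {f : ℝ → ℝ} {ω : ℝ} (hf : ExpType ω f) {g : ℂ → ℂ} {g' z : ℂ}
    (hg : HasDerivAt g g' z) (hz : ω < z.re) (h : ∀ w : ℂ, ω < w.re → laplace f w = g w) :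
    laplace (fun t => t * f t) z = -g' := by
  have h1 : HasDerivAt (laplace f) g' z := hg.congr_of_eventuallyEq (by
    filter_upwards [(isOpen_re_gt ω).mem_nhds hz] with w hw
    exact h w hw)
  rw [← (hasDerivAt_laplace hf hz).unique h1, neg_neg]

theorem IsScalarResolvent.expType {b s : ℝ → ℝ} {μ : ℝ} (hs : IsScalarResolvent b μ s) :
    ∃ ω, 0 < ω ∧ ExpType ω s := by
  obtain ⟨K, ω, hω, hK⟩ := hs.growth
  exact ⟨ω, hω, ExpType.of_le_exp hs.continuous.aestronglyMeasurable fun t ht => hK t ht.le⟩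

/-- Transforming s' = −μ b∗s with s(0) = 1 gives z ŝ − 1 = −μ b̂ ŝ. -/
theorem IsScalarResolvent.laplace_eq {b s : ℝ → ℝ} {μ ω : ℝ} (hb : ExpType 0 b)
    (hs : IsScalarResolvent b μ s) (hω : 0 < ω) (he : ExpType ω s) :
    ∀ z : ℂ, ω < z.re → laplace s z * symb b μ z = 1 := by
  intro z hz
  have hbω : ExpType ω b := hb.mono hω.le
  have hc : ExpType ω (conv b s) := convolution_expType hbω he
  have h1 := laplace_deriv (p' := fun t => (-μ) * conv b s t) he (hc.const_mul (-μ))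
    (fun t ht => by simpa using hs.hasDerivAt hb ht) hs.continuous.continuousWithinAt hz
  rw [laplace_const_mul, hs.apply_zero] at h1
  have h2 : laplace (conv b s) z = laplace b z * laplace s z := laplace_convolution hbω he hz
  rw [h2] at h1
  push_cast at h1
  rw [symb]
  linear_combination h1

theorem hasDerivAt_inv_symb {b : ℝ → ℝ} (hb : ExpType 0 b) (μ : ℝ) {z : ℂ} (hz : 0 < z.re)
    (h0 : symb b μ z ≠ 0) : HasDerivAt (fun w => (symb b μ w)⁻¹) (-transS b μ z) z :=
  ((hasDerivAt_symb hb μ hz).inv h0).congr_deriv (by rw [transS]; ring)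

theorem differentiableOn_transS {b : ℝ → ℝ} (hb : ExpType 0 b) (μ : ℝ)
    (h0 : ∀ z : ℂ, 0 < z.re → symb b μ z ≠ 0) :
    DifferentiableOn ℂ (transS b μ) {z | 0 < z.re} := fun z hz =>
  ((hasDerivAt_symb' hb μ hz).differentiableAt.div
    ((hasDerivAt_symb hb μ hz).differentiableAt.pow 2)
    (pow_ne_zero 2 (h0 z hz))).differentiableWithinAt

theorem differentiableOn_transD {b : ℝ → ℝ} (hb : ExpType 0 b) (μ : ℝ)
    (h0 : ∀ z : ℂ, 0 < z.re → symb b μ z ≠ 0) :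
    DifferentiableOn ℂ (transD b μ) {z | 0 < z.re} := by
  intro z hz
  have hz : 0 < z.re := hz
  have d0 := (hasDerivAt_symb hb μ hz).differentiableAt
  have d1 := (hasDerivAt_symb' hb μ hz).differentiableAt
  have d2 : DifferentiableAt ℂ (symb'' b μ) z :=
    (hasDerivAt_laplace hb.id_mul.id_mul hz).differentiableAt.const_mul _
  have n2 : symb b μ z ^ 2 ≠ 0 := pow_ne_zero 2 (h0 z hz)
  have n3 : symb b μ z ^ 3 ≠ 0 := pow_ne_zero 3 (h0 z hz)
  have hid : DifferentiableAt ℂ (fun w : ℂ => w) z := differentiableAt_id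
  exact (((((d1.const_mul 2).div (d0.pow 2) n2).neg).sub ((hid.mul d2).div (d0.pow 2) n2)).add
    (((hid.const_mul 2).mul (d1.pow 2)).div (d0.pow 3) n3)).differentiableWithinAt

theorem IsScalarResolvent.laplace_id_mul {b s : ℝ → ℝ} {μ ω : ℝ} (hb : ExpType 0 b)
    (hs : IsScalarResolvent b μ s) (hω : 0 < ω) (he : ExpType ω s)
    (h0 : ∀ z : ℂ, 0 < z.re → symb b μ z ≠ 0) {z : ℂ} (hz : ω < z.re) :
    laplace (fun t => t * s t) z = transS b μ z := by
  have hz0 : 0 < z.re := hω.trans hz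
  rw [laplace_id_mul_of_eq he (hasDerivAt_inv_symb hb μ hz0 (h0 z hz0)) hz, neg_neg]
  intro w hw
  exact eq_inv_of_mul_eq_one_left (hs.laplace_eq hb hω he w hw)

/-- The transform of s' is z/q − 1, and two factors t differentiate it twice. They provide the
quadratic decay that makes the inversion integral converge absolutely. -/
theorem IsScalarResolvent.laplace_id_mul_deriv {b s : ℝ → ℝ} {μ ω : ℝ} (hb : ExpType 0 b)
    (hs : IsScalarResolvent b μ s) (hω : 0 < ω) (he : ExpType ω s)
    (h0 : ∀ z : ℂ, 0 < z.re → symb b μ z ≠ 0) {z : ℂ} (hz : ω < z.re) :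
    laplace (fun t => t * (t * (-μ * conv b s t))) z = transD b μ z := by
  have hbω : ExpType ω b := hb.mono hω.le
  have hc : ExpType ω (fun t => -μ * conv b s t) := (convolution_expType hbω he).const_mul (-μ)
  have h1 : ∀ w : ℂ, ω < w.re → laplace (fun t => -μ * conv b s t) w =
      w * (symb b μ w)⁻¹ - 1 := by
    intro w hw
    have h1 := laplace_deriv he hc
      (fun t ht => by simpa using hs.hasDerivAt hb ht) hs.continuous.continuousWithinAt hw
    rw [hs.apply_zero, eq_inv_of_mul_eq_one_left (hs.laplace_eq hb hω he w hw)] at h1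
    rw [h1]
    simp
  have h2 : ∀ w : ℂ, ω < w.re → HasDerivAt (fun w => w * (symb b μ w)⁻¹ - 1)
      ((symb b μ w)⁻¹ - w * transS b μ w) w := by
    intro w hw
    have hw0 : 0 < w.re := hω.trans hw
    refine (((hasDerivAt_id w).mul (hasDerivAt_inv_symb hb μ hw0 (h0 w hw0))).sub_const
      1).congr_deriv ?_
    simp
    ring
  have h3 : ∀ w : ℂ, ω < w.re → laplace (fun t => t * (-μ * conv b s t)) w =
      w * transS b μ w - (symb b μ w)⁻¹ := by
    intro w hw
    rw [laplace_id_mul_of_eq hc (h2 w hw) hw h1]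
    ring
  have hz0 : 0 < z.re := hω.trans hz
  have hn := h0 z hz0
  have h4 : HasDerivAt (transS b μ) ((symb'' b μ z * symb b μ z ^ 2 -
      symb' b μ z * (2 * symb b μ z * symb' b μ z)) / (symb b μ z ^ 2) ^ 2) z := by
    refine ((hasDerivAt_symb' hb μ hz0).div ((hasDerivAt_symb hb μ hz0).pow 2)
      (pow_ne_zero 2 hn)).congr_deriv ?_
    simp
  have h5 := ((hasDerivAt_id z).mul h4).sub (hasDerivAt_inv_symb hb μ hz0 hn)
  rw [laplace_id_mul_of_eq hc.id_mul h5 hz h3, transD, transS]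
  simp only [id]
  field_simp
  ring

/-! ### Estimates for the scalar resolvent -/

/-- A kernel whose Laplace transform takes values in a proper sector of the right half-plane and
which is `2`-regular, written with the transforms of `b`, `t b` and `t² b`. -/
structure IsParabolicKernel (b : ℝ → ℝ) (δ C : ℝ) : Prop where
  expType : ExpType 0 b
  pos : 0 < δ
  le_one : δ ≤ 1
  nonneg : 0 ≤ C
  sector : ∀ z : ℂ, 0 < z.re → δ * ‖laplace b z‖ ≤ (laplace b z).re
  regular_one : ∀ z : ℂ, 0 < z.re → ‖z‖ * ‖laplace (fun t => t * b t) z‖ ≤ C * ‖laplace b z‖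
  regular_two : ∀ z : ℂ, 0 < z.re →
    ‖z‖ ^ 2 * ‖laplace (fun t => t * (t * b t)) z‖ ≤ C * ‖laplace b z‖

/-- If |z| ≥ 2|w|, then w is too small to cancel z. Otherwise Re(z + w) ≥ δ|w| suffices on its own.
-/
theorem sector_add_lower {δ : ℝ} (h0 : 0 < δ) (h1 : δ ≤ 1) {z w : ℂ} (hz : 0 < z.re)
    (hw : δ * ‖w‖ ≤ w.re) : δ / 3 * (‖z‖ + ‖w‖) ≤ ‖z + w‖ := by
  have a1 : w.re ≤ ‖z + w‖ := by
    have := Complex.re_le_norm (z + w)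
    rw [Complex.add_re] at this
    linarith
  have a2 : ‖z‖ - ‖w‖ ≤ ‖z + w‖ := by
    have := norm_sub_norm_le z (-w)
    rwa [norm_neg, sub_neg_eq_add] at this
  have := norm_nonneg z
  have := norm_nonneg w
  rcases le_total ‖z‖ (2 * ‖w‖) with h | h
  · nlinarith
  · nlinarith

theorem IsParabolicKernel.symb_lower {b : ℝ → ℝ} {δ C μ : ℝ} (h : IsParabolicKernel b δ C)
    (hμ : 0 ≤ μ) {z : ℂ} (hz : 0 < z.re) :
    δ / 3 * (‖z‖ + μ * ‖laplace b z‖) ≤ ‖symb b μ z‖ := by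
  have e1 : ‖(μ : ℂ) * laplace b z‖ = μ * ‖laplace b z‖ := by
    rw [norm_mul, Complex.norm_real, Real.norm_of_nonneg hμ]
  have := sector_add_lower h.pos h.le_one hz (w := μ * laplace b z) (by
    rw [e1, Complex.re_ofReal_mul, mul_left_comm]
    gcongr
    exact h.sector z hz)
  rwa [e1] at this

theorem norm_pos_of_re_pos {z : ℂ} (hz : 0 < z.re) : 0 < ‖z‖ := hz.trans_le (Complex.re_le_norm z)

theorem IsParabolicKernel.symb_ne_zero {b : ℝ → ℝ} {δ C μ : ℝ} (h : IsParabolicKernel b δ C)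
    (hμ : 0 ≤ μ) {z : ℂ} (hz : 0 < z.re) : symb b μ z ≠ 0 := by
  rw [← norm_pos_iff]
  refine lt_of_lt_of_le ?_ (h.symb_lower hμ hz)
  have := h.pos
  have := norm_pos_of_re_pos hz
  positivity

/-- The constant in the estimates for the transformed resolvent. -/
noncomputable def symbConst (δ C : ℝ) : ℝ := 3 * (3 / δ * (1 + C)) + 2 * (3 / δ * (1 + C)) ^ 2

theorem symbConst_pos {δ C : ℝ} (hδ : 0 < δ) (hC : 0 ≤ C) : 0 < symbConst δ C := by
  unfold symbConst
  positivity

/-- Regularity passes from b̂ to q because |z| + μ|b̂| is bounded by a multiple of |q|, uniformly in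
μ. -/
theorem IsParabolicKernel.symb_deriv_bounds {b : ℝ → ℝ} {δ C μ : ℝ} (h : IsParabolicKernel b δ C)
    (hμ : 0 ≤ μ) {z : ℂ} (hz : 0 < z.re) :
    ‖z‖ * ‖symb' b μ z‖ ≤ 3 / δ * (1 + C) * ‖symb b μ z‖ ∧
    ‖z‖ ^ 2 * ‖symb'' b μ z‖ ≤ 3 / δ * (1 + C) * ‖symb b μ z‖ := by
  have hδ := h.pos
  have hC := h.nonneg
  have h1 : (1 + C) * (‖z‖ + μ * ‖laplace b z‖) ≤ 3 / δ * (1 + C) * ‖symb b μ z‖ := by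
    have := h.symb_lower hμ hz
    calc _ = 3 / δ * (1 + C) * (δ / 3 * (‖z‖ + μ * ‖laplace b z‖)) := by field_simp
      _ ≤ _ := by gcongr
  have hz0 := norm_nonneg z
  have hl0 := norm_nonneg (laplace b z)
  constructor
  · refine le_trans ?_ h1
    have e1 : ‖symb' b μ z‖ ≤ 1 + μ * ‖laplace (fun t => t * b t) z‖ := by
      refine (norm_sub_le _ _).trans ?_
      simp [abs_of_nonneg hμ]
    calc _ ≤ ‖z‖ * (1 + μ * ‖laplace (fun t => t * b t) z‖) := by gcongr
      _ = ‖z‖ + μ * (‖z‖ * ‖laplace (fun t => t * b t) z‖) := by ring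
      _ ≤ ‖z‖ + μ * (C * ‖laplace b z‖) := by
        have := mul_le_mul_of_nonneg_left (h.regular_one z hz) hμ
        linarith
      _ ≤ _ := by nlinarith [mul_nonneg hC hz0, mul_nonneg hμ hl0]
  · refine le_trans ?_ h1
    have e1 : ‖symb'' b μ z‖ = μ * ‖laplace (fun t => t * (t * b t)) z‖ := by
      simp [symb'', abs_of_nonneg hμ]
    rw [e1]
    calc _ = μ * (‖z‖ ^ 2 * ‖laplace (fun t => t * (t * b t)) z‖) := by ring
      _ ≤ μ * (C * ‖laplace b z‖) := mul_le_mul_of_nonneg_left (h.regular_two z hz) hμ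
      _ ≤ _ := by nlinarith [mul_nonneg hC hz0, mul_nonneg hμ hl0]

/-- Every derivative of q costs a factor 1/|z| relative to |q|, so each term of the two transforms
has size 1/(|z||q|). -/
theorem IsParabolicKernel.norm_trans_le {b : ℝ → ℝ} {δ C μ : ℝ} (h : IsParabolicKernel b δ C)
    (hμ : 0 ≤ μ) {z : ℂ} (hz : 0 < z.re) :
    ‖transS b μ z‖ ≤ symbConst δ C / (‖z‖ * ‖symb b μ z‖) ∧
    ‖transD b μ z‖ ≤ symbConst δ C / (‖z‖ * ‖symb b μ z‖) := by
  obtain ⟨h1, h2⟩ := h.symb_deriv_bounds hμ hz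
  have hδ := h.pos
  have hC := h.nonneg
  have hz0 := norm_pos_of_re_pos hz
  have hq0 : 0 < ‖symb b μ z‖ := norm_pos_iff.mpr (h.symb_ne_zero hμ hz)
  unfold symbConst
  set E := 3 / δ * (1 + C)
  have hE : 0 < E := by positivity
  set q := ‖symb b μ z‖
  set r := ‖z‖
  have h1' : ‖symb' b μ z‖ ≤ E * q / r := by rw [le_div_iff₀ hz0]; linarith
  have h2' : ‖symb'' b μ z‖ ≤ E * q / r ^ 2 := by rw [le_div_iff₀ (by positivity)]; linarith
  constructor
  · rw [transS, norm_div, norm_pow]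
    calc _ ≤ E * q / r / q ^ 2 := by gcongr
      _ = E / (r * q) := by field_simp
      _ ≤ _ := by gcongr; nlinarith
  · have e1 : ‖transD b μ z‖ ≤ 2 * ‖symb' b μ z‖ / q ^ 2 + r * ‖symb'' b μ z‖ / q ^ 2 +
        2 * r * ‖symb' b μ z‖ ^ 2 / q ^ 3 := by
      refine (norm_add_le _ _).trans (add_le_add ((norm_sub_le _ _).trans (le_of_eq ?_))
        (le_of_eq ?_)) <;> simp [q, r]
    calc _ ≤ _ := e1
      _ ≤ 2 * (E * q / r) / q ^ 2 + r * (E * q / r ^ 2) / q ^ 2 +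
          2 * r * (E * q / r) ^ 2 / q ^ 3 := by gcongr
      _ = _ := by field_simp; ring

/-- Here |q| ≥ (δ/3)|z| is used. It gives decay uniform in μ and justifies the contour shift. -/
theorem IsParabolicKernel.norm_trans_le_sq {b : ℝ → ℝ} {δ C μ : ℝ} (h : IsParabolicKernel b δ C)
    (hμ : 0 ≤ μ) {z : ℂ} (hz : 0 < z.re) :
    symbConst δ C / (‖z‖ * ‖symb b μ z‖) ≤ 3 / δ * symbConst δ C / ‖z‖ ^ 2 := by
  have hδ := h.pos
  have hz0 := norm_pos_of_re_pos hz
  have hQ := symbConst_pos hδ h.nonneg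
  have hq : δ / 3 * ‖z‖ ≤ ‖symb b μ z‖ := by
    refine le_trans ?_ (h.symb_lower hμ hz)
    have := norm_nonneg (laplace b z)
    gcongr
    nlinarith
  calc _ ≤ symbConst δ C / (‖z‖ * (δ / 3 * ‖z‖)) := by gcongr
    _ = _ := by field_simp

section

variable {b s : ℝ → ℝ} {δ C μ : ℝ}

/-- Both `t s(t)` and `t² s'(t)` are controlled by any integrable majorant of `1 / (|z| |q(z)|)` on
the line `Re z = 1 / t`. -/
theorem IsScalarResolvent.abs_le_of_majorant (h : IsParabolicKernel b δ C) (hμ : 0 < μ)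
    (hs : IsScalarResolvent b μ s) {t : ℝ} (ht : 0 < t) {m : ℝ → ℝ} (hm : Integrable m)
    (hle : ∀ᵐ y : ℝ, symbConst δ C /
      (‖((t⁻¹ : ℝ) + y * Complex.I : ℂ)‖ * ‖symb b μ ((t⁻¹ : ℝ) + y * Complex.I)‖) ≤ m y) :
    |s t| ≤ Real.exp 1 / (2 * Real.pi) * (∫ y, m y) / t ∧
    |μ * conv b s t| ≤ Real.exp 1 / (2 * Real.pi) * (∫ y, m y) / t ^ 2 := by
  obtain ⟨ω, hω, he⟩ := hs.expType
  have hb := h.expType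
  have h0 : ∀ z : ℂ, 0 < z.re → symb b μ z ≠ 0 := fun z hz => h.symb_ne_zero hμ.le hz
  have hre : ∀ y : ℝ, 0 < ((t⁻¹ : ℝ) + y * Complex.I : ℂ).re := fun y => by simpa using ht
  have hc : ExpType ω (fun t => -μ * conv b s t) :=
    (convolution_expType (hb.mono hω.le) he).const_mul (-μ)
  have hcc : ContinuousOn (fun t => -μ * conv b s t) (Set.Ici 0) :=
    (continuousOn_conv hb hs.continuous).const_smul (-μ)
  constructor
  · have h1 := abs_le_integral_laplace he.id_mul
      (continuous_id.mul hs.continuous).continuousOn (by simp) (differentiableOn_transS hb μ h0)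
      (fun z hz => (h.norm_trans_le hμ.le hz).1.trans (h.norm_trans_le_sq hμ.le hz))
      (fun z hz _ => hs.laplace_id_mul hb hω he h0 hz) ht
    rw [abs_mul, abs_of_pos ht] at h1
    rw [le_div_iff₀ ht, mul_comm]
    refine h1.trans (mul_le_mul_of_nonneg_left ?_ (by positivity))
    refine integral_mono_of_nonneg (ae_of_all _ fun y => norm_nonneg _) hm ?_
    filter_upwards [hle] with y hy
    exact (h.norm_trans_le hμ.le (hre y)).1.trans hy
  · have h1 := abs_le_integral_laplace hc.id_mul.id_mul
      (continuousOn_id.mul (continuousOn_id.mul hcc)) (by simp) (differentiableOn_transD hb μ h0)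
      (fun z hz => (h.norm_trans_le hμ.le hz).2.trans (h.norm_trans_le_sq hμ.le hz))
      (fun z hz _ => hs.laplace_id_mul_deriv hb hω he h0 hz) ht
    rw [abs_mul, abs_mul, abs_of_pos ht, neg_mul, abs_neg] at h1
    rw [le_div_iff₀ (by positivity), mul_comm, pow_two, mul_assoc]
    refine h1.trans (mul_le_mul_of_nonneg_left ?_ (by positivity))
    refine integral_mono_of_nonneg (ae_of_all _ fun y => norm_nonneg _) hm ?_
    filter_upwards [hle] with y hy
    exact (h.norm_trans_le hμ.le (hre y)).2.trans hy

/-- The bounds `|s| ≤ M` and `|s'| ≤ M / t`, uniformly in `μ`. -/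
theorem IsScalarResolvent.abs_le_const (h : IsParabolicKernel b δ C) (hμ : 0 < μ)
    (hs : IsScalarResolvent b μ s) {t : ℝ} (ht : 0 < t) :
    |s t| ≤ Real.exp 1 / 2 * (3 / δ * symbConst δ C) ∧
    |μ * conv b s t| ≤ Real.exp 1 / 2 * (3 / δ * symbConst δ C) / t := by
  have ht' : 0 < t⁻¹ := inv_pos.mpr ht
  -- On Re z = 1/t the majorant is a constant over t⁻² + y², with integral proportional to t; this
  -- cancels one power of t.
  have := hs.abs_le_of_majorant h hμ ht
    ((integrable_inv_sq_add_sq ht').const_mul (3 / δ * symbConst δ C)) (ae_of_all _ fun y => by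
      have := h.norm_trans_le_sq hμ.le (z := (t⁻¹ : ℝ) + y * Complex.I) (by simpa using ht)
      rwa [norm_sq_vertical, div_eq_mul_inv _ (_ + _ : ℝ)] at this)
  rw [integral_const_mul, integral_inv_sq_add_sq ht'] at this
  have hpi := Real.pi_pos
  constructor
  · refine this.1.trans (le_of_eq ?_)
    field_simp
  · refine this.2.trans (le_of_eq ?_)
    field_simp

end

/-- The majorant for kernels with `|b̂(z)| ≥ c |z|^{1-ρ}`. -/
theorem integrable_majorant {ρ : ℝ} (h1 : 1 < ρ) (h2 : ρ < 2) :
    Integrable fun x : ℝ => (|x| ^ 2 + |x| ^ (2 - ρ))⁻¹ := by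
  -- Near 0 the term |x|^{2−ρ} dominates, and |x|^{ρ−2} is integrable there because ρ > 1; away from
  -- 0 the quadratic term gives 2/(1 + x²).
  have hr : IntervalIntegrable (fun x : ℝ => |x| ^ (ρ - 2)) volume (-1) 1 := by
    have a1 : IntervalIntegrable (fun x : ℝ => |x| ^ (ρ - 2)) volume 0 1 := by
      refine (intervalIntegral.intervalIntegrable_rpow' (r := ρ - 2) (by linarith)).congr ?_
      intro x hx
      rw [Set.uIoc_of_le zero_le_one] at hx
      simp only [abs_of_pos hx.1]
    have a2 : IntervalIntegrable (fun x : ℝ => |x| ^ (ρ - 2)) volume 0 (-1) := by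
      rw [IntervalIntegrable.iff_comp_neg]
      simpa using a1
    exact a2.symm.trans a1
  have hr' : Integrable (Set.indicator (Set.Ioc (-1) 1) fun x : ℝ => |x| ^ (ρ - 2)) := by
    rw [integrable_indicator_iff measurableSet_Ioc]
    rwa [intervalIntegrable_iff_integrableOn_Ioc_of_le (by norm_num)] at hr
  refine Integrable.mono' ((integrable_inv_one_add_sq.const_mul 2).add hr')
    (Measurable.aestronglyMeasurable (by fun_prop)) ?_
  filter_upwards [Measure.ae_ne volume 0] with x hx
  have hx0 : 0 < |x| := abs_pos.mpr hx
  have hp : 0 < |x| ^ (2 - ρ) := Real.rpow_pos_of_pos hx0 _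
  rw [Real.norm_of_nonneg (by positivity)]
  simp only [Pi.add_apply]
  by_cases h : x ∈ Set.Ioc (-1 : ℝ) 1
  · rw [Set.indicator_of_mem h]
    have e1 : |x| ^ (ρ - 2) = (|x| ^ (2 - ρ))⁻¹ := by
      rw [← Real.rpow_neg hx0.le]; congr 1; ring
    rw [e1]
    have : (|x| ^ 2 + |x| ^ (2 - ρ))⁻¹ ≤ (|x| ^ (2 - ρ))⁻¹ := by
      gcongr
      nlinarith
    have : 0 ≤ 2 * (1 + x ^ 2)⁻¹ := by positivity
    linarith
  · rw [Set.indicator_of_notMem h, add_zero]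
    have hx1 : 1 ≤ |x| := by
      by_contra! hlt
      rw [abs_lt] at hlt
      exact h ⟨hlt.1, hlt.2.le⟩
    have : (|x| ^ 2 + |x| ^ (2 - ρ))⁻¹ ≤ (2⁻¹ * (1 + x ^ 2))⁻¹ := by
      gcongr
      rw [← sq_abs x]
      nlinarith
    rwa [mul_inv, inv_inv] at this

/-- For a = ν^{1/ρ} the substitution x = a y makes both terms scale as a², since ν a^{2−ρ} = a².
Integration then leaves a⁻² · a = ν^{−1/ρ}. -/
theorem majorant_scaling {ρ ν : ℝ} (hρ : 0 < ρ) (hν : 0 < ν) :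
    (fun x : ℝ => (|x| ^ 2 + ν * |x| ^ (2 - ρ))⁻¹) = fun x : ℝ =>
      ((ν ^ (1 / ρ)) ^ 2)⁻¹ * (|(ν ^ (1 / ρ))⁻¹ * x| ^ 2 + |(ν ^ (1 / ρ))⁻¹ * x| ^ (2 - ρ))⁻¹ := by
  set a := ν ^ (1 / ρ) with ha
  have ha0 : 0 < a := Real.rpow_pos_of_pos hν _
  have hν' : ν = a ^ ρ := by
    rw [ha, ← Real.rpow_mul hν.le, one_div, inv_mul_cancel₀ hρ.ne', Real.rpow_one]
  ext x
  rw [← mul_inv]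
  congr 1
  rw [abs_mul, abs_inv, abs_of_pos ha0, Real.mul_rpow (by positivity) (abs_nonneg x),
    Real.inv_rpow ha0.le, Real.rpow_sub ha0, hν', Real.rpow_two]
  have : 0 < a ^ ρ := Real.rpow_pos_of_pos ha0 _
  field_simp

theorem integral_majorant {ρ ν : ℝ} (h1 : 1 < ρ) (h2 : ρ < 2) (hν : 0 < ν) :
    Integrable (fun x : ℝ => (|x| ^ 2 + ν * |x| ^ (2 - ρ))⁻¹) ∧
    ∫ x : ℝ, (|x| ^ 2 + ν * |x| ^ (2 - ρ))⁻¹ =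
      ν ^ (-(1 / ρ)) * ∫ x : ℝ, (|x| ^ 2 + |x| ^ (2 - ρ))⁻¹ := by
  have ha0 : 0 < ν ^ (1 / ρ) := Real.rpow_pos_of_pos hν _
  rw [majorant_scaling (by linarith) hν, Real.rpow_neg hν.le]
  refine ⟨((integrable_majorant h1 h2).comp_mul_left' (inv_ne_zero ha0.ne')).const_mul _, ?_⟩
  rw [integral_const_mul,
    Measure.integral_comp_mul_left (fun x : ℝ => (|x| ^ 2 + |x| ^ (2 - ρ))⁻¹)]
  rw [inv_inv, abs_of_pos ha0, smul_eq_mul]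
  field_simp

/-- The smoothing bounds for kernels with `|b̂(z)| ≥ c |z|^{1-ρ}`. -/
theorem exists_smoothing_bound {b : ℝ → ℝ} {δ C c ρ : ℝ} (h : IsParabolicKernel b δ C)
    (h1 : 1 < ρ) (h2 : ρ < 2) (hc : 0 < c)
    (hlow : ∀ z : ℂ, 0 < z.re → c * ‖z‖ ^ (1 - ρ) ≤ ‖laplace b z‖) :
    ∃ M : ℝ, 0 ≤ M ∧ ∀ (μ : ℝ) (s : ℝ → ℝ), 0 < μ → IsScalarResolvent b μ s → ∀ t, 0 < t →
      |s t| ≤ M * μ ^ (-(1 / ρ)) / t ∧ |μ * conv b s t| ≤ M * μ ^ (-(1 / ρ)) / t ^ 2 := by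
  have hδ := h.pos
  set κ := ∫ x : ℝ, (|x| ^ 2 + |x| ^ (2 - ρ))⁻¹ with hκ
  have hκ0 : 0 ≤ κ := integral_nonneg fun x => by positivity
  have hQ := symbConst_pos hδ h.nonneg
  refine ⟨Real.exp 1 / (2 * Real.pi) * (3 / δ * symbConst δ C * (c ^ (-(1 / ρ)) * κ)),
    by positivity, fun μ s hμ hs t ht => ?_⟩
  have hν : 0 < c * μ := mul_pos hc hμ
  obtain ⟨i1, i2⟩ := integral_majorant h1 h2 hν
  have key := hs.abs_le_of_majorant h hμ ht (i1.const_mul (3 / δ * symbConst δ C)) ?_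
  · rw [integral_const_mul, i2, ← hκ, Real.mul_rpow hc.le hμ.le] at key
    refine ⟨key.1.trans (le_of_eq (by ring)), key.2.trans (le_of_eq (by ring))⟩
  · filter_upwards [Measure.ae_ne volume 0] with y hy
    set z : ℂ := (t⁻¹ : ℝ) + y * Complex.I
    have hz : 0 < z.re := by simpa [z] using ht
    have hy0 : 0 < |y| := abs_pos.mpr hy
    have hyz : |y| ≤ ‖z‖ := by
      have := Complex.abs_im_le_norm z
      simpa [z] using this
    have hz0 := norm_pos_of_re_pos hz
    have hp : 0 < |y| ^ (2 - ρ) := Real.rpow_pos_of_pos hy0 _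
    -- The extra factor |z| makes the exponent 2 − ρ positive, so |z| may be replaced by the smaller
    -- |y| = |Im z|.
    have e1 : |y| ^ 2 + c * μ * |y| ^ (2 - ρ) ≤ ‖z‖ * (‖z‖ + μ * (c * ‖z‖ ^ (1 - ρ))) := by
      have e2 : ‖z‖ * (‖z‖ + μ * (c * ‖z‖ ^ (1 - ρ))) = ‖z‖ ^ 2 + c * μ * ‖z‖ ^ (2 - ρ) := by
        have : ‖z‖ ^ (2 - ρ) = ‖z‖ * ‖z‖ ^ (1 - ρ) := by
          rw [← Real.rpow_one_add' hz0.le (by linarith)]; congr 1; ring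
        rw [this]
        ring
      rw [e2]
      gcongr
    have e3 : δ / 3 * (‖z‖ + μ * (c * ‖z‖ ^ (1 - ρ))) ≤ ‖symb b μ z‖ := by
      refine le_trans ?_ (h.symb_lower hμ.le hz)
      gcongr
      exact hlow z hz
    calc _ ≤ symbConst δ C / (δ / 3 * (|y| ^ 2 + c * μ * |y| ^ (2 - ρ))) := by
          refine div_le_div_of_nonneg_left hQ.le (by positivity) ?_
          calc _ ≤ δ / 3 * (‖z‖ * (‖z‖ + μ * (c * ‖z‖ ^ (1 - ρ)))) := by gcongr
            _ = ‖z‖ * (δ / 3 * (‖z‖ + μ * (c * ‖z‖ ^ (1 - ρ)))) := by ring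
            _ ≤ _ := by gcongr
      _ = _ := by field_simp

/-! ### Regular sectorial kernels -/

theorem iteratedDeriv_one_laplace {b : ℝ → ℝ} (hb : ExpType 0 b) {z : ℂ} (hz : 0 < z.re) :
    iteratedDeriv 1 (laplace b) z = -laplace (fun t => t * b t) z := by
  rw [iteratedDeriv_one]
  exact (hasDerivAt_laplace hb hz).deriv

theorem iteratedDeriv_two_laplace {b : ℝ → ℝ} (hb : ExpType 0 b) {z : ℂ} (hz : 0 < z.re) :
    iteratedDeriv 2 (laplace b) z = laplace (fun t => t * (t * b t)) z := by
  rw [iteratedDeriv_succ]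
  have h1 : iteratedDeriv 1 (laplace b) =ᶠ[𝓝 z] fun w => -laplace (fun t => t * b t) w := by
    filter_upwards [(isOpen_re_gt 0).mem_nhds hz] with w hw
    exact iteratedDeriv_one_laplace hb hw
  rw [h1.deriv_eq]
  have h2 := (hasDerivAt_laplace hb.id_mul hz).neg.deriv
  rw [neg_neg] at h2
  exact h2

/-- The constant δ is the cosine of the sector angle. -/
theorem IsSectorial.exists_sector {b : ℝ → ℝ} (h : IsSectorial b) :
    ∃ δ : ℝ, 0 < δ ∧ δ ≤ 1 ∧ ∀ z : ℂ, 0 < z.re → δ * ‖laplace b z‖ ≤ (laplace b z).re := by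
  have hle : ∀ z : ℂ, 0 < z.re → |(laplace b z).arg| ≤ sectorAngle b := by
    intro z hz
    refine le_csSup ⟨Real.pi, ?_⟩ ⟨z, hz, rfl⟩
    rintro _ ⟨w, _, rfl⟩
    exact Complex.abs_arg_le_pi _
  have h0 : 0 ≤ sectorAngle b := (abs_nonneg _).trans (hle 1 (by simp))
  refine ⟨Real.cos (sectorAngle b), Real.cos_pos_of_mem_Ioo ⟨by linarith [Real.pi_pos], h.2⟩,
    Real.cos_le_one _, fun z hz => ?_⟩
  rw [← Complex.norm_mul_cos_arg (laplace b z), mul_comm, ← Real.cos_abs (Complex.arg _)]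
  gcongr
  exact Real.cos_le_cos_of_nonneg_of_le_pi (abs_nonneg _) (by linarith [Real.pi_pos, h.2]) (hle z hz)

theorem KernelAssumption.exists_isParabolicKernel {b : ℝ → ℝ} {ρ : ℝ} (h : KernelAssumption b ρ) :
    ∃ δ C : ℝ, IsParabolicKernel b δ C := by
  have hb : ExpType 0 b := fun σ hσ => h.subexponential σ hσ
  obtain ⟨δ, h1, h2, h3⟩ := h.sectorial.exists_sector
  obtain ⟨C, hC, hr⟩ := h.regular
  refine ⟨δ, C, hb, h1, h2, hC.le, h3, fun z hz => ?_, fun z hz => ?_⟩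
  · have := hr z hz 1 (by norm_num)
    rwa [iteratedDeriv_one_laplace hb hz, norm_neg, pow_one] at this
  · have := hr z hz 2 le_rfl
    rwa [iteratedDeriv_two_laplace hb hz] at this

/-- Points that see each other under at most a right angle have comparable values. -/
theorem IsParabolicKernel.norm_laplace_le {b : ℝ → ℝ} {δ C : ℝ} (h : IsParabolicKernel b δ C)
    {z w : ℂ} (hz : 0 < z.re) (hw : 0 < w.re) (hzw : 0 ≤ z.re * w.re + z.im * w.im) {m R : ℝ}
    (hm : 0 < m) (hmz : m ≤ ‖z‖) (hmw : m ≤ ‖w‖) (hd : ‖w - z‖ ≤ R * m) :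
    ‖laplace b w‖ ≤ Real.exp (2 * C * R) * ‖laplace b z‖ := by
  have hR : 0 ≤ R := by
    have := (norm_nonneg _).trans hd
    exact nonneg_of_mul_nonneg_left this hm
  set γ : ℝ → ℂ := fun u => z + u * (w - z)
  have hγre : ∀ u ∈ Set.Icc (0 : ℝ) 1, 0 < (γ u).re := by
    intro u hu
    have : (γ u).re = (1 - u) * z.re + u * w.re := by simp [γ]; ring
    rw [this]
    rcases eq_or_lt_of_le hu.1 with h0 | h0
    · rw [← h0]; simpa using hz
    · have := mul_pos h0 hw
      have := mul_nonneg (sub_nonneg.mpr hu.2) hz.le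
      linarith
  -- The nonnegative inner product of `z` and `w` gives |γ|² ≥ ((1 − u)² + u²) m² ≥ m²/2, so the
  -- segment avoids a disc about the origin.
  have hγn : ∀ u ∈ Set.Icc (0 : ℝ) 1, m / 2 ≤ ‖γ u‖ := by
    intro u hu
    have e1 : ‖γ u‖ ^ 2 = (1 - u) ^ 2 * ‖z‖ ^ 2 + u ^ 2 * ‖w‖ ^ 2 +
        2 * (u * (1 - u)) * (z.re * w.re + z.im * w.im) := by
      simp only [Complex.sq_norm, Complex.normSq_apply]
      simp [γ]
      ring
    have e2 : 0 ≤ 2 * (u * (1 - u)) * (z.re * w.re + z.im * w.im) := by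
      have := mul_nonneg hu.1 (sub_nonneg.mpr hu.2)
      positivity
    have e3 : m ^ 2 ≤ ‖z‖ ^ 2 := by gcongr
    have e4 : m ^ 2 ≤ ‖w‖ ^ 2 := by gcongr
    refine le_of_sq_le_sq ?_ (norm_nonneg _)
    rw [e1]
    nlinarith [mul_le_mul_of_nonneg_left e3 (sq_nonneg (1 - u)),
      mul_le_mul_of_nonneg_left e4 (sq_nonneg u), mul_nonneg (sq_nonneg m) (sq_nonneg (1 - 2 * u)),
      sq_nonneg m]
  have hder : ∀ u ∈ Set.Icc (0 : ℝ) 1, HasDerivAt (fun u => laplace b (γ u))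
      (-laplace (fun t => t * b t) (γ u) * (w - z)) u := by
    intro u hu
    have hγ : HasDerivAt γ (w - z) u := by
      have h1 : HasDerivAt (fun u : ℝ => (u : ℂ) * (w - z)) (w - z) u := by
        simpa using (Complex.ofRealCLM.hasDerivAt (x := u)).mul_const (w - z)
      exact h1.const_add z
    exact (hasDerivAt_laplace h.expType (hγre u hu)).comp u hγ
  -- Gronwall along the segment: |b̂'| ≤ C|b̂|/|γ| with |γ| ≥ m/2 and speed at most R m give the
  -- rate 2CR.
  have key := norm_le_gronwallBound_of_norm_deriv_right_le (f := fun u => laplace b (γ u))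
    (f' := fun u => -laplace (fun t => t * b t) (γ u) * (w - z)) (δ := ‖laplace b z‖)
    (K := 2 * C * R) (ε := 0) (a := 0) (b := 1)
    (fun u hu => (hder u hu).continuousAt.continuousWithinAt)
    (fun u hu => (hder u (Set.Ico_subset_Icc_self hu)).hasDerivWithinAt) (by simp [γ]) ?_
    1 (by simp)
  · rw [gronwallBound_ε0] at key
    simpa [γ, mul_comm] using key
  · intro u hu
    have hu := Set.Ico_subset_Icc_self hu
    have a1 := hγn u hu
    have a2 := h.regular_one _ (hγre u hu)
    have a0 : 0 < ‖γ u‖ := by linarith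
    rw [norm_mul, norm_neg, add_zero]
    have a3 : ‖laplace (fun t => t * b t) (γ u)‖ ≤ C * ‖laplace b (γ u)‖ / ‖γ u‖ := by
      rw [le_div_iff₀ a0]; linarith
    have hC := h.nonneg
    calc _ ≤ C * ‖laplace b (γ u)‖ / ‖γ u‖ * (R * m) := by gcongr
      _ ≤ C * ‖laplace b (γ u)‖ / (m / 2) * (R * m) := by gcongr
      _ = _ := by field_simp

theorem exists_limit_of_dist_le {f : ℝ → ℂ} {K : ℝ}
    (hf : ∀ x ∈ Set.Ioo (0 : ℝ) 1, ∀ y ∈ Set.Ioo (0 : ℝ) 1, ‖f x - f y‖ ≤ K * |x - y|) :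
    ∃ l, Tendsto f (𝓝[>] 0) (𝓝 l) := by
  rw [← cauchy_map_iff_exists_tendsto, Metric.cauchy_iff]
  refine ⟨inferInstance, fun ε hε => ?_⟩
  have hη : 0 < min 1 (ε / (|K| + 1)) := by positivity
  refine ⟨f '' Set.Ioo 0 (min 1 (ε / (|K| + 1))), image_mem_map (Ioo_mem_nhdsGT hη), ?_⟩
  rintro _ ⟨x, hx, rfl⟩ _ ⟨y, hy, rfl⟩
  rw [dist_eq_norm]
  have hK : 0 < |K| + 1 := by positivity
  have hxy : |x - y| < ε / (|K| + 1) := by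
    have h1 := hx.2.trans_le (min_le_right _ _)
    have h2 := hy.2.trans_le (min_le_right _ _)
    rw [abs_lt]
    constructor <;> linarith [hx.1, hy.1]
  rw [lt_div_iff₀ hK] at hxy
  calc _ ≤ K * |x - y| := hf x ⟨hx.1, hx.2.trans_le (min_le_left _ _)⟩ y
        ⟨hy.1, hy.2.trans_le (min_le_left _ _)⟩
    _ ≤ (|K| + 1) * |x - y| := by
        gcongr
        linarith [le_abs_self K]
    _ < ε := by linarith

/-- The points r and ε + ik have modulus at least r/2 and distance at most 3r = 6 · r/2, whence the
6 in the exponent. -/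
theorem IsParabolicKernel.norm_laplace_vertical_le {b : ℝ → ℝ} {δ C : ℝ}
    (h : IsParabolicKernel b δ C) {r k ε : ℝ} (hr : 0 < r) (hk : r / 2 ≤ k) (hkr : k ≤ r)
    (hε : 0 < ε) (hεr : ε ≤ r) :
    ‖laplace b (ε + k * Complex.I)‖ ≤ Real.exp (2 * C * 6) * ‖laplace b r‖ := by
  refine h.norm_laplace_le (m := r / 2) (by simpa using hr) (by simpa using hε)
    (by simp; positivity) (by linarith) ?_ ?_ ?_
  · rw [Complex.norm_real, Real.norm_of_nonneg hr.le]; linarith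
  · refine le_trans ?_ (Complex.abs_im_le_norm _)
    simp only [Complex.add_im, Complex.ofReal_im, Complex.mul_I_im, Complex.ofReal_re, zero_add]
    exact hk.trans (le_abs_self k)
  · have hk0 : 0 ≤ k := by linarith
    have e1 : ‖(ε : ℂ)‖ = ε := by rw [Complex.norm_real, Real.norm_of_nonneg hε.le]
    have e2 : ‖(k * Complex.I : ℂ)‖ = k := by
      rw [norm_mul, Complex.norm_I, mul_one, Complex.norm_real, Real.norm_of_nonneg hk0]
    have e3 : ‖(r : ℂ)‖ = r := by rw [Complex.norm_real, Real.norm_of_nonneg hr.le]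
    have e4 := norm_sub_le (ε + k * Complex.I : ℂ) r
    have e5 := norm_add_le (ε : ℂ) (k * Complex.I)
    linarith

/-- The boundary function exists and is controlled by the values on the positive half-line. -/
theorem IsParabolicKernel.norm_boundaryFun_le {b : ℝ → ℝ} {δ C : ℝ}
    (h : IsParabolicKernel b δ C) {r k : ℝ} (hr : 0 < r) (hk : r / 2 ≤ k) (hkr : k ≤ r) :
    ‖boundaryFun b k‖ ≤ Real.exp (2 * C * 6) * ‖laplace b r‖ := by
  have hk0 : 0 < k := by linarith
  have hC := h.nonneg
  -- `limUnder` carries information only if the limit exists. It does: b̂' is bounded along the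
  -- approach to ik, so b̂(ε + ik) is Lipschitz in ε. Scaling ε by `min k 1` keeps it below k while
  -- the parameter runs through (0, 1).
  have hlim : ∃ l, Tendsto (fun ε : ℝ => laplace b ((ε : ℂ) + (k : ℂ) * Complex.I)) (𝓝[>] 0)
      (𝓝 l) := by
    set G : ℝ → ℂ := fun y => laplace b (((min k 1 * y : ℝ) : ℂ) + (k : ℂ) * Complex.I)
    set K := C * (Real.exp (2 * C * 6) * ‖laplace b k‖) / k
    have hc : 0 < min k 1 := lt_min hk0 one_pos
    have hG : ∃ l, Tendsto G (𝓝[>] 0) (𝓝 l) := by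
      refine exists_limit_of_dist_le (K := K * min k 1) fun x hx y hy => ?_
      have := (convex_Ioo (0 : ℝ) 1).norm_image_sub_le_of_norm_hasDerivWithin_le (f := G)
        (f' := fun y => -laplace (fun t => t * b t)
          (((min k 1 * y : ℝ) : ℂ) + (k : ℂ) * Complex.I) * ((min k 1 : ℝ) : ℂ))
        (C := K * min k 1) (fun u hu => ?_) (fun u hu => ?_) hy hx
      · simpa using this
      · have hre : 0 < (((min k 1 * u : ℝ) : ℂ) + (k : ℂ) * Complex.I).re := by
          simpa using mul_pos hc hu.1
        have hγ : HasDerivAt (fun u : ℝ => ((min k 1 * u : ℝ) : ℂ) + (k : ℂ) * Complex.I)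
            ((min k 1 : ℝ) : ℂ) u := by
          simpa using (((hasDerivAt_id u).const_mul (min k 1)).ofReal_comp).add_const
            ((k : ℂ) * Complex.I)
        exact ((hasDerivAt_laplace h.expType hre).comp u hγ).hasDerivWithinAt
      · set z := ((min k 1 * u : ℝ) : ℂ) + (k : ℂ) * Complex.I
        have hu0 : 0 < min k 1 * u := mul_pos hc hu.1
        have hre : 0 < z.re := by simpa [z] using hu0
        have hkz : k ≤ ‖z‖ := by
          refine le_trans ?_ (Complex.abs_im_le_norm z)
          simp [z, abs_of_pos hk0]
        have a1 := h.regular_one z hre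
        have a2 := h.norm_laplace_vertical_le hk0 (by linarith : k / 2 ≤ k) le_rfl hu0 (by
          have := min_le_left k 1
          nlinarith [hu.2, hu.1])
        rw [norm_mul, norm_neg, Complex.norm_real, Real.norm_of_nonneg hc.le]
        gcongr
        rw [le_div_iff₀ hk0, mul_comm]
        calc _ ≤ ‖z‖ * ‖laplace (fun t => t * b t) z‖ := by gcongr
          _ ≤ _ := a1
          _ ≤ _ := mul_le_mul_of_nonneg_left a2 hC
    obtain ⟨l, hl⟩ := hG
    refine ⟨l, (hl.comp (f := fun ε : ℝ => ε / min k 1) (x := 𝓝[>] 0) ?_).congr fun ε => ?_⟩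
    · refine tendsto_nhdsWithin_iff.mpr ⟨?_, ?_⟩
      · have : Tendsto (fun ε : ℝ => ε / min k 1) (𝓝 0) (𝓝 (0 / min k 1)) :=
          tendsto_id.div_const _
        rw [zero_div] at this
        exact this.mono_left nhdsWithin_le_nhds
      · filter_upwards [self_mem_nhdsWithin] with ε hε
        exact div_pos hε hc
    · simp only [G, Function.comp]
      rw [mul_div_cancel₀ _ hc.ne']
  have ht := tendsto_nhds_limUnder hlim
  refine le_of_tendsto ht.norm ?_
  filter_upwards [Ioo_mem_nhdsGT hr] with ε hε
  exact h.norm_laplace_vertical_le hr hk hkr hε.1 hε.2.le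

/-- The growth condition forces `|b̂(r)| ≥ c r^{1-ρ}`. -/
theorem KernelAssumption.exists_lower_bound {b : ℝ → ℝ} {ρ δ C : ℝ} (h : KernelAssumption b ρ)
    (hp : IsParabolicKernel b δ C) :
    ∃ c : ℝ, 0 < c ∧ ∀ z : ℂ, 0 < z.re → c * ‖z‖ ^ (1 - ρ) ≤ ‖laplace b z‖ := by
  obtain ⟨D, hD, hgrow⟩ := h.growth
  have hρ : 0 < ρ := by linarith [h.one_lt]
  set E := Real.exp (2 * C * 6)
  have hE : 0 < E := Real.exp_pos _
  have hreal : ∀ r : ℝ, 0 < r → r ^ (1 - ρ) ≤ (8 * D) ^ ρ * (E * ‖laplace b r‖) := by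
    intro r hr
    have hf : 0 < ‖laplace b r‖ := norm_pos_iff.mpr (h.sectorial.1 r (by simpa using hr))
    set G := E * ‖laplace b r‖
    have hG : 0 < G := mul_pos hE hf
    -- This choice balances the denominator: μ G = r, and `G` bounds |g| on (r/2, r], so |k| +
    -- μ|g(k)| ≤ 2r there.
    set μ := r / G
    have hμ : 0 < μ := div_pos hr hG
    have h1 := (hgrow μ hμ).2
    have h2 : ENNReal.ofReal ((1 / μ) / (r + μ * G) ^ 2 * (r / 2)) ≤
        ENNReal.ofReal (D / μ ^ (1 + 1 / ρ)) := by
      refine le_trans ?_ h1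
      -- The growth integral is bounded below by its 1/μ term on (r/2, r].
      calc _ = ∫⁻ _ in Set.Ioc (r / 2) r, ENNReal.ofReal ((1 / μ) / (r + μ * G) ^ 2) := by
            rw [setLIntegral_const, Real.volume_Ioc, ← ENNReal.ofReal_mul (by positivity)]
            congr 2
            ring
        _ ≤ _ := by
            refine le_trans (setLIntegral_mono' measurableSet_Ioc fun k hk => ?_)
              (lintegral_mono_set (fun k hk => ?_ : Set.Ioc (r / 2) r ⊆ Set.Ioi 0))
            · have hk0 : 0 < k := by linarith [hk.1]
              have hb := hp.norm_boundaryFun_le hr hk.1.le hk.2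
              refine ENNReal.ofReal_le_ofReal ?_
              rw [abs_of_pos hk0]
              gcongr
              · have : 0 ≤ k ^ 2 * ‖iteratedDeriv 3 (boundaryFun b) k‖ +
                  k * ‖iteratedDeriv 2 (boundaryFun b) k‖ + ‖deriv (boundaryFun b) k‖ := by
                  positivity
                linarith
              · exact hk.2
            · have : 0 < k := by linarith [hk.1]
              exact this
    rw [ENNReal.ofReal_le_ofReal_iff (by positivity)] at h2
    have h3 : μ * G = r := div_mul_cancel₀ r hG.ne'
    rw [h3, Real.rpow_add hμ, Real.rpow_one, le_div_iff₀ (by positivity)] at h2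
    have h4 : (1 / μ) / (r + r) ^ 2 * (r / 2) * (μ * μ ^ (1 / ρ)) = μ ^ (1 / ρ) / (8 * r) := by
      field_simp
      norm_num
    rw [h4, div_le_iff₀ (by positivity)] at h2
    -- Since μ = r/G, this inequality is the lower bound r^{1−ρ} ≤ (8D)^ρ G.
    have h5 : μ ≤ (8 * D * r) ^ ρ := by
      have := Real.rpow_le_rpow (by positivity) h2 hρ.le
      rw [← Real.rpow_mul hμ.le, one_div, inv_mul_cancel₀ hρ.ne', Real.rpow_one] at this
      refine this.trans (le_of_eq ?_)
      congr 1
      ring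
    rw [Real.mul_rpow (by positivity) hr.le, div_le_iff₀ hG] at h5
    rw [Real.rpow_sub hr, Real.rpow_one, div_le_iff₀ (Real.rpow_pos_of_pos hr _)]
    linarith
  refine ⟨((8 * D) ^ ρ * E * Real.exp (2 * C * 2))⁻¹, by positivity, fun z hz => ?_⟩
  have hz0 := norm_pos_of_re_pos hz
  have h1 := hreal ‖z‖ hz0
  -- The passage from the real point |z| to z: both have modulus |z|, their distance is at most
  -- 2|z|, and they enclose at most a right angle.
  have h2 := hp.norm_laplace_le (z := z) (w := (‖z‖ : ℂ)) (m := ‖z‖) (R := 2) hz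
    (by simpa using hz0) (by simp; positivity) hz0 le_rfl (by simp) (by
      refine (norm_sub_le _ _).trans ?_
      simp
      linarith)
  rw [inv_mul_le_iff₀ (by positivity)]
  calc _ ≤ _ := h1
    _ ≤ (8 * D) ^ ρ * (E * (Real.exp (2 * C * 2) * ‖laplace b z‖)) := by gcongr
    _ = _ := by ring

/-! ### Oscillatory integrals of monotone functions -/

theorem hasDerivAt_cexp_neg_mul (z : ℂ) (t : ℝ) :
    HasDerivAt (fun t : ℝ => Complex.exp (-(z * t))) (-(z * Complex.exp (-(z * t)))) t := by
  have := (((Complex.ofRealCLM.hasDerivAt (x := t)).const_mul z).neg).cexp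
  refine (by simpa using this : HasDerivAt (fun t : ℝ => Complex.exp (-(z * t))) _ t).congr_deriv ?_
  ring

/-- One integration by parts gains the factor |z|. The remaining integral is at most ∫(φ'm − φm') =
2∫φ'm − [φm], and the value −φ(R)m(R) in it absorbs the boundary term at R, so the bound does not
involve R outside the integral. -/
theorem norm_integral_exp_mul_le_of_deriv {z : ℂ} (hz : 0 < z.re) {T R : ℝ} (hT : 0 ≤ T)
    (hTR : T ≤ R) {φ φ' m m' : ℝ → ℝ} (hφ : ∀ t ∈ Set.Icc T R, 0 ≤ φ t)
    (hφ' : ∀ t ∈ Set.Icc T R, 0 ≤ φ' t) (hm : ∀ t ∈ Set.Icc T R, 0 ≤ m t)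
    (hm' : ∀ t ∈ Set.Icc T R, m' t ≤ 0)
    (dφ : ∀ t, HasDerivAt φ (φ' t) t) (dm : ∀ t, HasDerivAt m (m' t) t) (cφ' : Continuous φ')
    (cm' : Continuous m') :
    ‖z‖ * ‖∫ t in T..R, Complex.exp (-(z * t)) * ((φ t * m t : ℝ) : ℂ)‖ ≤
      2 * (φ T * m T) + 2 * ∫ t in T..R, φ' t * m t := by
  have cφ : Continuous φ := continuous_iff_continuousAt.mpr fun t => (dφ t).continuousAt
  have cm : Continuous m := continuous_iff_continuousAt.mpr fun t => (dm t).continuousAt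
  have hR : R ∈ Set.Icc T R := ⟨hTR, le_rfl⟩
  have hT' : T ∈ Set.Icc T R := ⟨le_rfl, hTR⟩
  have dp : ∀ t, HasDerivAt (fun t => φ t * m t) (φ' t * m t + φ t * m' t) t :=
    fun t => (dφ t).mul (dm t)
  have ftc1 : ∫ t in T..R, (φ' t * m t + φ t * m' t) = φ R * m R - φ T * m T :=
    intervalIntegral.integral_eq_sub_of_hasDerivAt (fun t _ => dp t)
      ((by fun_prop : Continuous fun t => φ' t * m t + φ t * m' t).intervalIntegrable _ _)
  have dG : ∀ t : ℝ, HasDerivAt (fun t : ℝ => Complex.exp (-(z * t)) * ((φ t * m t : ℝ) : ℂ))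
      (-(z * Complex.exp (-(z * t))) * ((φ t * m t : ℝ) : ℂ) +
        Complex.exp (-(z * t)) * ((φ' t * m t + φ t * m' t : ℝ) : ℂ)) t :=
    fun t => (hasDerivAt_cexp_neg_mul z t).mul (dp t).ofReal_comp
  have c1 : Continuous fun t : ℝ => Complex.exp (-(z * t)) * ((φ t * m t : ℝ) : ℂ) :=
    Continuous.mul (by fun_prop) (Complex.continuous_ofReal.comp (cφ.mul cm))
  have c2 : Continuous fun t : ℝ =>
      Complex.exp (-(z * t)) * ((φ' t * m t + φ t * m' t : ℝ) : ℂ) :=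
    Continuous.mul (by fun_prop) (Complex.continuous_ofReal.comp
      ((cφ'.mul cm).add (cφ.mul cm')))
  have ftc2 := intervalIntegral.integral_eq_sub_of_hasDerivAt (a := T) (b := R)
    (fun t _ => dG t) ((((c1.const_smul (-z)).add c2).congr fun t => by
      show -z * _ + _ = _; ring).intervalIntegrable _ _)
  have e1 : z * ∫ t in T..R, Complex.exp (-(z * t)) * ((φ t * m t : ℝ) : ℂ) =
      (∫ t in T..R, Complex.exp (-(z * t)) * ((φ' t * m t + φ t * m' t : ℝ) : ℂ)) -
      (Complex.exp (-(z * R)) * ((φ R * m R : ℝ) : ℂ) -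
        Complex.exp (-(z * T)) * ((φ T * m T : ℝ) : ℂ)) := by
    rw [← ftc2, ← intervalIntegral.integral_const_mul,
      ← intervalIntegral.integral_sub (c2.intervalIntegrable _ _)]
    · congr 1
      ext t
      ring
    · exact (((c1.const_smul (-z)).add c2).congr fun t => by
        show -z * _ + _ = _; ring).intervalIntegrable _ _
  have hexp : ∀ t ∈ Set.Icc T R, ‖Complex.exp (-(z * t))‖ ≤ 1 := by
    intro t ht
    rw [norm_cexp_neg_mul, Real.exp_le_one_iff]
    have := mul_nonneg hz.le (hT.trans ht.1)
    linarith
  have b1 : ‖∫ t in T..R, Complex.exp (-(z * t)) * ((φ' t * m t + φ t * m' t : ℝ) : ℂ)‖ ≤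
      ∫ t in T..R, (φ' t * m t - φ t * m' t) := by
    refine intervalIntegral.norm_integral_le_of_norm_le hTR (ae_of_all _ fun t ht => ?_)
      ((by fun_prop : Continuous fun t => φ' t * m t - φ t * m' t).intervalIntegrable _ _)
    have ht' := Set.Ioc_subset_Icc_self ht
    rw [norm_mul, Complex.norm_real, Real.norm_eq_abs]
    have h1 := mul_nonneg (hφ' t ht') (hm t ht')
    have h2 := mul_nonneg (hφ t ht') (neg_nonneg.mpr (hm' t ht'))
    calc _ ≤ 1 * |φ' t * m t + φ t * m' t| := by gcongr; exact hexp t ht'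
      _ ≤ _ := by
        rw [one_mul, abs_le]
        constructor <;> nlinarith
  have e2 : ∫ t in T..R, (φ' t * m t - φ t * m' t) =
      2 * (∫ t in T..R, φ' t * m t) - (φ R * m R - φ T * m T) := by
    rw [← ftc1, ← intervalIntegral.integral_const_mul, ← intervalIntegral.integral_sub]
    · congr 1
      ext t
      ring
    · exact (by fun_prop : Continuous fun t => 2 * (φ' t * m t)).intervalIntegrable _ _
    · exact (by fun_prop : Continuous fun t => φ' t * m t + φ t * m' t).intervalIntegrable _ _
  have nb : ∀ t ∈ Set.Icc T R, ‖Complex.exp (-(z * t)) * ((φ t * m t : ℝ) : ℂ)‖ ≤ φ t * m t := by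
    intro t ht
    have := mul_nonneg (hφ t ht) (hm t ht)
    rw [norm_mul, Complex.norm_real, Real.norm_of_nonneg this]
    exact mul_le_of_le_one_left this (hexp t ht)
  rw [← norm_mul, e1]
  refine (norm_sub_le _ _).trans ?_
  have := norm_sub_le (Complex.exp (-(z * R)) * ((φ R * m R : ℝ) : ℂ))
    (Complex.exp (-(z * T)) * ((φ T * m T : ℝ) : ℂ))
  have := nb R hR
  have := nb T hT'
  linarith

/-- The estimate for antitone `m` without differentiability, by averaging. -/
theorem norm_integral_exp_mul_le_of_antitone {z : ℂ} (hz : 0 < z.re) {T R : ℝ} (hT : 0 ≤ T)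
    (hTR : T ≤ R) {φ φ' m : ℝ → ℝ} (hφ : ∀ t ∈ Set.Icc T R, 0 ≤ φ t)
    (hφ' : ∀ t ∈ Set.Icc T R, 0 ≤ φ' t) (hm : ∀ t, 0 ≤ m t) (am : Antitone m)
    (dφ : ∀ t, HasDerivAt φ (φ' t) t) (cφ' : Continuous φ') (cm : Continuous m) :
    ‖z‖ * ‖∫ t in T..R, Complex.exp (-(z * t)) * ((φ t * m t : ℝ) : ℂ)‖ ≤
      2 * (φ T * m T) + 2 * ∫ t in T..R, φ' t * m t := by
  have cφ : Continuous φ := continuous_iff_continuousAt.mpr fun t => (dφ t).continuousAt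
  have im : ∀ x y : ℝ, IntervalIntegrable m volume x y := fun x y => cm.intervalIntegrable _ _
  set F : ℝ → ℝ := fun t => ∫ r in (0 : ℝ)..t, m r
  have dF : ∀ t, HasDerivAt F (m t) t := fun t =>
    intervalIntegral.integral_hasDerivAt_right (im _ _)
      cm.stronglyMeasurable.stronglyMeasurableAtFilter cm.continuousAt
  have cF : Continuous F := continuous_iff_continuousAt.mpr fun t => (dF t).continuousAt
  -- Forward averages of `m` are continuously differentiable, nonincreasing and, because `m`
  -- decreases, at most `m`; they tend to `m` as h → 0+.
  set M : ℝ → ℝ → ℝ := fun h t => h⁻¹ * (F (t + h) - F t)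
  have cM : ∀ h, Continuous (M h) := fun h => by fun_prop
  have hM : ∀ h, 0 < h → ∀ t, 0 ≤ M h t ∧ M h t ≤ m t := by
    intro h hh t
    have e : F (t + h) - F t = ∫ r in t..(t + h), m r :=
      intervalIntegral.integral_interval_sub_left (im _ _) (im _ _)
    have b1 : ∫ r in t..(t + h), m r ≤ h * m t := by
      have := intervalIntegral.integral_mono_on (by linarith : t ≤ t + h) (im _ _)
        (intervalIntegrable_const (c := m t)) (fun r hr => am hr.1)
      simpa using this
    have b0 : 0 ≤ ∫ r in t..(t + h), m r :=
      intervalIntegral.integral_nonneg (by linarith) fun r _ => hm r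
    simp only [M, e]
    refine ⟨by positivity, ?_⟩
    rwa [inv_mul_le_iff₀ hh]
  have dM : ∀ h t, HasDerivAt (M h) (h⁻¹ * (m (t + h) - m t)) t := fun h t =>
    (((dF (t + h)).comp_add_const t h).sub (dF t)).const_mul _
  have key : ∀ h, 0 < h → ‖z‖ * ‖∫ t in T..R, Complex.exp (-(z * t)) * ((φ t * M h t : ℝ) : ℂ)‖ ≤
      2 * (φ T * m T) + 2 * ∫ t in T..R, φ' t * m t := by
    intro h hh
    refine (norm_integral_exp_mul_le_of_deriv hz hT hTR hφ hφ' (fun t _ => (hM h hh t).1)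
      (fun t _ => ?_) dφ (dM h) cφ' (by fun_prop)).trans ?_
    · have := am (by linarith : t ≤ t + h)
      exact mul_nonpos_of_nonneg_of_nonpos (by positivity) (by linarith)
    · have h1 := mul_le_mul_of_nonneg_left (hM h hh T).2 (hφ T ⟨le_rfl, hTR⟩)
      have := cM h
      have h2 : ∫ t in T..R, φ' t * M h t ≤ ∫ t in T..R, φ' t * m t :=
        intervalIntegral.integral_mono_on hTR
          ((by fun_prop : Continuous fun t => φ' t * M h t).intervalIntegrable _ _)
          ((by fun_prop : Continuous fun t => φ' t * m t).intervalIntegrable _ _)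
          fun t ht => mul_le_mul_of_nonneg_left (hM h hh t).2 (hφ' t ht)
      linarith
  have lim : Tendsto (fun h => ∫ t in T..R, Complex.exp (-(z * t)) * ((φ t * M h t : ℝ) : ℂ))
      (𝓝[>] 0) (𝓝 (∫ t in T..R, Complex.exp (-(z * t)) * ((φ t * m t : ℝ) : ℂ))) := by
    refine intervalIntegral.tendsto_integral_filter_of_dominated_convergence
      (fun t => ‖Complex.exp (-(z * t))‖ * (|φ t| * m t)) ?_ ?_ ?_ ?_
    · refine Eventually.of_forall fun h => Continuous.aestronglyMeasurable ?_
      exact Continuous.mul (by fun_prop) (Complex.continuous_ofReal.comp (cφ.mul (cM h)))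
    · filter_upwards [self_mem_nhdsWithin] with h hh
      refine ae_of_all _ fun t _ => ?_
      rw [norm_mul, Complex.norm_real, norm_mul, Real.norm_of_nonneg (hM h hh t).1,
        Real.norm_eq_abs]
      gcongr
      exact (hM h hh t).2
    · exact (by fun_prop : Continuous fun t : ℝ =>
        ‖Complex.exp (-(z * t))‖ * (|φ t| * m t)).intervalIntegrable _ _
    · refine ae_of_all _ fun t _ => ?_
      have h1 := (hasDerivAt_iff_tendsto_slope_zero.mp (dF t)).mono_left
        (nhdsWithin_mono (0 : ℝ) (fun x hx => ne_of_gt hx : Set.Ioi (0 : ℝ) ⊆ {0}ᶜ))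
      exact ((Complex.continuous_ofReal.tendsto _).comp (h1.const_mul (φ t))).const_mul _
  refine le_of_tendsto (lim.norm.const_mul ‖z‖) ?_
  filter_upwards [self_mem_nhdsWithin] with h hh
  exact key h hh

/-- The Laplace transform of `φ m` with `φ` increasing and `m` decreasing, split at `1 / |z|`. -/
theorem norm_laplace_mul_le {φ φ' m : ℝ → ℝ} (hφ : ∀ t, 0 ≤ t → 0 ≤ φ t)
    (hφ' : ∀ t, 0 ≤ t → 0 ≤ φ' t) (dφ : ∀ t, HasDerivAt φ (φ' t) t) (cφ' : Continuous φ')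
    (hm : ∀ t, 0 < t → 0 ≤ m t) (am : AntitoneOn m (Set.Ioi 0)) (cm : ContinuousOn m (Set.Ioi 0))
    (he : ExpType 0 fun t => φ t * m t) {z : ℂ} (hz : 0 < z.re) {X W : ℝ}
    (hX : ∫ t in (0 : ℝ)..‖z‖⁻¹, φ t * m t ≤ X)
    (hW : ∀ R, ‖z‖⁻¹ ≤ R → ∫ t in ‖z‖⁻¹..R, φ' t * m t ≤ W) :
    ‖laplace (fun t => φ t * m t) z‖ ≤ X + ‖z‖⁻¹ * (2 * (φ ‖z‖⁻¹ * m ‖z‖⁻¹) + 2 * W) := by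
  have hz0 := norm_pos_of_re_pos hz
  set T := ‖z‖⁻¹
  have hT : 0 < T := inv_pos.mpr hz0
  have hi := he.integrable hz
  have hmax : ∀ t, max t T ∈ Set.Ioi (0 : ℝ) := fun t => lt_of_lt_of_le hT (le_max_right _ _)
  have lim := intervalIntegral_tendsto_integral_Ioi 0 hi tendsto_id
  refine le_of_tendsto lim.norm ?_
  filter_upwards [eventually_ge_atTop T] with R hR
  have hii : ∀ x y : ℝ, 0 ≤ x → 0 ≤ y → IntervalIntegrable
      (fun t : ℝ => Complex.exp (-(z * t)) * ((φ t * m t : ℝ) : ℂ)) volume x y := by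
    intro x y hx hy
    rw [intervalIntegrable_iff]
    refine hi.mono_set fun t ht => ?_
    exact (le_min hx hy).trans_lt ht.1
  simp only [id]
  rw [← intervalIntegral.integral_add_adjacent_intervals (hii 0 T le_rfl hT.le)
    (hii T R hT.le (hT.le.trans hR))]
  refine (norm_add_le _ _).trans (add_le_add (le_trans ?_ hX) ?_)
  · refine intervalIntegral.norm_integral_le_of_norm_le hT.le (ae_of_all _ fun t ht => ?_)
      (he.intervalIntegrable le_rfl hT.le)
    have h0 := mul_nonneg (hφ t ht.1.le) (hm t ht.1)
    rw [norm_mul, Complex.norm_real, Real.norm_of_nonneg h0, norm_cexp_neg_mul]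
    refine mul_le_of_le_one_left h0 ?_
    rw [Real.exp_le_one_iff]
    have := mul_nonneg hz.le ht.1.le
    linarith
  -- Freezing `m` to the left of T gives a function continuous and nonincreasing on the whole line,
  -- without changing it on [T, R].
  · have key := norm_integral_exp_mul_le_of_antitone (m := fun t => m (max t T)) hz hT.le hR
      (fun t ht => hφ t (hT.le.trans ht.1)) (fun t ht => hφ' t (hT.le.trans ht.1))
      (fun t => hm _ (hmax t)) (fun x y hxy => am (hmax x) (hmax y) (max_le_max_right T hxy)) dφ cφ'
      (cm.comp_continuous (by fun_prop) hmax)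
    have e1 : ∫ t in T..R, Complex.exp (-(z * t)) * ((φ t * m (max t T) : ℝ) : ℂ) =
        ∫ t in T..R, Complex.exp (-(z * t)) * ((φ t * m t : ℝ) : ℂ) := by
      refine intervalIntegral.integral_congr fun t ht => ?_
      rw [Set.uIcc_of_le hR] at ht
      simp only [max_eq_left ht.1]
    have e2 : ∫ t in T..R, φ' t * m (max t T) = ∫ t in T..R, φ' t * m t := by
      refine intervalIntegral.integral_congr fun t ht => ?_
      rw [Set.uIcc_of_le hR] at ht
      simp only [max_eq_left ht.1]
    simp only [e1, e2, max_self] at key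
    rw [← le_div_iff₀' hz0] at key
    refine key.trans ?_
    rw [div_eq_inv_mul]
    gcongr
    exact hW R hR

/-! ### Monotone kernels: upper bounds -/

/-- A nonnegative locally integrable kernel with derivatives `-b₁` and `b₂`, where `b₁, b₂` are
nonnegative and `b₂` is nonincreasing. -/
structure IsThreeMonotone (b b₁ b₂ : ℝ → ℝ) : Prop where
  integrable : ∀ T : ℝ, IntegrableOn b (Set.Ioc 0 T)
  nonneg : ∀ t, 0 < t → 0 ≤ b t
  nonneg₁ : ∀ t, 0 < t → 0 ≤ b₁ t
  nonneg₂ : ∀ t, 0 < t → 0 ≤ b₂ t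
  deriv : ∀ t, 0 < t → HasDerivAt b (-b₁ t) t
  deriv₁ : ∀ t, 0 < t → HasDerivAt b₁ (-b₂ t) t
  cont₂ : ContinuousOn b₂ (Set.Ioi 0)
  anti₂ : AntitoneOn b₂ (Set.Ioi 0)

theorem antitoneOn_of_hasDerivAt_neg {f f₁ : ℝ → ℝ} (hd : ∀ t, 0 < t → HasDerivAt f (-f₁ t) t)
    (h1 : ∀ t, 0 < t → 0 ≤ f₁ t) : AntitoneOn f (Set.Ioi 0) := by
  refine antitoneOn_of_deriv_nonpos (convex_Ioi 0)
    (fun t ht => (hd t ht).continuousAt.continuousWithinAt) ?_ ?_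
  · intro t ht
    rw [interior_Ioi] at ht
    exact (hd t ht).differentiableAt.differentiableWithinAt
  · intro t ht
    rw [interior_Ioi] at ht
    rw [(hd t ht).deriv]
    have := h1 t ht
    linarith

/-- The mean value theorem on [t/2, t]: f(t/2) ≥ f(t/2) − f(t) = (t/2) f₁(c) ≥ (t/2) f₁(t). -/
theorem id_mul_deriv_le {f f₁ : ℝ → ℝ} (hd : ∀ t, 0 < t → HasDerivAt f (-f₁ t) t)
    (h0 : ∀ t, 0 < t → 0 ≤ f t) (ha : AntitoneOn f₁ (Set.Ioi 0)) {t : ℝ} (ht : 0 < t) :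
    t * f₁ t ≤ 2 * f (t / 2) := by
  obtain ⟨c, hc, he⟩ := exists_hasDerivAt_eq_slope f (fun x => -f₁ x) (by linarith : t / 2 < t)
    (fun x hx => (hd x (by linarith [hx.1])).continuousAt.continuousWithinAt)
    (fun x hx => hd x (by linarith [hx.1]))
  have hc0 : 0 < c := by linarith [hc.1]
  have h1 := ha hc0 ht hc.2.le
  have h2 := h0 t ht
  rw [eq_div_iff (by linarith)] at he
  nlinarith

namespace IsThreeMonotone

variable {b b₁ b₂ : ℝ → ℝ}

theorem anti (h : IsThreeMonotone b b₁ b₂) : AntitoneOn b (Set.Ioi 0) :=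
  antitoneOn_of_hasDerivAt_neg h.deriv h.nonneg₁

theorem anti₁ (h : IsThreeMonotone b b₁ b₂) : AntitoneOn b₁ (Set.Ioi 0) :=
  antitoneOn_of_hasDerivAt_neg h.deriv₁ h.nonneg₂

theorem cont (h : IsThreeMonotone b b₁ b₂) : ContinuousOn b (Set.Ioi 0) :=
  fun t ht => (h.deriv t ht).continuousAt.continuousWithinAt

theorem cont₁ (h : IsThreeMonotone b b₁ b₂) : ContinuousOn b₁ (Set.Ioi 0) :=
  fun t ht => (h.deriv₁ t ht).continuousAt.continuousWithinAt

theorem id_mul_le (h : IsThreeMonotone b b₁ b₂) {t : ℝ} (ht : 0 < t) :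
    t * b₁ t ≤ 2 * b (t / 2) := id_mul_deriv_le h.deriv h.nonneg h.anti₁ ht

theorem id_mul_le₁ (h : IsThreeMonotone b b₁ b₂) {t : ℝ} (ht : 0 < t) :
    t * b₂ t ≤ 2 * b₁ (t / 2) := id_mul_deriv_le h.deriv₁ h.nonneg₁ h.anti₂ ht

theorem sq_mul_le (h : IsThreeMonotone b b₁ b₂) {t : ℝ} (ht : 0 < t) :
    t * (t * b₂ t) ≤ 8 * b (t / 4) := by
  have h1 := mul_le_mul_of_nonneg_left (h.id_mul_le₁ ht) ht.le
  have h2 := h.id_mul_le (half_pos ht)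
  have e : t / 2 / 2 = t / 4 := by ring
  rw [e] at h2
  linarith

theorem expType (h : IsThreeMonotone b b₁ b₂) : ExpType 0 b := by
  intro σ hσ
  rw [← Set.Ioc_union_Ioi_eq_Ioi (zero_le_one (α := ℝ))]
  refine IntegrableOn.union ?_ ?_
  · refine (h.integrable 1).continuousOn_mul_of_subset (K := Set.Icc 0 1)
      (by fun_prop : Continuous fun t => Real.exp (-(σ * t))).continuousOn
      isCompact_Icc measurableSet_Ioc Set.Ioc_subset_Icc_self
  · have h1 := (integrableOn_exp_mul_Ioi (a := -σ) (by linarith) 1).mul_const (b 1)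
    refine Integrable.mono' h1 ?_ ?_
    · refine ContinuousOn.aestronglyMeasurable ?_ measurableSet_Ioi
      exact ContinuousOn.mul (by fun_prop) (h.cont.mono (Set.Ioi_subset_Ioi zero_le_one))
    · filter_upwards [ae_restrict_mem measurableSet_Ioi] with t ht
      have ht : 1 < t := ht
      have ht0 : 0 < t := by linarith
      rw [norm_mul, Real.norm_of_nonneg (h.nonneg t ht0), Real.norm_of_nonneg (Real.exp_pos _).le,
        neg_mul]
      gcongr
      exact h.anti (Set.mem_Ioi.mpr one_pos) ht0 ht.le

theorem expType_comp_div (hb : ExpType 0 b) {a : ℝ} (ha : 0 < a) : ExpType 0 fun t => b (t / a) := by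
  intro σ hσ
  have h1 := hb (σ * a) (by positivity)
  have := (integrableOn_Ioi_comp_mul_left_iff (fun t => Real.exp (-(σ * a * t)) * b t) 0
    (inv_pos.mpr ha)).mpr (by simpa using h1)
  refine this.congr (ae_of_all _ fun t => ?_)
  simp only
  have e1 : σ * a * (a⁻¹ * t) = σ * t := by field_simp
  have e2 : a⁻¹ * t = t / a := by ring
  rw [e1, e2]

theorem expType₁ (h : IsThreeMonotone b b₁ b₂) : ExpType 0 fun t => t * b₁ t := by
  refine ((expType_comp_div h.expType two_pos).const_mul 2).mono_fun ?_ fun t ht => ?_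
  · exact (continuousOn_id.mul h.cont₁).aestronglyMeasurable measurableSet_Ioi
  · rw [abs_of_nonneg (mul_nonneg ht.le (h.nonneg₁ t ht))]
    exact h.id_mul_le ht

theorem expType₂ (h : IsThreeMonotone b b₁ b₂) : ExpType 0 fun t => t * (t * b₂ t) := by
  refine ((expType_comp_div h.expType four_pos).const_mul 8).mono_fun ?_ fun t ht => ?_
  · exact (continuousOn_id.mul (continuousOn_id.mul h.cont₂)).aestronglyMeasurable
      measurableSet_Ioi
  · rw [abs_of_nonneg (mul_nonneg ht.le (mul_nonneg ht.le (h.nonneg₂ t ht)))]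
    exact h.sq_mul_le ht

theorem integral_mono_right (h : IsThreeMonotone b b₁ b₂) {x y : ℝ} (hx : 0 ≤ x) (hxy : x ≤ y) :
    ∫ t in (0 : ℝ)..x, b t ≤ ∫ t in (0 : ℝ)..y, b t := by
  rw [intervalIntegral.integral_of_le hx, intervalIntegral.integral_of_le (hx.trans hxy)]
  refine setIntegral_mono_set (h.integrable y) ?_ (Set.Ioc_subset_Ioc_right hxy).eventuallyLE
  filter_upwards [ae_restrict_mem measurableSet_Ioc] with t ht
  exact h.nonneg t ht.1

theorem mul_le_integral (h : IsThreeMonotone b b₁ b₂) {t : ℝ} (ht : 0 < t) :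
    t * b t ≤ ∫ r in (0 : ℝ)..t, b r := by
  have := intervalIntegral.integral_mono_on_of_le_Ioo ht.le (intervalIntegrable_const (c := b t))
    (h.expType.intervalIntegrable le_rfl ht.le) (fun r hr => h.anti hr.1 ht hr.2.le)
  simpa using this

theorem mul_div_le_integral (h : IsThreeMonotone b b₁ b₂) {t a : ℝ} (ht : 0 < t) (ha : 1 ≤ a) :
    t * b (t / a) ≤ a * ∫ r in (0 : ℝ)..t, b r := by
  have ha0 : 0 < a := by linarith
  have h1 := h.mul_le_integral (div_pos ht ha0)
  have h2 := h.integral_mono_right (div_pos ht ha0).le (div_le_self ht.le ha)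
  have h3 : t * b (t / a) = a * (t / a * b (t / a)) := by field_simp
  rw [h3]
  gcongr
  linarith

theorem integral_comp_div_le (h : IsThreeMonotone b b₁ b₂) {t a : ℝ} (ht : 0 < t) (ha : 1 ≤ a) :
    ∫ r in (0 : ℝ)..t, b (r / a) ≤ a * ∫ r in (0 : ℝ)..t, b r := by
  have ha0 : 0 < a := by linarith
  rw [intervalIntegral.integral_comp_div _ ha0.ne', smul_eq_mul, zero_div]
  gcongr
  exact h.integral_mono_right (div_pos ht ha0).le (div_le_self ht.le ha)

theorem integral_Ioc_eq (h : IsThreeMonotone b b₁ b₂) {x y : ℝ} (hx : 0 < x) (hxy : x ≤ y) :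
    ∫ t in x..y, b₁ t = b x - b y := by
  have := intervalIntegral.integral_eq_sub_of_hasDerivAt (a := x) (b := y) (f := fun t => -b t)
    (f' := b₁) (fun t ht => by
      rw [Set.uIcc_of_le hxy] at ht
      exact (h.deriv t (hx.trans_le ht.1)).neg.congr_deriv (neg_neg _)) ?_
  · rw [this]; ring
  · refine ContinuousOn.intervalIntegrable (h.cont₁.mono fun t ht => ?_)
    rw [Set.uIcc_of_le hxy] at ht
    exact hx.trans_le ht.1

/-- The split at T = 1/|z| with φ = 1: the tail costs 2T b(T), at most twice ∫₀ᵀ b. The next two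
bounds use the same split with φ = t, m = b₁ and φ = t², m = b₂. -/
theorem norm_laplace_le (h : IsThreeMonotone b b₁ b₂) {z : ℂ} (hz : 0 < z.re) :
    ‖laplace b z‖ ≤ 3 * ∫ t in (0 : ℝ)..‖z‖⁻¹, b t := by
  have hT : 0 < ‖z‖⁻¹ := inv_pos.mpr (norm_pos_of_re_pos hz)
  have := norm_laplace_mul_le (φ := fun _ => 1) (φ' := fun _ => 0) (m := b)
    (X := ∫ t in (0 : ℝ)..‖z‖⁻¹, b t) (W := 0) (fun _ _ => zero_le_one)
    (fun _ _ => le_rfl) (fun t => hasDerivAt_const t 1) continuous_const h.nonneg h.anti h.cont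
    (by simpa using h.expType) hz (by simp) (by simp)
  simp only [one_mul] at this
  have h1 := h.mul_le_integral hT
  change ‖laplace b z‖ ≤ _ at this
  linarith

theorem norm_laplace_le₁ (h : IsThreeMonotone b b₁ b₂) {z : ℂ} (hz : 0 < z.re) :
    ‖laplace (fun t => t * b₁ t) z‖ ≤ 14 * ∫ t in (0 : ℝ)..‖z‖⁻¹, b t := by
  have hT : 0 < ‖z‖⁻¹ := inv_pos.mpr (norm_pos_of_re_pos hz)
  set T := ‖z‖⁻¹
  have hb2 := expType_comp_div h.expType (two_pos (α := ℝ))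
  have := norm_laplace_mul_le (φ := fun t => t) (φ' := fun _ => 1) (m := b₁)
    (X := 4 * ∫ t in (0 : ℝ)..T, b t) (W := b T) (fun _ ht => ht)
    (fun _ _ => zero_le_one) (fun t => hasDerivAt_id t) continuous_const h.nonneg₁ h.anti₁ h.cont₁
    h.expType₁ hz ?_ ?_
  · refine this.trans ?_
    have h1 := h.mul_le_integral hT
    have h2 := h.mul_div_le_integral hT one_le_two
    have h3 := mul_le_mul_of_nonneg_left (h.id_mul_le hT) hT.le
    linarith
  · have h1 := intervalIntegral.integral_mono_on_of_le_Ioo hT.le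
      (h.expType₁.intervalIntegrable le_rfl hT.le)
      ((hb2.const_mul 2).intervalIntegrable le_rfl hT.le) (fun r hr => h.id_mul_le hr.1)
    rw [intervalIntegral.integral_const_mul] at h1
    have h2 := h.integral_comp_div_le hT one_le_two
    linarith
  · intro R hR
    simp only [one_mul]
    rw [h.integral_Ioc_eq hT hR]
    have := h.nonneg R (hT.trans_le hR)
    linarith

theorem norm_laplace_le₂ (h : IsThreeMonotone b b₁ b₂) {z : ℂ} (hz : 0 < z.re) :
    ‖laplace (fun t => t * (t * b₂ t)) z‖ ≤ 128 * ∫ t in (0 : ℝ)..‖z‖⁻¹, b t := by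
  have hT : 0 < ‖z‖⁻¹ := inv_pos.mpr (norm_pos_of_re_pos hz)
  set T := ‖z‖⁻¹
  have hb4 := expType_comp_div h.expType (four_pos (α := ℝ))
  have he2 : ExpType 0 fun t => t * t * b₂ t := by
    simpa only [mul_assoc] using h.expType₂
  have := norm_laplace_mul_le (φ := fun t => t * t) (φ' := fun t => 2 * t) (m := b₂)
    (X := 32 * ∫ t in (0 : ℝ)..T, b t) (W := 8 * b (T / 2)) (fun _ ht => mul_nonneg ht ht)
    (fun _ ht => by positivity) (fun t => ((hasDerivAt_id t).mul (hasDerivAt_id t)).congr_deriv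
      (by simp; ring)) (by fun_prop) h.nonneg₂ h.anti₂ h.cont₂
    he2 hz ?_ ?_
  · simp only [mul_assoc] at this
    refine this.trans ?_
    have h2 := h.mul_div_le_integral hT one_le_two
    have h4 := h.mul_div_le_integral hT (by norm_num : (1 : ℝ) ≤ 4)
    have h3 := mul_le_mul_of_nonneg_left (h.sq_mul_le hT) hT.le
    linarith
  · simp only [mul_assoc]
    have h1 := intervalIntegral.integral_mono_on_of_le_Ioo hT.le
      (h.expType₂.intervalIntegrable le_rfl hT.le)
      ((hb4.const_mul 8).intervalIntegrable le_rfl hT.le) (fun r hr => h.sq_mul_le hr.1)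
    rw [intervalIntegral.integral_const_mul] at h1
    have h2 := h.integral_comp_div_le hT (by norm_num : (1 : ℝ) ≤ 4)
    linarith
  · intro R hR
    have hsub : ∀ t ∈ Set.uIcc T R, 0 < t := by
      intro t ht
      rw [Set.uIcc_of_le hR] at ht
      exact hT.trans_le ht.1
    have i1 : IntervalIntegrable (fun t => 2 * t * b₂ t) volume T R :=
      ContinuousOn.intervalIntegrable
        (ContinuousOn.mul (by fun_prop) (h.cont₂.mono fun t ht => hsub t ht))
    have i2 : IntervalIntegrable (fun t => 4 * b₁ (t / 2)) volume T R := by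
      refine ContinuousOn.intervalIntegrable (ContinuousOn.mul (by fun_prop)
        (h.cont₁.comp (by fun_prop) fun t ht => ?_))
      exact half_pos (hsub t ht)
    -- The bound t b₂(t) ≤ 2 b₁(t/2) makes the tail telescope: ∫ 4 b₁(t/2) = 8 (b(T/2) − b(R/2)).
    have h1 := intervalIntegral.integral_mono_on hR i1 i2 (fun t ht => by
      have := h.id_mul_le₁ (hT.trans_le ht.1)
      linarith)
    rw [intervalIntegral.integral_const_mul,
      intervalIntegral.integral_comp_div _ (two_ne_zero (α := ℝ)), smul_eq_mul,
      h.integral_Ioc_eq (half_pos hT) (by linarith)] at h1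
    have := h.nonneg (R / 2) (half_pos (hT.trans_le hR))
    linarith

theorem tendsto_integral_zero (h : IsThreeMonotone b b₁ b₂) :
    Tendsto (fun t => ∫ r in (0 : ℝ)..t, b r) (𝓝[≥] 0) (𝓝 0) := by
  have h1 : ContinuousWithinAt (fun t => ∫ r in (0 : ℝ)..t, b r) (Set.Icc 0 1) 0 := by
    have := intervalIntegral.continuousOn_primitive_interval (f := b) (μ := volume) (a := 0)
      (b := 1) (by
        rw [Set.uIcc_of_le zero_le_one, integrableOn_Icc_iff_integrableOn_Ioc]
        exact h.integrable 1)
    rw [Set.uIcc_of_le zero_le_one] at this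
    exact this 0 (by simp)
  have h2 : 𝓝[Set.Icc (0 : ℝ) 1] 0 = 𝓝[≥] 0 := nhdsWithin_Icc_eq_nhdsGE one_pos
  rw [ContinuousWithinAt, h2] at h1
  simpa using h1

/-- Removes the boundary term at 0 in integrations by parts: `b` may blow up there, but functions
such as t b(t) are dominated by ∫₀ᵗ b, which tends to 0. -/
theorem continuousWithinAt_of_le (h : IsThreeMonotone b b₁ b₂) {f : ℝ → ℝ} (h0 : f 0 = 0) {K : ℝ}
    (hf : ∀ t, 0 < t → |f t| ≤ K * ∫ r in (0 : ℝ)..t, b r) :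
    ContinuousWithinAt f (Set.Ici 0) 0 := by
  rw [ContinuousWithinAt, h0]
  refine squeeze_zero_norm' (a := fun t => K * ∫ r in (0 : ℝ)..t, b r) ?_ (by
    simpa using h.tendsto_integral_zero.const_mul K)
  filter_upwards [self_mem_nhdsWithin] with t ht
  rcases eq_or_lt_of_le (show (0 : ℝ) ≤ t from ht) with rfl | ht
  · simp [h0]
  · exact hf t ht

theorem continuousWithinAt_id_mul (h : IsThreeMonotone b b₁ b₂) :
    ContinuousWithinAt (fun t => t * b t) (Set.Ici 0) 0 := by
  refine h.continuousWithinAt_of_le (K := 1) (by simp) fun t ht => ?_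
  rw [abs_of_nonneg (mul_nonneg ht.le (h.nonneg t ht)), one_mul]
  exact h.mul_le_integral ht

theorem continuousWithinAt_sq_mul (h : IsThreeMonotone b b₁ b₂) :
    ContinuousWithinAt (fun t => t * (t * b₁ t)) (Set.Ici 0) 0 := by
  refine h.continuousWithinAt_of_le (K := 4) (by simp) fun t ht => ?_
  rw [abs_of_nonneg (mul_nonneg ht.le (mul_nonneg ht.le (h.nonneg₁ t ht)))]
  have h1 := mul_le_mul_of_nonneg_left (h.id_mul_le ht) ht.le
  have h2 := h.mul_div_le_integral ht one_le_two
  linarith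

/-- The transform of (t b)' = b − t b₁. It trades the derivative of b̂ for transforms already
bounded by ∫₀ᵀ b with T = 1/|z|; the next two identities do the same for t² b₁ and t² b. -/
theorem mul_laplace_id_mul (h : IsThreeMonotone b b₁ b₂) {z : ℂ} (hz : 0 < z.re) :
    z * laplace (fun t => t * b t) z = laplace b z - laplace (fun t => t * b₁ t) z := by
  have hd : ∀ t, 0 < t → HasDerivAt (fun t => t * b t) (b t + (-1) * (t * b₁ t)) t := by
    intro t ht
    refine ((hasDerivAt_id t).mul (h.deriv t ht)).congr_deriv ?_
    simp
  have := laplace_deriv h.expType.id_mul (h.expType.add (h.expType₁.const_mul (-1))) hd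
    h.continuousWithinAt_id_mul hz
  rw [this, laplace_add h.expType (h.expType₁.const_mul (-1)) hz, laplace_const_mul]
  simp
  ring

theorem mul_laplace_sq_mul (h : IsThreeMonotone b b₁ b₂) {z : ℂ} (hz : 0 < z.re) :
    z * laplace (fun t => t * (t * b₁ t)) z =
      2 * laplace (fun t => t * b₁ t) z - laplace (fun t => t * (t * b₂ t)) z := by
  have hd : ∀ t, 0 < t → HasDerivAt (fun t => t * (t * b₁ t))
      (2 * (t * b₁ t) + (-1) * (t * (t * b₂ t))) t := by
    intro t ht
    refine ((hasDerivAt_id t).mul ((hasDerivAt_id t).mul (h.deriv₁ t ht))).congr_deriv ?_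
    simp
    ring
  have := laplace_deriv h.expType₁.id_mul ((h.expType₁.const_mul 2).add (h.expType₂.const_mul (-1)))
    hd h.continuousWithinAt_sq_mul hz
  rw [this, laplace_add (h.expType₁.const_mul 2) (h.expType₂.const_mul (-1)) hz,
    laplace_const_mul, laplace_const_mul]
  simp
  ring

theorem sq_mul_laplace (h : IsThreeMonotone b b₁ b₂) {z : ℂ} (hz : 0 < z.re) :
    z ^ 2 * laplace (fun t => t * (t * b t)) z = 2 * laplace b z -
      4 * laplace (fun t => t * b₁ t) z + laplace (fun t => t * (t * b₂ t)) z := by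
  have he := h.expType.id_mul
  have he1 := h.expType₁.id_mul
  have hd : ∀ t, 0 < t → HasDerivAt (fun t => t * (t * b t))
      (2 * (t * b t) + (-1) * (t * (t * b₁ t))) t := by
    intro t ht
    refine ((hasDerivAt_id t).mul ((hasDerivAt_id t).mul (h.deriv t ht))).congr_deriv ?_
    simp
    ring
  have hc : ContinuousWithinAt (fun t => t * (t * b t)) (Set.Ici 0) 0 :=
    continuousWithinAt_id.mul h.continuousWithinAt_id_mul
  have := laplace_deriv he.id_mul ((he.const_mul 2).add (he1.const_mul (-1))) hd hc hz
  rw [laplace_add (he.const_mul 2) (he1.const_mul (-1)) hz, laplace_const_mul,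
    laplace_const_mul] at this
  simp only [zero_mul, Complex.ofReal_zero, zero_add, Complex.ofReal_neg, Complex.ofReal_one,
    Complex.ofReal_ofNat] at this
  linear_combination z * this + 2 * h.mul_laplace_id_mul hz - h.mul_laplace_sq_mul hz

/-- The constant is 190 = 2·3 + 4·14 + 128, from the identity for z² times the transform of t² b;
the first-order bound needs 3 + 14. -/
theorem norm_mul_laplace_le (h : IsThreeMonotone b b₁ b₂) {z : ℂ} (hz : 0 < z.re) :
    ‖z‖ * ‖laplace (fun t => t * b t) z‖ ≤ 190 * (∫ t in (0 : ℝ)..‖z‖⁻¹, b t) ∧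
    ‖z‖ ^ 2 * ‖laplace (fun t => t * (t * b t)) z‖ ≤ 190 * ∫ t in (0 : ℝ)..‖z‖⁻¹, b t := by
  have h0 := h.norm_laplace_le hz
  have h1 := h.norm_laplace_le₁ hz
  have h2 := h.norm_laplace_le₂ hz
  have hn := norm_nonneg (laplace b z)
  constructor
  · rw [← norm_mul, h.mul_laplace_id_mul hz]
    refine (norm_sub_le _ _).trans ?_
    linarith
  · rw [← norm_pow, ← norm_mul, h.sq_mul_laplace hz]
    refine (norm_add_le _ _).trans ?_
    have := norm_sub_le (2 * laplace b z) (4 * laplace (fun t => t * b₁ t) z)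
    rw [norm_mul, norm_mul] at this
    norm_num at this
    linarith

end IsThreeMonotone

/-! ### Monotone kernels: lower bounds -/

/-- Alternating sums of a convex sequence. -/
theorem half_sub_le_alternating_sum {a : ℕ → ℝ} (hc : ∀ j, 2 * a (j + 1) ≤ a j + a (j + 2)) (N : ℕ) :
    (a 0 - a (2 * N)) / 2 ≤ ∑ j ∈ Finset.range (2 * N), (-1) ^ j * a j := by
  induction N with
  | zero => simp
  | succ N ih =>
    rw [mul_add, mul_one, Finset.sum_range_succ, Finset.sum_range_succ]
    -- By convexity each pair satisfies a(2N) − a(2N+1) ≥ (a(2N) − a(2N+2))/2, and these lower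
    -- bounds telescope.
    have h1 := hc (2 * N)
    have h2 : (-1 : ℝ) ^ (2 * N) = 1 := by rw [pow_mul]; norm_num
    have h3 : (-1 : ℝ) ^ (2 * N + 1) = -1 := by rw [pow_succ, h2]; norm_num
    rw [h2, h3]
    linarith

/-- The sine transform of a convex decreasing function is at least half of the contribution of the
first half-period. -/
theorem half_integral_le_sine_transform {m : ℝ → ℝ} {k : ℝ} (hk : 0 < k)
    (hm : ∀ t, 0 < t → 0 ≤ m t) (ha : AntitoneOn m (Set.Ioi 0)) (h0 : Tendsto m atTop (𝓝 0))
    (hc : ∀ t h, 0 < t → 0 < h → 2 * m (t + h) ≤ m t + m (t + 2 * h))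
    (hi : IntegrableOn (fun t => Real.sin (k * t) * m t) (Set.Ioi 0)) :
    (∫ t in (0 : ℝ)..(Real.pi / k), Real.sin (k * t) * m t) / 2 ≤
      ∫ t in Set.Ioi (0 : ℝ), Real.sin (k * t) * m t := by
  set h := Real.pi / k with hh
  have hh0 : 0 < h := div_pos Real.pi_pos hk
  have hkh : k * h = Real.pi := by rw [hh]; field_simp
  have hii : ∀ x y : ℝ, 0 ≤ x → 0 ≤ y → IntervalIntegrable
      (fun t => Real.sin (k * t) * m t) volume x y := by
    intro x y hx hy
    rw [intervalIntegrable_iff]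
    exact hi.mono_set fun t ht => (le_min hx hy).trans_lt ht.1
  -- The sine changes sign from one half-period to the next, so the integral is the alternating sum
  -- of the `a j`. This sequence is convex because `m` is, and it tends to 0.
  set a : ℕ → ℝ := fun j => ∫ t in (0 : ℝ)..h, Real.sin (k * t) * m (t + j * h)
  have hsin : ∀ (j : ℕ) (t : ℝ), Real.sin (k * (t + j * h)) = (-1) ^ j * Real.sin (k * t) := by
    intro j t
    have : k * (t + j * h) = k * t + j * Real.pi := by rw [← hkh]; ring
    rw [this, Real.sin_add_nat_mul_pi]
  have hpow : ∀ j : ℕ, (-1 : ℝ) ^ j * (-1) ^ j = 1 := fun j => by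
    rw [← mul_pow]; norm_num
  have hia : ∀ j : ℕ, IntervalIntegrable (fun t => Real.sin (k * t) * m (t + j * h)) volume 0 h := by
    intro j
    have hj : (0 : ℝ) ≤ j * h := by positivity
    have h1 := ((hii (0 + j * h) (h + j * h) (by linarith) (by linarith)).comp_add_right
      (j * h)).const_mul ((-1) ^ j)
    rw [add_sub_cancel_right, add_sub_cancel_right] at h1
    refine h1.congr fun t _ => ?_
    simp only [hsin]
    rw [← mul_assoc, ← mul_assoc, hpow, one_mul]
  have hpiece : ∀ j : ℕ, ∫ t in (j * h)..((j + 1 : ℕ) * h), Real.sin (k * t) * m t =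
      (-1) ^ j * a j := by
    intro j
    have h1 := intervalIntegral.integral_comp_add_right (a := 0) (b := h)
      (fun t => Real.sin (k * t) * m t) (j * h)
    have e1 : h + j * h = (j + 1 : ℕ) * h := by push_cast; ring
    rw [zero_add, e1] at h1
    rw [← h1, ← intervalIntegral.integral_const_mul]
    congr 1
    ext t
    rw [hsin]
    ring
  have hsum : ∀ n : ℕ, ∑ j ∈ Finset.range n, (-1) ^ j * a j =
      ∫ t in (0 : ℝ)..(n * h), Real.sin (k * t) * m t := by
    intro n
    rw [← Finset.sum_congr rfl fun j _ => hpiece j,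
      intervalIntegral.sum_integral_adjacent_intervals (a := fun j : ℕ => (j : ℝ) * h)
        fun j _ => hii _ _ (by positivity) (by positivity)]
    simp
  have hsin0 : ∀ t ∈ Set.Ioo (0 : ℝ) h, 0 ≤ Real.sin (k * t) := by
    intro t ht
    refine Real.sin_nonneg_of_nonneg_of_le_pi (mul_nonneg hk.le ht.1.le) ?_
    rw [← hkh]
    gcongr
    exact ht.2.le
  have hconv : ∀ j, 2 * a (j + 1) ≤ a j + a (j + 2) := by
    intro j
    rw [← intervalIntegral.integral_const_mul, ← intervalIntegral.integral_add (hia _) (hia _)]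
    refine intervalIntegral.integral_mono_on_of_le_Ioo hh0.le ((hia _).const_mul 2)
      ((hia _).add (hia _)) fun t ht => ?_
    have hj : (0 : ℝ) ≤ j * h := by positivity
    have h1 := hc (t + j * h) h (by linarith [ht.1]) hh0
    have e1 : t + (j + 1 : ℕ) * h = t + j * h + h := by push_cast; ring
    have e2 : t + (j + 2 : ℕ) * h = t + j * h + 2 * h := by push_cast; ring
    rw [e1, e2]
    have := mul_le_mul_of_nonneg_left h1 (hsin0 t ht)
    linarith
  have hlim1 : Tendsto (fun N : ℕ => ((2 * N : ℕ) : ℝ) * h) atTop atTop := by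
    refine Tendsto.atTop_mul_const hh0 (tendsto_natCast_atTop_atTop.comp ?_)
    exact tendsto_id.const_mul_atTop' two_pos
  have hlima : Tendsto (fun N : ℕ => a (2 * N)) atTop (𝓝 0) := by
    have hb : Tendsto (fun N : ℕ => h * m (((2 * N : ℕ) : ℝ) * h)) atTop (𝓝 0) := by
      simpa using (h0.comp hlim1).const_mul h
    refine squeeze_zero' (Eventually.of_forall fun N => ?_) ?_ hb
    · refine intervalIntegral.integral_nonneg_of_ae_restrict hh0.le ?_
      rw [← restrict_Ioo_eq_restrict_Icc]
      filter_upwards [ae_restrict_mem measurableSet_Ioo] with t ht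
      have hj : (0 : ℝ) ≤ ((2 * N : ℕ) : ℝ) * h := by positivity
      exact mul_nonneg (hsin0 t ht) (hm _ (by linarith [ht.1]))
    · filter_upwards [eventually_gt_atTop 0] with N hN
      have hN0 : (0 : ℝ) < ((2 * N : ℕ) : ℝ) * h := by positivity
      have h1 := intervalIntegral.integral_mono_on_of_le_Ioo hh0.le (hia (2 * N))
        (intervalIntegrable_const (c := m (((2 * N : ℕ) : ℝ) * h))) fun t ht => ?_
      · simpa [a] using h1
      · have h2 : m (t + ((2 * N : ℕ) : ℝ) * h) ≤ m (((2 * N : ℕ) : ℝ) * h) :=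
          ha hN0 (show (0 : ℝ) < _ by linarith [ht.1]) (by linarith [ht.1])
        have h3 := hm (t + ((2 * N : ℕ) : ℝ) * h) (by linarith [ht.1])
        calc _ ≤ 1 * m (t + ((2 * N : ℕ) : ℝ) * h) := by
              gcongr
              exact Real.sin_le_one _
          _ ≤ _ := by rw [one_mul]; exact h2
  have hl := (tendsto_const_nhds (x := a 0)).sub hlima |>.div_const 2
  have hr := (intervalIntegral_tendsto_integral_Ioi 0 hi tendsto_id).comp hlim1
  have := le_of_tendsto_of_tendsto' hl hr fun N => by
    have := half_sub_le_alternating_sum hconv N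
    rw [hsum] at this
    exact this
  simpa [a] using this

namespace IsThreeMonotone

variable {b b₁ b₂ : ℝ → ℝ}

/-- The negative of the derivative of `e^{-σt} b(t)`. -/
noncomputable def damped (b b₁ : ℝ → ℝ) (σ t : ℝ) : ℝ := Real.exp (-(σ * t)) * (σ * b t + b₁ t)

theorem hasDerivAt_exp_neg (σ t : ℝ) :
    HasDerivAt (fun t => Real.exp (-(σ * t))) (-(σ * Real.exp (-(σ * t)))) t := by
  refine (((hasDerivAt_id t).const_mul σ).neg.exp).congr_deriv ?_
  simp
  ring

theorem hasDerivAt_exp_mul (h : IsThreeMonotone b b₁ b₂) (σ : ℝ) {t : ℝ} (ht : 0 < t) :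
    HasDerivAt (fun t => Real.exp (-(σ * t)) * b t) (-damped b b₁ σ t) t := by
  refine ((hasDerivAt_exp_neg σ t).mul (h.deriv t ht)).congr_deriv ?_
  rw [damped]
  ring

theorem hasDerivAt_damped (h : IsThreeMonotone b b₁ b₂) (σ : ℝ) {t : ℝ} (ht : 0 < t) :
    HasDerivAt (damped b b₁ σ)
      (-(Real.exp (-(σ * t)) * (σ ^ 2 * b t + 2 * σ * b₁ t + b₂ t))) t := by
  refine ((hasDerivAt_exp_neg σ t).mul
    (((h.deriv t ht).const_mul σ).add (h.deriv₁ t ht))).congr_deriv ?_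
  simp only [Pi.add_apply]
  ring

theorem damped_nonneg (h : IsThreeMonotone b b₁ b₂) {σ t : ℝ} (hσ : 0 ≤ σ) (ht : 0 < t) :
    0 ≤ damped b b₁ σ t := by
  have := h.nonneg t ht
  have := h.nonneg₁ t ht
  unfold damped
  positivity

/-- Minus the derivative is e^{−σt}(σ²b + 2σb₁ + b₂), a product of nonnegative nonincreasing
factors, so the slopes over consecutive intervals of length l increase. -/
theorem damped_convex (h : IsThreeMonotone b b₁ b₂) {σ : ℝ} (hσ : 0 ≤ σ) {t l : ℝ} (ht : 0 < t)
    (hl : 0 < l) : 2 * damped b b₁ σ (t + l) ≤ damped b b₁ σ t + damped b b₁ σ (t + 2 * l) := by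
  set n : ℝ → ℝ := fun t => Real.exp (-(σ * t)) * (σ ^ 2 * b t + 2 * σ * b₁ t + b₂ t)
  have hd : ∀ x, 0 < x → HasDerivAt (damped b b₁ σ) (-n x) x := fun x hx => h.hasDerivAt_damped σ hx
  obtain ⟨c, hc, he⟩ := exists_hasDerivAt_eq_slope (damped b b₁ σ) (fun x => -n x)
    (by linarith : t < t + l)
    (fun x hx => (hd x (by linarith [hx.1])).continuousAt.continuousWithinAt)
    (fun x hx => hd x (by linarith [hx.1]))
  obtain ⟨d, hd', he'⟩ := exists_hasDerivAt_eq_slope (damped b b₁ σ) (fun x => -n x)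
    (by linarith : t + l < t + 2 * l)
    (fun x hx => (hd x (by linarith [hx.1])).continuousAt.continuousWithinAt)
    (fun x hx => hd x (by linarith [hx.1]))
  have hc0 : 0 < c := by linarith [hc.1]
  have hcd : c ≤ d := by linarith [hc.2, hd'.1]
  have hd0 : 0 < d := by linarith
  have hn : n d ≤ n c := by
    have a0 := h.anti hc0 hd0 hcd
    have a1 := h.anti₁ hc0 hd0 hcd
    have a2 := h.anti₂ hc0 hd0 hcd
    have b0 := h.nonneg d hd0
    have b1 := h.nonneg₁ d hd0
    have b2 := h.nonneg₂ d hd0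
    simp only [n]
    gcongr
  rw [eq_div_iff (by linarith)] at he he'
  nlinarith

theorem damped_anti (h : IsThreeMonotone b b₁ b₂) {σ : ℝ} (hσ : 0 ≤ σ) :
    AntitoneOn (damped b b₁ σ) (Set.Ioi 0) := by
  refine antitoneOn_of_hasDerivAt_neg (fun t ht => h.hasDerivAt_damped σ ht) fun t ht => ?_
  have := h.nonneg t ht
  have := h.nonneg₁ t ht
  have := h.nonneg₂ t ht
  positivity

theorem tendsto_damped (h : IsThreeMonotone b b₁ b₂) {σ : ℝ} (hσ : 0 < σ) :
    Tendsto (damped b b₁ σ) atTop (𝓝 0) := by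
  have h1 : Tendsto (fun t => Real.exp (-(σ * t)) * (σ * b 1 + b₁ 1)) atTop (𝓝 0) := by
    have : Tendsto (fun t => Real.exp (-(σ * t))) atTop (𝓝 0) :=
      Real.tendsto_exp_neg_atTop_nhds_zero.comp (tendsto_id.const_mul_atTop hσ)
    simpa using this.mul_const (σ * b 1 + b₁ 1)
  refine squeeze_zero' ?_ ?_ h1
  · filter_upwards [eventually_gt_atTop 0] with t ht
    exact h.damped_nonneg hσ.le ht
  · filter_upwards [eventually_ge_atTop 1] with t ht
    have ht0 : (0 : ℝ) < t := by linarith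
    have a0 := h.anti (Set.mem_Ioi.mpr one_pos) ht0 ht
    have a1 := h.anti₁ (Set.mem_Ioi.mpr one_pos) ht0 ht
    unfold damped
    gcongr

/-- The bound |sin kt| ≤ kt compensates the singularity of b₁ at 0: t b₁ has exponential type 0
although b₁ need not be integrable. -/
theorem integrable_sin_mul_damped (h : IsThreeMonotone b b₁ b₂) {σ k : ℝ} (hσ : 0 < σ)
    (hk : 0 ≤ k) : IntegrableOn (fun t => Real.sin (k * t) * damped b b₁ σ t) (Set.Ioi 0) := by
  have hg := ((h.expType.id_mul.const_mul (k * σ)).add (h.expType₁.const_mul k)) σ hσ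
  refine Integrable.mono' hg ?_ ?_
  · refine ContinuousOn.aestronglyMeasurable (fun t ht => ?_) measurableSet_Ioi
    exact ((by fun_prop : Continuous fun t => Real.sin (k * t)).continuousAt.mul
      (h.hasDerivAt_damped σ ht).continuousAt).continuousWithinAt
  · filter_upwards [ae_restrict_mem measurableSet_Ioi] with t ht
    have ht : 0 < t := ht
    rw [norm_mul, Real.norm_of_nonneg (h.damped_nonneg hσ.le ht), Real.norm_eq_abs]
    have h1 : |Real.sin (k * t)| ≤ k * t := by
      refine Real.abs_sin_le_abs.trans (le_of_eq ?_)
      exact abs_of_nonneg (by positivity)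
    calc _ ≤ k * t * damped b b₁ σ t := by
          gcongr
          exact h.damped_nonneg hσ.le ht
      _ = _ := by unfold damped; ring

theorem laplace_re (b : ℝ → ℝ) (h : ExpType 0 b) {z : ℂ} (hz : 0 < z.re) :
    (laplace b z).re = ∫ t in Set.Ioi (0 : ℝ), Real.cos (z.im * t) * (Real.exp (-(z.re * t)) * b t) := by
  rw [laplace, ← Complex.reCLM_apply, ← ContinuousLinearMap.integral_comp_comm _ (h.integrable hz)]
  congr 1
  ext t
  simp [Complex.exp_re]
  ring

/-- Integration by parts turns the cosine transform of `e^{-σt} b` into a sine transform. -/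
theorem mul_laplace_re (h : IsThreeMonotone b b₁ b₂) {z : ℂ} (hz : 0 < z.re) (hk : 0 ≤ z.im) :
    z.im * (laplace b z).re =
      ∫ t in Set.Ioi (0 : ℝ), Real.sin (z.im * t) * damped b b₁ z.re t := by
  rw [laplace_re b h.expType hz]
  set k := z.im
  set σ := z.re
  have i0 : IntegrableOn (fun t => Real.cos (k * t) * (Real.exp (-(σ * t)) * b t)) (Set.Ioi 0) :=
    (h.expType σ hz).bdd_mul (c := 1)
      (by fun_prop : Continuous fun t => Real.cos (k * t)).aestronglyMeasurable
      (ae_of_all _ fun t => Real.abs_cos_le_one _)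
  have i1 := h.integrable_sin_mul_damped hz hk
  have is : IntegrableOn (fun t => Real.sin (k * t) * (Real.exp (-(σ * t)) * b t)) (Set.Ioi 0) :=
    (h.expType σ hz).bdd_mul (c := 1)
      (by fun_prop : Continuous fun t => Real.sin (k * t)).aestronglyMeasurable
      (ae_of_all _ fun t => Real.abs_sin_le_one _)
  have hd : ∀ t ∈ Set.Ioi (0 : ℝ), HasDerivAt
      (fun t => Real.sin (k * t) * (Real.exp (-(σ * t)) * b t))
      (k * (Real.cos (k * t) * (Real.exp (-(σ * t)) * b t)) -
        Real.sin (k * t) * damped b b₁ σ t) t := by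
    intro t ht
    refine ((((hasDerivAt_id t).const_mul k).sin).mul (h.hasDerivAt_exp_mul σ ht)).congr_deriv ?_
    simp
    ring
  have id : IntegrableOn (fun t => k * (Real.cos (k * t) * (Real.exp (-(σ * t)) * b t)) -
      Real.sin (k * t) * damped b b₁ σ t) (Set.Ioi 0) := (i0.const_mul k).sub i1
  have hcont : ContinuousWithinAt (fun t => Real.sin (k * t) * (Real.exp (-(σ * t)) * b t))
      (Set.Ici 0) 0 := by
    refine h.continuousWithinAt_of_le (K := k) (by simp) fun t ht => ?_
    have hb0 := h.nonneg t ht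
    rw [abs_mul, abs_mul, Real.abs_exp, abs_of_nonneg hb0]
    have h1 : |Real.sin (k * t)| ≤ k * t := by
      refine Real.abs_sin_le_abs.trans (le_of_eq ?_)
      exact abs_of_nonneg (by positivity)
    have h2 : Real.exp (-(σ * t)) ≤ 1 := by
      rw [Real.exp_le_one_iff]
      have := mul_pos hz ht
      linarith
    calc _ ≤ k * t * (1 * b t) := by gcongr
      _ = k * (t * b t) := by ring
      _ ≤ _ := by gcongr; exact h.mul_le_integral ht
  have := integral_Ioi_of_hasDerivAt_of_tendsto hcont hd id
    (tendsto_zero_of_hasDerivAt_of_integrableOn_Ioi hd id is)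
  rw [integral_sub (i0.const_mul k) i1, integral_const_mul] at this
  simp only [mul_zero, Real.sin_zero, zero_mul, sub_zero] at this
  linarith

/-- The lower bound for the real part in terms of `∫₀ᵀ -t b'(t) dt`, `T = 1 / |z|`. -/
theorem laplace_re_lower_of_im_pos (h : IsThreeMonotone b b₁ b₂) {z : ℂ} (hz : 0 < z.re)
    (hk : 0 < z.im) :
    (Real.pi * Real.exp 1)⁻¹ * ∫ t in (0 : ℝ)..‖z‖⁻¹, t * b₁ t ≤ (laplace b z).re := by
  have hn := norm_pos_of_re_pos hz
  set T := ‖z‖⁻¹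
  have hT : 0 < T := inv_pos.mpr hn
  have hkT : z.im * T ≤ 1 := by
    have := (le_abs_self _).trans (Complex.abs_im_le_norm z)
    rw [← div_eq_mul_inv, div_le_one hn]
    exact this
  have hσT : z.re * T ≤ 1 := by
    rw [← div_eq_mul_inv, div_le_one hn]
    exact Complex.re_le_norm z
  have hpi := Real.pi_gt_three
  have i1 := h.integrable_sin_mul_damped hz hk.le
  have key := half_integral_le_sine_transform hk (fun t ht => h.damped_nonneg hz.le ht)
    (h.damped_anti hz.le) (h.tendsto_damped hz) (fun t l ht hl => h.damped_convex hz.le ht hl) i1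
  rw [← h.mul_laplace_re hz hk.le] at key
  -- The split point T lies in the first half-period, so the nonnegative contribution of [T, π/Im z]
  -- can be dropped.
  have hTh : T ≤ Real.pi / z.im := by
    rw [le_div_iff₀ hk]; linarith
  have hii : ∀ x y : ℝ, 0 ≤ x → 0 ≤ y → IntervalIntegrable
      (fun t => Real.sin (z.im * t) * damped b b₁ z.re t) volume x y := by
    intro x y hx hy
    rw [intervalIntegrable_iff]
    exact i1.mono_set fun t ht => (le_min hx hy).trans_lt ht.1
  have hh : 0 < Real.pi / z.im := by positivity
  rw [← intervalIntegral.integral_add_adjacent_intervals (hii 0 T le_rfl hT.le)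
    (hii T _ hT.le hh.le)] at key
  have p1 : 0 ≤ ∫ t in T..(Real.pi / z.im), Real.sin (z.im * t) * damped b b₁ z.re t := by
    refine intervalIntegral.integral_nonneg hTh fun t ht => ?_
    have ht0 : 0 < t := hT.trans_le ht.1
    refine mul_nonneg (Real.sin_nonneg_of_nonneg_of_le_pi (by positivity) ?_)
      (h.damped_nonneg hz.le ht0)
    have := ht.2
    rw [le_div_iff₀ hk] at this
    linarith
  -- On (0, T) both t Im z and t Re z are at most 1: Jordan's inequality bounds the sine below, the
  -- exponential is at least 1/e, and the term with b is discarded.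
  have p2 : 2 / Real.pi * z.im * (Real.exp 1)⁻¹ * (∫ t in (0 : ℝ)..T, t * b₁ t) ≤
      ∫ t in (0 : ℝ)..T, Real.sin (z.im * t) * damped b b₁ z.re t := by
    rw [← intervalIntegral.integral_const_mul]
    refine intervalIntegral.integral_mono_on_of_le_Ioo hT.le
      ((h.expType₁.intervalIntegrable le_rfl hT.le).const_mul _) (hii 0 T le_rfl hT.le)
      fun t ht => ?_
    have b0 := h.nonneg t ht.1
    have b1 := h.nonneg₁ t ht.1
    have ht1 := ht.1
    have htT := ht.2.le
    have s1 : 2 / Real.pi * (z.im * t) ≤ Real.sin (z.im * t) := by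
      refine Real.mul_le_sin (by positivity) ?_
      have : z.im * t ≤ z.im * T := by gcongr
      linarith
    have s2 : (Real.exp 1)⁻¹ ≤ Real.exp (-(z.re * t)) := by
      rw [← Real.exp_neg]
      gcongr
      have : z.re * t ≤ z.re * T := by gcongr
      linarith
    calc _ = 2 / Real.pi * (z.im * t) * ((Real.exp 1)⁻¹ * (b₁ t)) := by ring
      _ ≤ Real.sin (z.im * t) * (Real.exp (-(z.re * t)) * (z.re * b t + b₁ t)) := by
        gcongr
        · exact le_trans (by positivity) s1
        · have := mul_nonneg hz.le b0
          linarith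
      _ = _ := rfl
  have p3 : 2 / Real.pi * z.im * (Real.exp 1)⁻¹ * (∫ t in (0 : ℝ)..T, t * b₁ t) ≤
      2 * (z.im * (laplace b z).re) := by linarith
  have p4 : 2 / Real.pi * z.im * (Real.exp 1)⁻¹ * (∫ t in (0 : ℝ)..T, t * b₁ t) =
      2 * (z.im * ((Real.pi * Real.exp 1)⁻¹ * ∫ t in (0 : ℝ)..T, t * b₁ t)) := by
    rw [mul_inv]; ring
  rw [p4] at p3
  exact le_of_mul_le_mul_left (le_of_mul_le_mul_left p3 two_pos) hk

theorem integral_eq_add (h : IsThreeMonotone b b₁ b₂) {T : ℝ} (hT : 0 < T) :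
    ∫ t in (0 : ℝ)..T, b t = (∫ t in (0 : ℝ)..T, t * b₁ t) + T * b T := by
  have hc : ContinuousOn (fun t => t * b t) (Set.Icc 0 T) := by
    intro t ht
    rcases eq_or_lt_of_le ht.1 with rfl | h0
    · exact h.continuousWithinAt_id_mul.mono Set.Icc_subset_Ici_self
    · exact (continuousAt_id.mul (h.deriv t h0).continuousAt).continuousWithinAt
  have i0 := h.expType.intervalIntegrable le_rfl hT.le
  have i1 := h.expType₁.intervalIntegrable le_rfl hT.le
  have := intervalIntegral.integral_eq_sub_of_hasDerivAt_of_le hT.le hc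
    (f' := fun t => b t - t * b₁ t) (fun t ht =>
      ((hasDerivAt_id t).mul (h.deriv t ht.1)).congr_deriv (by simp; ring)) (i0.sub i1)
  rw [intervalIntegral.integral_sub i0 i1] at this
  simp only [zero_mul, sub_zero] at this
  linarith

/-- Real points: the transform dominates the integral of the kernel. -/
theorem integral_le_laplace_re (h : IsThreeMonotone b b₁ b₂) {σ : ℝ} (hσ : 0 < σ) :
    (Real.exp 1)⁻¹ * ∫ t in (0 : ℝ)..σ⁻¹, b t ≤ (laplace b σ).re := by
  have hT : 0 < σ⁻¹ := inv_pos.mpr hσ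
  rw [laplace_re b h.expType (by simpa using hσ), intervalIntegral.integral_of_le hT.le,
    ← integral_const_mul]
  simp only [Complex.ofReal_im, zero_mul, Real.cos_zero, one_mul, Complex.ofReal_re]
  refine (setIntegral_mono_on (g := fun t => Real.exp (-(σ * t)) * b t)
    ((h.integrable σ⁻¹).const_mul _) ((h.expType σ hσ).mono_set Set.Ioc_subset_Ioi_self)
    measurableSet_Ioc fun t ht => ?_).trans
    (setIntegral_mono_set (h.expType σ hσ) ?_ Set.Ioc_subset_Ioi_self.eventuallyLE)
  · have := h.nonneg t ht.1
    rw [← Real.exp_neg]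
    gcongr
    have : σ * t ≤ σ * σ⁻¹ := by gcongr; exact ht.2
    rwa [mul_inv_cancel₀ hσ.ne'] at this
  · filter_upwards [ae_restrict_mem measurableSet_Ioi] with t ht
    have := h.nonneg t ht
    simp only [Pi.zero_apply]
    positivity

/-- Conjugation covers Im z < 0. On the real axis, where the sine transform gives nothing,
positivity of the integrand gives the stronger bound e⁻¹ ∫₀ᵀ b with T = 1/|z|. -/
theorem laplace_re_lower (h : IsThreeMonotone b b₁ b₂) {z : ℂ} (hz : 0 < z.re) :
    (Real.pi * Real.exp 1)⁻¹ * ∫ t in (0 : ℝ)..‖z‖⁻¹, t * b₁ t ≤ (laplace b z).re := by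
  rcases lt_trichotomy z.im 0 with h0 | h0 | h0
  · have := h.laplace_re_lower_of_im_pos (z := starRingEnd ℂ z) (by simpa using hz)
      (by simpa using h0)
    rwa [laplace_conj, Complex.conj_re, RCLike.norm_conj] at this
  · have hz' : z = (z.re : ℂ) := by apply Complex.ext <;> simp [h0]
    have hn : ‖z‖ = z.re := by
      rw [hz', Complex.norm_real, Real.norm_of_nonneg]
      · simp
      · simpa using hz.le
    have h1 := h.integral_le_laplace_re hz
    rw [← hz'] at h1
    rw [hn]
    have hT : 0 < z.re⁻¹ := inv_pos.mpr hz
    have h2 := h.integral_eq_add hT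
    have h3 := mul_nonneg hT.le (h.nonneg _ hT)
    have h4 : 0 ≤ ∫ t in (0 : ℝ)..z.re⁻¹, b t := (mul_nonneg hT.le (h.nonneg _ hT)).trans
      (h.mul_le_integral hT)
    refine le_trans ?_ h1
    have hpi : 1 ≤ Real.pi := by linarith [Real.pi_gt_three]
    have he := Real.exp_pos 1
    refine (mul_le_mul_of_nonneg_left (by linarith) (by positivity)).trans
      (mul_le_mul_of_nonneg_right (inv_anti₀ he ?_) h4)
    nlinarith
  · exact h.laplace_re_lower_of_im_pos hz h0

end IsThreeMonotone

/-! ### Monotone kernels are parabolic -/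

theorem MonotoneKernelAssumption.isThreeMonotone {b : ℝ → ℝ} (h : MonotoneKernelAssumption b) :
    IsThreeMonotone b (fun t => -deriv b t) (iteratedDeriv 2 b) := by
  obtain ⟨_, hcd, hsign, hanti, _⟩ := h.monotone
  have hcd : ContDiffOn ℝ 2 b (Set.Ioi 0) := hcd
  have hanti : AntitoneOn (fun t => (-1 : ℝ) ^ 2 * iteratedDeriv 2 b t) (Set.Ioi 0) := hanti
  have hd1 : ∀ t, 0 < t → DifferentiableAt ℝ b t := fun t ht =>
    (hcd.contDiffAt (Ioi_mem_nhds ht)).differentiableAt (by norm_num)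
  have hcd' : ContDiffOn ℝ 1 (deriv b) (Set.Ioi 0) :=
    ((contDiffOn_succ_iff_deriv_of_isOpen (n := 1) isOpen_Ioi).mp hcd).2.2
  have hcd'' : ContinuousOn (deriv (deriv b)) (Set.Ioi 0) :=
    hcd'.continuousOn_deriv_of_isOpen isOpen_Ioi le_rfl
  have e2 : iteratedDeriv 2 b = deriv (deriv b) := by
    rw [iteratedDeriv_succ, iteratedDeriv_one]
  refine ⟨fun T => ?_, fun t ht => ?_, fun t ht => ?_, fun t ht => ?_, fun t ht => ?_,
    fun t ht => ?_, ?_, ?_⟩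
  · exact (h.locallyIntegrable.integrableOn_compact_subset Set.Icc_subset_Ici_self
      isCompact_Icc).mono_set Set.Ioc_subset_Icc_self
  · simpa using hsign 0 (by norm_num) t ht
  · simpa [iteratedDeriv_one] using hsign 1 (by norm_num) t ht
  · simpa using hsign 2 (by norm_num) t ht
  · simpa using (hd1 t ht).hasDerivAt
  · rw [e2]
    exact ((hcd'.contDiffAt (Ioi_mem_nhds ht)).differentiableAt (by norm_num)).hasDerivAt.neg
  · rw [e2]; exact hcd''
  · simpa using hanti

namespace IsThreeMonotone

variable {b b₁ b₂ : ℝ → ℝ}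

theorem integral_id_mul_mono (h : IsThreeMonotone b b₁ b₂) {x y : ℝ} (hx : 0 ≤ x) (hxy : x ≤ y) :
    ∫ t in (0 : ℝ)..x, t * b₁ t ≤ ∫ t in (0 : ℝ)..y, t * b₁ t := by
  rw [intervalIntegral.integral_of_le hx, intervalIntegral.integral_of_le (hx.trans hxy)]
  refine setIntegral_mono_set (h.expType₁.integrableOn_Ioc y) ?_
    (Set.Ioc_subset_Ioc_right hxy).eventuallyLE
  filter_upwards [ae_restrict_mem measurableSet_Ioc] with t ht
  exact mul_nonneg ht.1.le (h.nonneg₁ t ht.1)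

theorem sq_half_mul_le {f : ℝ → ℝ} (ha : AntitoneOn f (Set.Ioi 0)) {T : ℝ} (hT : 0 < T)
    (hi : IntervalIntegrable (fun t => t * f t) volume 0 T) :
    T ^ 2 / 2 * f T ≤ ∫ t in (0 : ℝ)..T, t * f t := by
  have := intervalIntegral.integral_mono_on_of_le_Ioo hT.le
    ((by fun_prop : Continuous fun t : ℝ => t * f T).intervalIntegrable _ _) hi
    (fun t ht => mul_le_mul_of_nonneg_left (ha ht.1 hT ht.2.le) ht.1.le)
  rw [intervalIntegral.integral_mul_const, integral_id] at this
  simpa using this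

/-- If b₁ vanished identically, `b` would be constant, hence 0 by its decay. One point with b₁ > 0
makes b₁ positive everywhere to its left. The denominator of the ratio condition is thus positive,
so that quotient is a genuine one. -/
theorem integral_id_mul_pos (h : IsThreeMonotone b b₁ b₂) (h0 : Tendsto b atTop (𝓝 0))
    (hne : ¬ b =ᵐ[volume.restrict (Set.Ioi 0)] 0) {T : ℝ} (hT : 0 < T) :
    0 < ∫ t in (0 : ℝ)..T, t * b₁ t := by
  obtain ⟨t₁, ht₁, hb₁⟩ : ∃ t, 0 < t ∧ 0 < b₁ t := by
    by_contra! hcon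
    refine hne ?_
    have hz : ∀ t, 0 < t → b₁ t = 0 := fun t ht => le_antisymm (hcon t ht) (h.nonneg₁ t ht)
    filter_upwards [ae_restrict_mem measurableSet_Ioi] with t ht
    have hc : ∀ᶠ x in atTop, b x = b t := by
      filter_upwards [eventually_ge_atTop t] with x hx
      have := h.integral_Ioc_eq ht hx
      rw [intervalIntegral.integral_congr (g := fun _ => 0) fun r hr => by
        rw [Set.uIcc_of_le hx] at hr
        exact hz r (lt_of_lt_of_le ht hr.1)] at this
      simp at this
      linarith
    exact tendsto_nhds_unique (tendsto_const_nhds.congr' (hc.mono fun _ hx => hx.symm)) h0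
  have hm : 0 < min T t₁ := lt_min hT ht₁
  have h1 := sq_half_mul_le h.anti₁ hm (h.expType₁.intervalIntegrable le_rfl hm.le)
  have h2 := h.integral_id_mul_mono hm.le (min_le_left T t₁)
  have h3 := h.anti₁ hm ht₁ (min_le_right T t₁)
  have h4 : 0 < min T t₁ ^ 2 / 2 * b₁ (min T t₁) := by
    have : 0 < b₁ (min T t₁) := hb₁.trans_le h3
    positivity
  linarith

end IsThreeMonotone

/-- The ratio condition bounds `∫₀ᵀ b` by `∫₀ᵀ -t b'(t) dt` for all `T`. -/
theorem MonotoneKernelAssumption.exists_integral_le {b : ℝ → ℝ} (h : MonotoneKernelAssumption b) :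
    ∃ K : ℝ, 0 < K ∧ ∀ T, 0 < T →
      ∫ t in (0 : ℝ)..T, b t ≤ K * ∫ t in (0 : ℝ)..T, t * -deriv b t := by
  have hm := h.isThreeMonotone
  obtain ⟨M, hM⟩ := h.smooth
  have hpos : ∀ T, 0 < T → 0 < ∫ t in (0 : ℝ)..T, t * -deriv b t := fun T hT =>
    hm.integral_id_mul_pos h.tendsto_zero h.ne_zero hT
  rw [eventually_sup] at hM
  -- From ∫₀ᵀ b = ∫₀ᵀ t b₁ + T b(T): monotonicity gives T b(T) ≤ (2/T) ∫₀ᵀ s b(s) ds, which the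
  -- ratio condition controls.
  have hgood : ∀ T, 0 < T → ((1 / T) * ∫ s in (0 : ℝ)..T, s * b s) /
      (∫ s in (0 : ℝ)..T, -(s * deriv b s)) ≤ M →
      ∫ t in (0 : ℝ)..T, b t ≤ (1 + 2 * |M|) * ∫ t in (0 : ℝ)..T, t * -deriv b t := by
    intro T hT hle
    have hp := hpos T hT
    simp_rw [← mul_neg] at hle
    rw [div_le_iff₀ hp] at hle
    have h1 := IsThreeMonotone.sq_half_mul_le hm.anti hT
      (hm.expType.id_mul.intervalIntegrable le_rfl hT.le)
    have h2 := hm.integral_eq_add hT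
    have h3 : T * b T ≤ 2 * ((1 / T) * ∫ s in (0 : ℝ)..T, s * b s) := by
      have := mul_le_mul_of_nonneg_left h1 (one_div_pos.mpr hT).le
      have e : 1 / T * (T ^ 2 / 2 * b T) = T * b T / 2 := by field_simp
      rw [e] at this
      linarith
    have h4 := mul_le_mul_of_nonneg_right (le_abs_self M) hp.le
    linarith
  obtain ⟨t₀, ht₀, hs⟩ := mem_nhdsGT_iff_exists_Ioc_subset.mp hM.1
  obtain ⟨t₁, hl⟩ := eventually_atTop.mp hM.2
  have ht₀ : 0 < t₀ := ht₀
  -- For t₀ < T < t₁ both integrals are monotone in T, so their values at t₁ and t₀ give a bound.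
  set K' := (∫ t in (0 : ℝ)..t₁, b t) / ∫ t in (0 : ℝ)..t₀, t * -deriv b t
  refine ⟨max (1 + 2 * |M|) K', lt_of_lt_of_le (by positivity) (le_max_left _ _), fun T hT => ?_⟩
  have hp := hpos T hT
  rcases le_or_gt T t₀ with hT0 | hT0
  · refine (hgood T hT (hs ⟨hT, hT0⟩)).trans ?_
    gcongr
    exact le_max_left _ _
  rcases le_or_gt t₁ T with hT1 | hT1
  · refine (hgood T hT (hl T hT1)).trans ?_
    gcongr
    exact le_max_left _ _
  · calc _ ≤ ∫ t in (0 : ℝ)..t₁, b t := hm.integral_mono_right hT.le hT1.le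
      _ = K' * ∫ t in (0 : ℝ)..t₀, t * -deriv b t := (div_mul_cancel₀ _ (hpos t₀ ht₀).ne').symm
      _ ≤ max (1 + 2 * |M|) K' * ∫ t in (0 : ℝ)..T, t * -deriv b t := by
        have := (hpos t₀ ht₀).le
        have h1 := hm.integral_id_mul_mono ht₀.le hT0.le
        have h2 : 0 ≤ max (1 + 2 * |M|) K' := le_trans (by positivity) (le_max_left _ _)
        gcongr
        exact le_max_right _ _

/-- With I = ∫₀ᵀ b, T = 1/|z|, one has κ I ≤ Re b̂ ≤ |b̂| ≤ 3 I. Hence the sector constant κ/3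
(capped at 1) and, from 190 I ≤ (190/κ)|b̂|, the regularity constant. -/
theorem MonotoneKernelAssumption.exists_isParabolicKernel {b : ℝ → ℝ}
    (h : MonotoneKernelAssumption b) : ∃ δ C : ℝ, IsParabolicKernel b δ C := by
  have hm := h.isThreeMonotone
  obtain ⟨K, hK, hle⟩ := h.exists_integral_le
  set κ := (Real.pi * Real.exp 1 * K)⁻¹
  have hκ : 0 < κ := by have := Real.pi_pos; positivity
  have hlow : ∀ z : ℂ, 0 < z.re → κ * ∫ t in (0 : ℝ)..‖z‖⁻¹, b t ≤ (laplace b z).re := by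
    intro z hz
    refine le_trans ?_ (hm.laplace_re_lower hz)
    have := hle _ (inv_pos.mpr (norm_pos_of_re_pos hz))
    have hpi := Real.pi_pos
    calc _ ≤ κ * (K * ∫ t in (0 : ℝ)..‖z‖⁻¹, t * -deriv b t) := by gcongr
      _ = _ := by simp only [κ]; field_simp
  have hre : ∀ z : ℂ, (laplace b z).re ≤ ‖laplace b z‖ := fun z => Complex.re_le_norm _
  have hbd : ∀ z : ℂ, 0 < z.re → ∫ t in (0 : ℝ)..‖z‖⁻¹, b t ≤ κ⁻¹ * ‖laplace b z‖ := by
    intro z hz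
    rw [← div_eq_inv_mul, le_div_iff₀ hκ, mul_comm]
    exact (hlow z hz).trans (hre z)
  refine ⟨min 1 (κ / 3), 190 * κ⁻¹, hm.expType, by positivity, min_le_left _ _, by positivity,
    fun z hz => ?_, fun z hz => ?_, fun z hz => ?_⟩
  · calc _ ≤ κ / 3 * (3 * ∫ t in (0 : ℝ)..‖z‖⁻¹, b t) := by
          gcongr
          · exact min_le_right _ _
          · exact hm.norm_laplace_le hz
      _ = κ * ∫ t in (0 : ℝ)..‖z‖⁻¹, b t := by ring
      _ ≤ _ := hlow z hz
  · have := (hm.norm_mul_laplace_le hz).1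
    have := hbd z hz
    linarith
  · have := (hm.norm_mul_laplace_le hz).2
    have := hbd z hz
    linarith

/-- The behaviour of the transform at infinity controls `∫₀ᵗ b` for small `t`. -/
theorem MonotoneKernelAssumption.exists_integral_le_rpow {b : ℝ → ℝ} {ρ : ℝ}
    (h : MonotoneKernelAssumption b)
    (hΘ : (fun x : ℝ => laplace b (x : ℂ)) =Θ[atTop] fun x : ℝ => x ^ (1 - ρ)) :
    ∃ t₀ K : ℝ, 0 < t₀ ∧ 0 < K ∧ ∀ t, 0 < t → t ≤ t₀ →
      ∫ r in (0 : ℝ)..t, |b r| ≤ K * t ^ (ρ - 1) := by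
  have hm := h.isThreeMonotone
  obtain ⟨K, hK, hb⟩ := hΘ.1.exists_pos
  obtain ⟨x₀, hx₀⟩ := eventually_atTop.mp hb.bound
  have hm0 : 0 < max x₀ 1 := lt_of_lt_of_le one_pos (le_max_right _ _)
  refine ⟨(max x₀ 1)⁻¹, Real.exp 1 * K, inv_pos.mpr hm0, by positivity, fun t ht htt => ?_⟩
  have hx : max x₀ 1 ≤ t⁻¹ := by rwa [le_inv_comm₀ hm0 ht]
  have h1 := hx₀ t⁻¹ ((le_max_left _ _).trans hx)
  -- A Tauberian bound at the point 1/t: b̂(1/t) ≥ e⁻¹ ∫₀ᵗ b.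
  have h2 := hm.integral_le_laplace_re (inv_pos.mpr ht)
  have h3 := Complex.re_le_norm (laplace b (t⁻¹ : ℝ))
  have e1 : ∫ r in (0 : ℝ)..t, |b r| = ∫ r in (0 : ℝ)..t, b r := by
    rw [intervalIntegral.integral_of_le ht.le, intervalIntegral.integral_of_le ht.le]
    exact setIntegral_congr_fun measurableSet_Ioc fun r hr => abs_of_nonneg (hm.nonneg r hr.1)
  have e2 : (t⁻¹) ^ (1 - ρ) = t ^ (ρ - 1) := by
    rw [Real.inv_rpow ht.le, ← Real.rpow_neg ht.le]; congr 1; ring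
  rw [inv_inv, inv_mul_le_iff₀ (Real.exp_pos 1)] at h2
  rw [Real.norm_of_nonneg (by positivity), e2] at h1
  rw [e1, mul_assoc]
  refine h2.trans ?_
  gcongr
  exact h3.trans h1

/-! ### Diagonal operators -/

variable {H : Type*} [NormedAddCommGroup H] [InnerProductSpace ℝ H]

theorem eq_of_coeff {ι : Type*} (e : HilbertBasis ι ℝ H) {v w : H}
    (h : ∀ k, ⟪e k, v⟫_ℝ = ⟪e k, w⟫_ℝ) : v = w := by
  apply e.repr.injective
  ext k
  rw [e.repr_apply_apply, e.repr_apply_apply, h k]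

theorem hasSum_sq_coeff {ι : Type*} (e : HilbertBasis ι ℝ H) (v : H) :
    HasSum (fun k => ⟪e k, v⟫_ℝ ^ 2) (‖v‖ ^ 2) := by
  have h := e.hasSum_inner_mul_inner v v
  rw [real_inner_self_eq_norm_sq] at h
  refine h.congr_fun fun k => ?_
  rw [real_inner_comm, sq]

theorem norm_le_of_coeff {ι : Type*} (e : HilbertBasis ι ℝ H) {v w : H} {M : ℝ} (hM : 0 ≤ M)
    (h : ∀ k, |⟪e k, w⟫_ℝ| ≤ M * |⟪e k, v⟫_ℝ|) : ‖w‖ ≤ M * ‖v‖ := by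
  refine abs_le_of_sq_le_sq' ?_ (by positivity) |>.2
  rw [mul_pow]
  refine hasSum_le (fun k => ?_) (hasSum_sq_coeff e w) ((hasSum_sq_coeff e v).mul_left (M ^ 2))
  rw [← sq_abs, ← sq_abs ⟪e k, v⟫_ℝ, ← mul_pow]
  exact pow_le_pow_left₀ (abs_nonneg _) (h k) 2

theorem exists_coeff_eq {ι : Type*} (e : HilbertBasis ι ℝ H) {v : H} {c : ι → ℝ} {M : ℝ}
    (h : ∀ k, |c k| ≤ M * |⟪e k, v⟫_ℝ|) : ∃ w : H, ∀ k, ⟪e k, w⟫_ℝ = c k := by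
  have hmem : Memℓp c 2 := by
    rw [memℓp_gen_iff (by norm_num)]
    refine Summable.of_nonneg_of_le (fun k => by positivity) (fun k => ?_)
      ((hasSum_sq_coeff e v).summable.mul_left (M ^ 2))
    have := pow_le_pow_left₀ (abs_nonneg _) (h k) 2
    rw [mul_pow, sq_abs] at this
    simpa using this
  refine ⟨e.repr.symm ⟨c, hmem⟩, fun k => ?_⟩
  rw [← e.repr_apply_apply, LinearIsometryEquiv.apply_symm_apply]

/-- Bounded diagonal operators. -/
theorem exists_diagonal {ι : Type*} (e : HilbertBasis ι ℝ H) {r : ι → ℝ} {M : ℝ}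
    (h : ∀ k, |r k| ≤ M) : ∃ R : H →L[ℝ] H, ∀ v k, ⟪e k, R v⟫_ℝ = r k * ⟪e k, v⟫_ℝ := by
  have hc : ∀ v k, |r k * ⟪e k, v⟫_ℝ| ≤ max M 0 * |⟪e k, v⟫_ℝ| := fun v k => by
    rw [abs_mul]
    exact mul_le_mul_of_nonneg_right ((h k).trans (le_max_left _ _)) (abs_nonneg _)
  choose f hf using fun v : H => exists_coeff_eq e (hc v)
  refine ⟨LinearMap.mkContinuous ⟨⟨f, fun v w => eq_of_coeff e fun k => ?_⟩,
    fun a v => eq_of_coeff e fun k => ?_⟩ (max M 0) fun v => ?_, fun v k => hf v k⟩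
  · rw [inner_add_right, hf, hf, hf, inner_add_right, mul_add]
  · simp only [RingHom.id_apply, inner_smul_right, hf]
    ring
  · exact norm_le_of_coeff e (le_max_right _ _) fun k => by
      simpa only [hf, LinearMap.coe_mk, AddHom.coe_mk] using hc v k

/-- Dominated convergence for the coefficients of a family of vectors. -/
theorem tendsto_of_coeff {ι α : Type*} (e : HilbertBasis ι ℝ H) {l : Filter α} {F : α → H} {v w : H}
    {c : α → ι → ℝ} {d : ι → ℝ} {M : ℝ} (hF : ∀ᶠ a in l, ∀ k, ⟪e k, F a⟫_ℝ = c a k * ⟪e k, v⟫_ℝ)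
    (hw : ∀ k, ⟪e k, w⟫_ℝ = d k * ⟪e k, v⟫_ℝ) (hM : ∀ᶠ a in l, ∀ k, |c a k - d k| ≤ M)
    (hlim : ∀ k, Tendsto (fun a => c a k) l (𝓝 (d k))) : Tendsto F l (𝓝 w) := by
  have h1 : Tendsto (fun a => ∑' k, ((c a k - d k) * ⟪e k, v⟫_ℝ) ^ 2) l (𝓝 (∑' _ : ι, (0 : ℝ))) := by
    refine tendsto_tsum_of_dominated_convergence (bound := fun k => M ^ 2 * ⟪e k, v⟫_ℝ ^ 2)
      ((hasSum_sq_coeff e v).summable.mul_left _) (fun k => ?_) ?_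
    · have := ((((hlim k).sub_const (d k)).mul_const ⟪e k, v⟫_ℝ).pow 2)
      simpa using this
    · filter_upwards [hM] with a ha k
      rw [Real.norm_eq_abs, abs_of_nonneg (sq_nonneg _), mul_pow]
      exact mul_le_mul_of_nonneg_right (sq_le_sq' (abs_le.mp (ha k)).1 (abs_le.mp (ha k)).2)
        (sq_nonneg _)
  rw [tsum_zero] at h1
  have h2 : Tendsto (fun a => ‖F a - w‖ ^ 2) l (𝓝 0) := by
    refine h1.congr' ?_
    filter_upwards [hF] with a ha
    rw [← (hasSum_sq_coeff e (F a - w)).tsum_eq]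
    refine tsum_congr fun k => ?_
    rw [inner_sub_right, ha, hw, sub_mul]
  have h3 := (Real.continuous_sqrt.tendsto 0).comp h2
  rw [Real.sqrt_zero] at h3
  rw [tendsto_iff_norm_sub_tendsto_zero]
  exact h3.congr fun a => Real.sqrt_sq (norm_nonneg _)

/-! ### The eigenbasis -/

/-- The spectral theorem for the compact symmetric inverse K: Hilbert bases of its eigenspaces are
glued, and they are total because the orthogonal complement of the eigenspaces is trivial. K is
injective, so 0 is no eigenvalue, and |1/λ| ≤ ‖K‖ bounds the spectrum of `A` away from 0. -/
theorem OperatorAssumption.exists_eigenbasis.{u} {H : Type u} [NormedAddCommGroup H]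
    [InnerProductSpace ℝ H] [CompleteSpace H] {A : H →ₗ.[ℝ] H} (hA : OperatorAssumption A) :
    ∃ (ι : Type u) (e : HilbertBasis ι ℝ H) (lam : ι → ℝ) (L : ℝ), (∀ k, IsEigenpair A (lam k) (e k)) ∧
      (∀ k, 0 < lam k) ∧ ∀ k, (lam k)⁻¹ ≤ L := by
  obtain ⟨K, hK, hl, hr⟩ := hA.compactInverse
  have hKs : (K : H →ₗ[ℝ] H).IsSymmetric := by
    intro x y
    obtain ⟨hx1, hx2⟩ := hr x
    obtain ⟨hy1, hy2⟩ := hr y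
    have := hA.symmetric ⟨K x, hx1⟩ ⟨K y, hy1⟩
    rw [hx2, hy2] at this
    exact this.symm
  have hbot := ContinuousLinearMap.orthogonalComplement_iSup_eigenspaces_eq_bot
    (T := K) hK hKs
  have horth := hKs.orthogonalFamily_eigenspaces
  have hcl : ∀ μ, CompleteSpace (Module.End.eigenspace (K : H →ₗ[ℝ] H) μ) := fun μ => by
    have : IsClosed {x : H | K x = μ • x} := isClosed_eq K.continuous (continuous_const_smul μ)
    have h2 : IsClosed (Module.End.eigenspace (K : H →ₗ[ℝ] H) μ : Set H) := by
      convert this using 1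
      ext x
      exact Module.End.mem_eigenspace_iff
    exact h2.completeSpace_coe
  choose W B hB using fun μ => exists_hilbertBasis ℝ (Module.End.eigenspace (K : H →ₗ[ℝ] H) μ)
  have ho : Orthonormal ℝ (fun a : Σ μ, W μ => ((B a.1 a.2 : Module.End.eigenspace _ a.1) : H)) :=
    horth.orthonormal_sigma_orthonormal fun μ => (B μ).orthonormal
  have hspan : (Submodule.span ℝ (Set.range fun a : Σ μ, W μ =>
      ((B a.1 a.2 : Module.End.eigenspace _ a.1) : H)))ᗮ = ⊥ := by
    rw [eq_bot_iff, ← hbot]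
    intro v hv
    rw [← Submodule.iInf_orthogonal, Submodule.mem_iInf]
    intro μ
    rw [Submodule.mem_orthogonal']
    intro u hu
    have h1 := (((B μ).hasSum_repr ⟨u, hu⟩).mapL (Submodule.subtypeL _)).mapL (innerSL ℝ v)
    refine h1.unique ?_
    convert hasSum_zero using 1
    ext k
    rw [Submodule.mem_orthogonal'] at hv
    have h2 := hv _ (Submodule.subset_span ⟨⟨μ, k⟩, rfl⟩)
    simp only at h2
    simp [h2]
  let e := HilbertBasis.mkOfOrthogonalEqBot ho hspan
  have heK : ∀ k, K (e k) = k.1 • e k := fun k => by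
    have h1 : e k = ((B k.1 k.2 : Module.End.eigenspace _ k.1) : H) :=
      congrFun (HilbertBasis.coe_mkOfOrthogonalEqBot ho hspan) k
    rw [h1]
    exact Module.End.mem_eigenspace_iff.mp (B k.1 k.2).2
  have hne : ∀ k, e k ≠ 0 := fun k => e.orthonormal.ne_zero k
  have h0 : ∀ k : Σ μ, W μ, k.1 ≠ 0 := fun k h => by
    obtain ⟨h1, h2⟩ := hr (e k)
    have h3 : (⟨K (e k), h1⟩ : A.domain) = 0 := by
      ext
      simp [heK, h]
    rw [h3, LinearPMap.map_zero] at h2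
    exact hne k h2.symm
  have heig : ∀ k, IsEigenpair A (k.1)⁻¹ (e k) := fun k => by
    obtain ⟨h1, h2⟩ := hr (e k)
    have hu1 : e k ∈ A.domain := by
      have := A.domain.smul_mem (k.1)⁻¹ h1
      rwa [heK, smul_smul, inv_mul_cancel₀ (h0 k), one_smul] at this
    have h3 : (⟨K (e k), h1⟩ : A.domain) = k.1 • ⟨e k, hu1⟩ := by
      ext
      simp [heK]
    rw [h3, LinearPMap.map_smul] at h2
    refine ⟨hu1, ?_⟩
    rw [eq_inv_smul_iff₀ (h0 k)]
    exact h2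
  refine ⟨_, e, fun k => (k.1)⁻¹, ‖K‖, heig, fun k => ?_, fun k => ?_⟩
  · obtain ⟨h1, h2⟩ := heig k
    have h3 := hA.posDef ⟨e k, h1⟩ (hne k)
    rw [h2, real_inner_smul_left, real_inner_self_eq_norm_sq, e.orthonormal.1 k] at h3
    simpa using h3
  · have h1 := K.le_opNorm (e k)
    rw [heK, norm_smul, e.orthonormal.1 k, mul_one, mul_one] at h1
    rw [inv_inv]
    exact (le_abs_self _).trans h1

/-! ### The resolvent family is diagonal -/

section Diagonal

variable {A : H →ₗ.[ℝ] H} {ι : Type*} {e : HilbertBasis ι ℝ H} {lam : ι → ℝ}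
  {b : ℝ → ℝ} {σ : ι → ℝ → ℝ}

theorem intervalIntegrable_primitive_smul {ω : ℝ} (hb : ExpType ω b) {u : ℝ → H}
    (hu : ContinuousOn u (Set.Ici 0)) {t : ℝ} (ht : 0 ≤ t) :
    IntervalIntegrable (fun r => primitive b (t - r) • u r) volume 0 t := by
  refine ContinuousOn.intervalIntegrable ?_
  rw [Set.uIcc_of_le ht]
  exact ((continuous_primitive hb).comp (by fun_prop : Continuous fun r => t - r)).continuousOn.smul
    (hu.mono Set.Icc_subset_Ici_self)

theorem integral_smul_eq_primitive {u : ℝ → H} {t : ℝ} (ht : 0 ≤ t) :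
    ∫ s in (0 : ℝ)..t, (∫ r in (0 : ℝ)..(t - s), b r) • u s =
      ∫ s in (0 : ℝ)..t, primitive b (t - s) • u s := by
  refine intervalIntegral.integral_congr fun s hs => ?_
  rw [Set.uIcc_of_le ht] at hs
  simp only [primitive, max_eq_left (sub_nonneg.mpr hs.2)]

variable [CompleteSpace H]

theorem OperatorAssumption.inner_apply (hA : OperatorAssumption A) {μ : ℝ} {f : H}
    (hf : IsEigenpair A μ f) (x : A.domain) : ⟪f, A x⟫_ℝ = μ * ⟪f, (x : H)⟫_ℝ := by
  obtain ⟨h1, h2⟩ := hf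
  have := hA.symmetric ⟨f, h1⟩ x
  rw [h2, real_inner_smul_left] at this
  exact this.symm

/-- By Parseval, a diagonal operator composed with A^s is bounded by the supremum of λ_k^s |r_k|.
This turns the operator estimates into scalar ones. -/
theorem fracPowCompBound_of_coeff (hA : OperatorAssumption A)
    (he : ∀ k, IsEigenpair A (lam k) (e k)) (hlam : ∀ k, 0 < lam k) {s M : ℝ} (hM : 0 ≤ M)
    {R : H →L[ℝ] H} {r : ι → ℝ} (hR : ∀ v k, ⟪e k, R v⟫_ℝ = r k * ⟪e k, v⟫_ℝ)
    (h : ∀ k, lam k ^ s * |r k| ≤ M) : FracPowCompBound A s R M := by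
  have hc : ∀ v k, |lam k ^ s * ⟪e k, R v⟫_ℝ| ≤ M * |⟪e k, v⟫_ℝ| := fun v k => by
    rw [hR, abs_mul, abs_mul, abs_of_pos (Real.rpow_pos_of_pos (hlam k) s), ← mul_assoc]
    exact mul_le_mul_of_nonneg_right (h k) (abs_nonneg _)
  refine ⟨hM, fun v => ?_⟩
  have hdom : R v ∈ (fracPow A s).domain := by
    rw [(fracPow_iff_series hA s e lam he (R v)).1]
    refine Summable.of_nonneg_of_le (fun k => sq_nonneg _) (fun k => ?_)
      ((hasSum_sq_coeff e v).summable.mul_left (M ^ 2))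
    have := pow_le_pow_left₀ (abs_nonneg _) (hc v k) 2
    rwa [mul_pow, sq_abs, sq_abs] at this
  refine ⟨hdom, norm_le_of_coeff e hM fun k => ?_⟩
  have h1 : (R v, fracPow A s ⟨R v, hdom⟩) ∈ (fracPow A s).graph :=
    (fracPow A s).mem_graph ⟨R v, hdom⟩
  rw [fracPow_graph hA] at h1
  rw [h1 _ _ (he k)]
  exact hc v k

theorem inner_integral_primitive {ω : ℝ} (hb : ExpType ω b) {u : ℝ → H}
    (hu : ContinuousOn u (Set.Ici 0)) {t : ℝ} (ht : 0 ≤ t) (f : H) :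
    ⟪f, ∫ s in (0 : ℝ)..t, (∫ r in (0 : ℝ)..(t - s), b r) • u s⟫_ℝ =
      ∫ s in (0 : ℝ)..t, primitive b (t - s) * ⟪f, u s⟫_ℝ := by
  rw [integral_smul_eq_primitive ht]
  have := ((innerSL ℝ f).intervalIntegral_comp_comm
    (intervalIntegrable_primitive_smul hb hu ht)).symm
  simpa [inner_smul_right] using this

/-- Paired with an eigenvector, the resolvent equation becomes the scalar Volterra equation with
datum ⟪f, v⟫, and uniqueness identifies the solution. So every resolvent family is diagonal. -/
theorem IsResolventFamily.inner_eq {ω : ℝ} (hA : OperatorAssumption A) (hb : ExpType ω b)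
    {S : ℝ → H →L[ℝ] H} (hS : IsResolventFamily A b S) {μ : ℝ} {f : H} (hf : IsEigenpair A μ f)
    {s : ℝ → ℝ} (hs : IsScalarResolvent b μ s) {t : ℝ} (ht : 0 ≤ t) (v : H) :
    ⟪f, S t v⟫_ℝ = s t * ⟪f, v⟫_ℝ := by
  have hu : ContinuousOn (fun t => ⟪f, S t v⟫_ℝ) (Set.Ici 0) :=
    continuousOn_const.inner (hS.continuousOn v)
  have key := volterra_unique (k := fun t => μ * primitive b t)
    (u := fun t => ⟪f, S t v⟫_ℝ - s t * ⟪f, v⟫_ℝ) ((continuous_primitive hb).const_mul μ)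
    (hu.sub (hs.continuous.mul_const _).continuousOn) (fun t ht => by
      obtain ⟨h1, h2⟩ := hS.equation v t ht
      have h3 := congrArg (fun w => ⟪f, w⟫_ℝ) h2
      simp only [inner_add_right, hA.inner_apply hf,
        inner_integral_primitive hb (hS.continuousOn v) ht f] at h3
      have h4 := hs.equation t ht
      have i1 : IntervalIntegrable (fun r => primitive b (t - r) * ⟪f, S r v⟫_ℝ) volume 0 t :=
        intervalIntegrable_primitive_smul hb hu ht
      have i2 : IntervalIntegrable (fun r => primitive b (t - r) * s r) volume 0 t :=
        intervalIntegrable_primitive_smul hb hs.continuous.continuousOn ht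
      have h5 : ∫ r in (0 : ℝ)..t, μ * primitive b (t - r) * (⟪f, S r v⟫_ℝ - s r * ⟪f, v⟫_ℝ) =
          μ * ((∫ r in (0 : ℝ)..t, primitive b (t - r) * ⟪f, S r v⟫_ℝ) -
            (∫ r in (0 : ℝ)..t, primitive b (t - r) * s r) * ⟪f, v⟫_ℝ) := by
        rw [← intervalIntegral.integral_mul_const, ← intervalIntegral.integral_sub i1
          (i2.mul_const _), ← intervalIntegral.integral_const_mul]
        refine intervalIntegral.integral_congr fun r _ => ?_
        ring
      rw [h5]
      linear_combination h3 - ⟪f, v⟫_ℝ * h4) t ht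
  linarith

/-- Strong continuity of the diagonal family is dominated convergence of coefficients. The integral
equals K(v − S(t)v) for the inverse K, which places it in the domain of `A`. -/
theorem exists_isResolventFamily_of_coeff {ω M : ℝ} (hA : OperatorAssumption A)
    (he : ∀ k, IsEigenpair A (lam k) (e k)) (hlam : ∀ k, 0 < lam k) (hb : ExpType ω b)
    (hσ : ∀ k, IsScalarResolvent b (lam k) (σ k)) (hM : ∀ k t, 0 ≤ t → |σ k t| ≤ M) :
    ∃ S : ℝ → H →L[ℝ] H, IsResolventFamily A b S := by
  choose S hS using fun t : ℝ => exists_diagonal e (r := fun k => σ k (max t 0))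
    (fun k => hM k _ (le_max_right _ _))
  have hc : ∀ v, Continuous fun t => S t v := fun v => continuous_iff_continuousAt.mpr fun t =>
    tendsto_of_coeff e (M := M + M) (Eventually.of_forall fun a k => hS a v k) (hS t v)
      (Eventually.of_forall fun a k => (abs_sub _ _).trans
        (add_le_add (hM k _ (le_max_right _ _)) (hM k _ (le_max_right _ _))))
      fun k => ((hσ k).continuous.comp (by fun_prop : Continuous fun a : ℝ => max a 0)).tendsto t
  refine ⟨S, fun v => (hc v).continuousOn, fun v t ht => ?_⟩
  obtain ⟨K, hK, hl, hr⟩ := hA.compactInverse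
  have hw : ∫ s in (0 : ℝ)..t, (∫ r in (0 : ℝ)..(t - s), b r) • S s v = K (v - S t v) := by
    refine eq_of_coeff e fun k => mul_left_cancel₀ (hlam k).ne' ?_
    obtain ⟨h1, h2⟩ := hr (v - S t v)
    have h3 := hA.inner_apply (he k) ⟨_, h1⟩
    rw [h2] at h3
    rw [← h3, inner_integral_primitive hb (hc v).continuousOn ht, inner_sub_right, hS,
      max_eq_left ht]
    have h4 : ∫ s in (0 : ℝ)..t, primitive b (t - s) * ⟪e k, S s v⟫_ℝ =
        (∫ s in (0 : ℝ)..t, primitive b (t - s) * σ k s) * ⟪e k, v⟫_ℝ := by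
      rw [← intervalIntegral.integral_mul_const]
      refine intervalIntegral.integral_congr fun s hs => ?_
      rw [Set.uIcc_of_le ht] at hs
      simp only [hS, max_eq_left hs.1]
      ring
    rw [h4]
    linear_combination ⟪e k, v⟫_ℝ * (hσ k).equation t ht
  rw [hw]
  obtain ⟨h1, h2⟩ := hr (v - S t v)
  exact ⟨h1, by rw [h2]; abel⟩

/-- The bound M/t on the scalar derivatives bounds the difference quotients near t uniformly in k,
so their coefficientwise convergence becomes norm convergence. -/
theorem IsResolventFamily.exists_strongDeriv {M : ℝ} (hA : OperatorAssumption A)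
    (he : ∀ k, IsEigenpair A (lam k) (e k)) (hb : ExpType 0 b)
    (hσ : ∀ k, IsScalarResolvent b (lam k) (σ k)) (hM0 : 0 ≤ M)
    (hM : ∀ k t, 0 < t → |lam k * conv b (σ k) t| ≤ M / t) {S : ℝ → H →L[ℝ] H}
    (hS : IsResolventFamily A b S) :
    ∃ D : ℝ → H →L[ℝ] H, IsStrongDeriv S D ∧
      ∀ t, 0 < t → ∀ v k, ⟪e k, D t v⟫_ℝ = -(lam k * conv b (σ k) t) * ⟪e k, v⟫_ℝ := by
  have hD : ∀ t : ℝ, ∃ D : H →L[ℝ] H, 0 < t →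
      ∀ v k, ⟪e k, D v⟫_ℝ = -(lam k * conv b (σ k) t) * ⟪e k, v⟫_ℝ := fun t => by
    by_cases ht : 0 < t
    · obtain ⟨D, hD⟩ := exists_diagonal e (r := fun k => -(lam k * conv b (σ k) t)) (M := M / t)
        fun k => by rw [abs_neg]; exact hM k t ht
      exact ⟨D, fun _ => hD⟩
    · exact ⟨0, fun h => absurd h ht⟩
  choose D hD using hD
  refine ⟨D, fun v t ht => ?_, hD⟩
  rw [hasDerivAt_iff_tendsto_slope]
  have hlip : ∀ k, ∀ r, t / 2 < r → |slope (σ k) t r| ≤ M / (t / 2) := fun k r hr => by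
    have h1 := (convex_Ioi (t / 2)).norm_image_sub_le_of_norm_hasDerivWithin_le
      (f := σ k) (f' := fun x => -(lam k * conv b (σ k) x)) (C := M / (t / 2))
      (fun x hx => ((hσ k).hasDerivAt hb ((half_pos ht).trans hx)).hasDerivWithinAt)
      (fun x hx => by
        have hx' : t / 2 < x := hx
        rw [norm_neg, Real.norm_eq_abs]
        refine (hM k x ((half_pos ht).trans hx')).trans ?_
        exact div_le_div_of_nonneg_left hM0 (half_pos ht) hx'.le)
      (Set.mem_Ioi.mpr (by linarith : t / 2 < t)) (Set.mem_Ioi.mpr hr)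
    rw [slope_def_field, abs_div]
    refine div_le_of_le_mul₀ (abs_nonneg _) (by positivity) ?_
    simpa [Real.norm_eq_abs] using h1
  have hev : ∀ᶠ r in 𝓝[≠] t, t / 2 < r :=
    eventually_nhdsWithin_of_eventually_nhds (Ioi_mem_nhds (by linarith))
  refine tendsto_of_coeff e (v := v) (c := fun r k => slope (σ k) t r) (M := M / (t / 2) + M / t) ?_
    (hD t ht v) ?_ fun k => hasDerivAt_iff_tendsto_slope.mp ((hσ k).hasDerivAt hb ht)
  · filter_upwards [hev] with r hr k
    rw [slope_def_module, inner_smul_right, inner_sub_right, hS.inner_eq hA hb (he k) (hσ k) ht.le,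
      hS.inner_eq hA hb (he k) (hσ k) ((half_pos ht).trans hr).le, slope_def_field]
    ring
  · filter_upwards [hev] with r hr k
    refine (abs_sub _ _).trans (add_le_add (hlip k r hr) ?_)
    rw [abs_neg]
    exact hM k t ht

end Diagonal

/-! ### Interpolation of the scalar bounds -/

theorem le_rpow_mul_rpow {x p q θ : ℝ} (hx : 0 ≤ x) (hp : x ≤ p) (hq : x ≤ q) (h0 : 0 ≤ θ)
    (h1 : θ ≤ 1) : x ≤ p ^ (1 - θ) * q ^ θ := by
  have h2 : x = x ^ (1 - θ) * x ^ θ := by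
    rw [← Real.rpow_add_of_nonneg hx (by linarith) h0]
    simp
  rw [h2]
  have h3 := hx.trans hp
  gcongr

/-- Interpolation with weight θ = sρ: the second bound contributes λ^{−s} t^{−sρ}. -/
theorem rpow_mul_le_smoothing {x M lam t ρ s : ℝ} (hx : 0 ≤ x) (hM : 0 < M) (hlam : 0 < lam)
    (ht : 0 < t) (hρ : 0 < ρ) (h1 : x ≤ M) (h2 : x ≤ M * lam ^ (-(1 / ρ)) / t)
    (hs : s ∈ Set.Icc 0 (1 / ρ)) : lam ^ s * x ≤ M * t ^ (-(s * ρ)) := by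
  have h3 := le_rpow_mul_rpow hx h1 h2 (mul_nonneg hs.1 hρ.le) ((le_div_iff₀ hρ).mp hs.2)
  have hl := Real.rpow_pos_of_pos hlam (-(1 / ρ))
  rw [Real.div_rpow (by positivity) ht.le, Real.mul_rpow hM.le hl.le, ← Real.rpow_mul hlam.le,
    show -(1 / ρ) * (s * ρ) = -s by field_simp] at h3
  refine (mul_le_mul_of_nonneg_left h3 (Real.rpow_nonneg hlam.le s)).trans (le_of_eq ?_)
  rw [Real.rpow_neg hlam.le, Real.rpow_neg ht.le]
  have h4 := Real.rpow_pos_of_pos hlam s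
  have h5 := Real.rpow_pos_of_pos ht (s * ρ)
  have h6 : M ^ (1 - s * ρ) * M ^ (s * ρ) = M := by
    rw [← Real.rpow_add hM]
    simp
  field_simp
  exact h6

/-- Interpolation with weight θ = s between M/t and λBM. In (I), B is the L¹ norm of `b` on (0, t);
in (II) it is t^{ρ−1}. -/
theorem rpow_neg_mul_le {x M B lam t s : ℝ} (hx : 0 ≤ x) (hM : 0 < M) (hB : 0 ≤ B) (hlam : 0 < lam)
    (ht : 0 < t) (h1 : x ≤ M / t) (h2 : x ≤ lam * (B * M)) (hs : s ∈ Set.Icc (0 : ℝ) 1) :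
    lam ^ (-s) * x ≤ M * B ^ s * t ^ (s - 1) := by
  have h3 := le_rpow_mul_rpow hx h1 h2 hs.1 hs.2
  rw [Real.div_rpow hM.le ht.le, Real.mul_rpow hlam.le (by positivity),
    Real.mul_rpow hB hM.le] at h3
  refine (mul_le_mul_of_nonneg_left h3 (Real.rpow_nonneg hlam.le (-s))).trans (le_of_eq ?_)
  have h4 := Real.rpow_pos_of_pos hlam s
  have h5 := Real.rpow_pos_of_pos ht (1 - s)
  have h6 : M ^ (1 - s) * M ^ s = M := by
    rw [← Real.rpow_add hM]
    simp
  rw [Real.rpow_neg hlam.le, ← neg_sub 1 s, Real.rpow_neg ht.le]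
  field_simp
  linear_combination B ^ s * h6

/-! ### Uniform bounds for the scalar resolvents -/

theorem IsParabolicKernel.exists_uniform_bound {b : ℝ → ℝ} {δ C : ℝ} (h : IsParabolicKernel b δ C) :
    ∃ M : ℝ, 0 < M ∧ ∀ μ s, 0 < μ → IsScalarResolvent b μ s →
      (∀ t, 0 ≤ t → |s t| ≤ M) ∧ (∀ t, 0 < t → |μ * conv b s t| ≤ M / t) ∧
      ∀ t, 0 < t → |μ * conv b s t| ≤ μ * ((∫ r in (0 : ℝ)..t, |b r|) * M) := by
  -- The maximum with 1 covers t = 0, where s(0) = 1.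
  refine ⟨max (Real.exp 1 / 2 * (3 / δ * symbConst δ C)) 1, by positivity, fun μ s hμ hs => ?_⟩
  have h1 : ∀ t, 0 ≤ t → |s t| ≤ max (Real.exp 1 / 2 * (3 / δ * symbConst δ C)) 1 := fun t ht => by
    rcases ht.eq_or_lt with rfl | ht
    · rw [hs.apply_zero, abs_one]
      exact le_max_right _ _
    · exact (hs.abs_le_const h hμ ht).1.trans (le_max_left _ _)
  refine ⟨h1, fun t ht => (hs.abs_le_const h hμ ht).2.trans ?_, fun t ht => ?_⟩
  · gcongr
    exact le_max_left _ _
  · rw [abs_mul, abs_of_pos hμ]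
    exact mul_le_mul_of_nonneg_left (abs_conv_le h.expType ht.le fun r hr _ => h1 r hr) hμ.le

theorem IsParabolicKernel.exists_isResolventFamily {H : Type*} [NormedAddCommGroup H]
    [InnerProductSpace ℝ H] [CompleteSpace H] {A : H →ₗ.[ℝ] H} (hA : OperatorAssumption A)
    {b : ℝ → ℝ} {δ C : ℝ} (h : IsParabolicKernel b δ C) :
    ∃ S : ℝ → H →L[ℝ] H, IsResolventFamily A b S := by
  obtain ⟨ι, e, lam, L, he, hlam, -⟩ := hA.exists_eigenbasis
  choose σ hσ using fun k => exists_isScalarResolvent h.expType (lam k)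
  obtain ⟨M, -, hM⟩ := h.exists_uniform_bound
  exact exists_isResolventFamily_of_coeff hA he hlam h.expType hσ
    fun k => (hM _ _ (hlam k) (hσ k)).1

theorem one_le_of_eq_sectorAngle {b : ℝ → ℝ} {ρ : ℝ} (h : ρ = 1 + 2 / Real.pi * sectorAngle b) :
    1 ≤ ρ := by
  have : 0 ≤ sectorAngle b := Real.sSup_nonneg (by
    rintro _ ⟨z, -, rfl⟩
    exact abs_nonneg _)
  have hpi := Real.pi_pos
  rw [h]
  have : 0 ≤ 2 / Real.pi * sectorAngle b := by positivity
  linarith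

end Volterra

/-! ### The theorem for both classes of kernels -/

theorem lemma4p4 {H : Type*} [NormedAddCommGroup H] [InnerProductSpace ℝ H] [CompleteSpace H]
    (A : H →ₗ.[ℝ] H) (hA : Volterra.OperatorAssumption A) (b : ℝ → ℝ) (ρ : ℝ) :
    (Volterra.KernelAssumption b ρ →
      (∃ S : ℝ → H →L[ℝ] H, Volterra.IsResolventFamily A b S) ∧
      ∀ S : ℝ → H →L[ℝ] H, Volterra.IsResolventFamily A b S →
        ∃ D : ℝ → H →L[ℝ] H, Volterra.IsStrongDeriv S D ∧
        ∃ C : ℝ, 0 < C ∧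
          (∀ t : ℝ, 0 < t → ∀ s ∈ Set.Icc 0 (1 / ρ),
            Volterra.FracPowCompBound A s (S t) (C * t ^ (-(s * ρ)))) ∧
          (∀ t : ℝ, 0 < t → ∀ s ∈ Set.Icc 0 (1 / ρ),
            Volterra.FracPowCompBound A s (D t) (C * t ^ (-(s * ρ) - 1))) ∧
          (∀ t : ℝ, 0 < t → ∀ s ∈ Set.Icc (0 : ℝ) 1,
            Volterra.FracPowCompBound A (-s) (D t)
              (C * (∫ r in (0 : ℝ)..t, |b r|) ^ s * t ^ (s - 1)))) ∧
    (Volterra.MonotoneKernelAssumption b →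
      ρ = 1 + 2 / Real.pi * Volterra.sectorAngle b →
      ((fun x : ℝ => Volterra.laplace b (x : ℂ)) =Θ[Filter.atTop] fun x : ℝ => x ^ (1 - ρ)) →
      (∃ S : ℝ → H →L[ℝ] H, Volterra.IsResolventFamily A b S) ∧
      ∀ S : ℝ → H →L[ℝ] H, Volterra.IsResolventFamily A b S →
        ∃ D : ℝ → H →L[ℝ] H, Volterra.IsStrongDeriv S D ∧
        ∃ C : ℝ, 0 < C ∧ ∀ t : ℝ, 0 < t → ∀ s ∈ Set.Icc (0 : ℝ) 1,
          Volterra.FracPowCompBound A (-s) (D t) (C * t ^ (ρ * s - 1))) := by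
  refine ⟨fun h => ?_, fun h hρ hΘ => ?_⟩
  · obtain ⟨δ, C₀, hp⟩ := h.exists_isParabolicKernel
    refine ⟨hp.exists_isResolventFamily hA, fun S hS => ?_⟩
    obtain ⟨c, hc, hlow⟩ := h.exists_lower_bound hp
    have hρ : 0 < ρ := by linarith [h.one_lt]
    obtain ⟨N, hN, hsm⟩ := Volterra.exists_smoothing_bound hp h.one_lt h.lt_two hc hlow
    obtain ⟨M, hM, hbd⟩ := hp.exists_uniform_bound
    obtain ⟨ι, e, lam, L, he, hlam, -⟩ := hA.exists_eigenbasis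
    choose σ hσ using fun k => Volterra.exists_isScalarResolvent hp.expType (lam k)
    obtain ⟨D, hSD, hD⟩ := hS.exists_strongDeriv hA he hp.expType hσ hM.le
      fun k => (hbd _ _ (hlam k) (hσ k)).2.1
    have hMN : M ≤ M + N := by linarith
    have hMN0 : 0 < M + N := by linarith
    refine ⟨D, hSD, M + N, hMN0, fun t ht s hs => ?_, fun t ht s hs => ?_, fun t ht s hs => ?_⟩
    · refine Volterra.fracPowCompBound_of_coeff hA he hlam (by positivity)
        (fun v k => hS.inner_eq hA hp.expType (he k) (hσ k) ht.le v) fun k => ?_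
      have hl := Real.rpow_pos_of_pos (hlam k) (-(1 / ρ))
      refine Volterra.rpow_mul_le_smoothing (abs_nonneg _) hMN0 (hlam k) ht hρ
        (((hbd _ _ (hlam k) (hσ k)).1 t ht.le).trans hMN)
        ((hsm _ _ (hlam k) (hσ k) t ht).1.trans ?_) hs
      gcongr
      linarith
    · refine Volterra.fracPowCompBound_of_coeff hA he hlam (by positivity) (hD t ht) fun k => ?_
      have hl := Real.rpow_pos_of_pos (hlam k) (-(1 / ρ))
      rw [abs_neg]
      -- Both endpoint bounds for s' are those for s divided by t, so the same interpolation applies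
      -- with an extra factor t⁻¹.
      refine (Volterra.rpow_mul_le_smoothing (M := (M + N) / t) (abs_nonneg _) (by positivity)
        (hlam k) ht hρ (((hbd _ _ (hlam k) (hσ k)).2.1 t ht).trans (by gcongr))
        ((hsm _ _ (hlam k) (hσ k) t ht).2.trans ?_) hs).trans (le_of_eq ?_)
      · rw [div_mul_eq_mul_div, div_div, ← sq]
        gcongr
        linarith
      · rw [Real.rpow_sub_one ht.ne']
        ring
    · have hB : 0 ≤ ∫ r in (0 : ℝ)..t, |b r| :=
        intervalIntegral.integral_nonneg ht.le fun r _ => abs_nonneg _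
      refine Volterra.fracPowCompBound_of_coeff hA he hlam (by positivity) (hD t ht) fun k => ?_
      rw [abs_neg]
      refine Volterra.rpow_neg_mul_le (abs_nonneg _) hMN0 hB (hlam k) ht
        (((hbd _ _ (hlam k) (hσ k)).2.1 t ht).trans (by gcongr))
        (((hbd _ _ (hlam k) (hσ k)).2.2 t ht).trans ?_) hs
      have := (hlam k).le
      gcongr
  · obtain ⟨δ, C₀, hp⟩ := h.exists_isParabolicKernel
    refine ⟨hp.exists_isResolventFamily hA, fun S hS => ?_⟩
    have hρ1 := Volterra.one_le_of_eq_sectorAngle hρ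
    obtain ⟨t₀, K, ht₀, hK, hint⟩ := h.exists_integral_le_rpow hΘ
    obtain ⟨M, hM, hbd⟩ := hp.exists_uniform_bound
    obtain ⟨ι, e, lam, L, he, hlam, hL⟩ := hA.exists_eigenbasis
    choose σ hσ using fun k => Volterra.exists_isScalarResolvent hp.expType (lam k)
    obtain ⟨D, hSD, hD⟩ := hS.exists_strongDeriv hA he hp.expType hσ hM.le
      fun k => (hbd _ _ (hlam k) (hσ k)).2.1
    have ht₀ρ := Real.rpow_pos_of_pos ht₀ (-ρ)
    have hQ : 0 < M * (1 + K + |L| * t₀ ^ (-ρ)) := by positivity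
    refine ⟨D, hSD, M * (1 + K + |L| * t₀ ^ (-ρ)), hQ, fun t ht s hs => ?_⟩
    refine Volterra.fracPowCompBound_of_coeff hA he hlam (by positivity) (hD t ht) fun k => ?_
    rw [abs_neg]
    have hl := hlam k
    have htρ := Real.rpow_pos_of_pos ht (ρ - 1)
    obtain ⟨-, h1, h2⟩ := hbd _ _ hl (hσ k)
    -- This extends the small-time bound to all t with B = t^{ρ−1}. For t > t₀ one writes 1/t =
    -- t^{ρ−1} t^{−ρ} ≤ t^{ρ−1} t₀^{−ρ} and pays for the missing factor λ_k with 1 ≤ λ_k |L|.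
    have h3 : |lam k * Volterra.conv b (σ k) t| ≤
        lam k * (t ^ (ρ - 1) * (M * (1 + K + |L| * t₀ ^ (-ρ)))) := by
      rcases le_or_gt t t₀ with htt | htt
      · calc |lam k * Volterra.conv b (σ k) t| ≤ lam k * ((K * t ^ (ρ - 1)) * M) := by
              refine (h2 t ht).trans ?_
              gcongr
              exact hint t ht htt
          _ = lam k * (t ^ (ρ - 1) * (M * K)) := by ring
          _ ≤ _ := by
              gcongr
              have : 0 ≤ |L| * t₀ ^ (-ρ) := by positivity
              linarith
      · have h4 : (1 : ℝ) ≤ lam k * |L| := by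
          have := (hL k).trans (le_abs_self L)
          rwa [inv_le_iff_one_le_mul₀' hl] at this
        have h5 : t ^ (-ρ) ≤ t₀ ^ (-ρ) :=
          Real.rpow_le_rpow_of_nonpos ht₀ htt.le (by linarith)
        have h6 : t⁻¹ = t ^ (ρ - 1) * t ^ (-ρ) := by
          rw [← Real.rpow_add ht, ← Real.rpow_neg_one]
          congr 1
          ring
        calc |lam k * Volterra.conv b (σ k) t| ≤ 1 * (M * t⁻¹) := by
              rw [one_mul, ← div_eq_mul_inv]
              exact h1 t ht
          _ ≤ (lam k * |L|) * (M * (t ^ (ρ - 1) * t₀ ^ (-ρ))) := by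
              rw [h6]
              gcongr
          _ = lam k * (t ^ (ρ - 1) * (M * (|L| * t₀ ^ (-ρ)))) := by ring
          _ ≤ _ := by
              gcongr
              linarith
    refine (Volterra.rpow_neg_mul_le (abs_nonneg _) hQ htρ.le hl ht ((h1 t ht).trans ?_) h3 hs).trans
      (le_of_eq ?_)
    · gcongr
      have : 0 ≤ K + |L| * t₀ ^ (-ρ) := by positivity
      exact le_mul_of_one_le_right hM.le (by linarith)
    -- The exponents add up to (ρ − 1)s + s − 1 = ρs − 1.
    · rw [mul_assoc, ← Real.rpow_mul ht.le, ← Real.rpow_add ht]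
      congr 2
      ring
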